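/- Let $N\ge 1$, $T>0$, $r\in[1,\infty)$, $Q_T=\mathbb R^N\times(0,T)$, and consider $$\partial_t u-\mathfrak L[\varphi(u)]=g\ \text{ in } Q_T,\qquad u(\cdot,0)=u_0\ \text{ on }\mathbb R^N, \tag{GPME}$$ where $\mathfrak L=c\Delta+\mathcal L^\mu$, $c\in\{0,1\}$, $\mathcal L^\mu[\psi](x)=\int_{z\ne0}\big(\psi(x+z)-\psi(x)-z\cdot D\psi(x)\mathbf 1_{|z|\le1}\big)\,d\mu(z)$, under the following assumptions: * $\varphi:\mathbb R\to\mathbb R$ is nondecreasing and locally $\gamma$-Hölder continuous for some $\gamma\in(0,1]$; * $g$ is measurable on $Q_T$ with $\int_0^T\big(\|g(\cdot,t)\|_{L^1(\mathbb R^N)}+\|g(\cdot,t)\|_{L^\infty(\mathbb R^N)}\big)dt<\infty$, and $u_0\in L^1(\mathbb R^N)\cap L^\infty(\mathbb R^N)$; * $\mu$ is a nonnegative symmetric Radon measure on $\mathbb R^N\setminus\{0\}$ with $\int_{0<|z|\le1}|z|^2d\mu+\int_{|z|>1}d\mu<\infty$. A function $u\in L^1_{\rm loc}(\mathbb R^N\times[0,T))$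 is a *very weak solution* of (GPME) if for all $\psi\in C_c^\infty(\mathbb R^N\times[0,T))$ one has $\varphi(u)\mathfrak L[\psi]\in L^1(Q_T)$ and $$\iint_{Q_T}\big(u\,\partial_t\psi+\varphi(u)\mathfrak L[\psi]+g\psi\big)\,dx\,dt+\int_{\mathbb R^N}u_0(x)\psi(x,0)\,dx=0.$$ *Schemes.* For every $h>0$ let $0=t_0<t_1<\dots<t_J=T$ be a time grid (depending on $h$), $\Delta t_j=t_j-t_{j-1}$, such that $\Delta t=\max_j\Delta t_j\to0$ as $h\to0^+$. Let $x_\beta=h\beta$ ($\beta\in\mathbb Z^N$) and $R_h=h(-\tfrac12,\tfrac12]^N$, and let $$\mathcal L^h[\psi](x)=\sum_{0\neq\eta\in\mathbb Z^N}\big(\psi(x+z_\eta)-\psi(x)\big)\omega_{\eta,h},\qquad z_{-\eta}=-z_\eta\in h\mathbb Z^N,\quad \omega_{\eta,h}=\omega_{-\eta,h}\ge0,\quad \sum_{\eta\ne0}\omega_{\eta,h}<\infty.$$ Let $U^0_\beta=h^{-N}\int_{x_\beta+R_h}u_0\,dx$ and $G^j_\beta=(h^N\Delta t_j)^{-1}\int_{t_{j-1}}^{t_j}\int_{x_\beta+R_h}g\,dx\,d\tau$,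 and let $(U^j_\beta)$ be a solution of $$U^j_\beta=U^{j-1}_\beta+\Delta t_j\,\mathcal L^h[\varphi(U^j_\cdot)]_\beta+\Delta t_j\,G^j_\beta,\qquad \beta\in\mathbb Z^N,\ 1\le j\le J,$$ with $\sum_\beta|U^j_\beta|<\infty$ for all $0\le j\le J$. Let $\widetilde{\overline U}_h:\mathbb R^N\times[0,T]\to\mathbb R$ be its interpolant which is constant on each cell $x_\beta+R_h$ in space and piecewise linear in time: with $\overline{U^j}=\sum_\beta U^j_\beta\mathbf 1_{x_\beta+R_h}$, it equals $\overline{U^0}$ at $t=0$ and $\overline{U^{j-1}}+\frac{t-t_{j-1}}{\Delta t_j}\big(\overline{U^j}-\overline{U^{j-1}}\big)$ for $t\in(t_{j-1},t_j]$. Consider the weight conditions $$\text{(a)}\ \sup_{0<h<1}\Big\{\sum_{h\le|z_\eta|\le1}|z_\eta|^2\omega_{\eta,h}+\sum_{|z_\eta|>1}\omega_{\eta,h}\Big\}<\infty,\qquad \text{(b)}\ \sup_{0<h<1}\Big\{\sum_{h\le|z_\eta|\le1}|z_\eta|^2\omega_{\eta,h}+\sum_{|z_\eta|>1}|z_\eta|\omega_{\eta,h}\Big\}<\infty,$$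 $$\text{(c)}_\alpha\ \text{(a) holds and }\ \sup_{R>1}\sup_{0<h<1}\Big\{R^{\alpha-2}\sum_{1<|z_\eta|\le R}|z_\eta|^2\omega_{\eta,h}+R^\alpha\sum_{|z_\eta|>R}\omega_{\eta,h}\Big\}<\infty .$$ Assume that one of the following holds: 1. $\mathcal L^h=\Delta_h$ for all $h>0$, where $\Delta_h\psi(x)=\sum_{i=1}^N h^{-2}\big(\psi(x+he_i)+\psi(x-he_i)-2\psi(x)\big)$ (with weights satisfying (a)), and $\frac{(N-2)^+}{N}<\gamma$; 2. (b) holds and $\frac{N-1}{N}<\gamma$; 3. (c)$_\alpha$ holds for some $\alpha\in(0,2)$ and $\frac{(N-\alpha)^+}{N}<\gamma$. **Theorem.** Assume moreover that the schemes are consistent, i.e. $\mathcal L^h[\psi]\to\mathfrak L[\psi]$ in $L^1(\mathbb R^N)$ as $h\to0^+$ for every $\psi\in C_c^\infty(\mathbb R^N)$, and that (GPME) has at most one very weak solution in $L^1(Q_T)\cap L^\infty(Q_T)\cap C([0,T];L^r(\mathbb R^N))$ (up to equality a.e. in $Q_T$). Then $\widetilde{\overline U}_h\in C([0,T];L^r(\mathbb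 R^N))$ for all $h>0$, there is a unique very weak solution $u$ of (GPME) in that class, and $$\widetilde{\overline U}_h\to u\quad\text{in } C([0,T];L^r(\mathbb R^N))\ \text{ as } h\to0^+ ,$$ that is, $\sup_{t\in[0,T]}\|\widetilde{\overline U}_h(\cdot,t)-u(\cdot,t)\|_{L^r(\mathbb R^N)}\to0$ for the whole family. -/

import Mathlib

open MeasureTheory Filter Topology Set
open scoped ContDiff

noncomputable section

namespace GPME

/-- The space `ℝ^N` with its Euclidean norm and Lebesgue measure. -/
abbrev Space (N : ℕ) := EuclideanSpace ℝ (Fin N)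

/-- Multi-indices in `ℤ^N`. -/
abbrev Idx (N : ℕ) := Fin N → ℤ

/-- The space-time cylinder `Q_T = (0,T) × ℝ^N` (time is the first coordinate throughout). -/
def cylinder (N : ℕ) (T : ℝ) : Set (ℝ × Space N) := Ioo 0 T ×ˢ univ

/-! ### The continuous operator -/

/-- `μ` is a nonnegative symmetric Radon measure on `ℝ^N ∖ {0}` with
`∫_{0<|z|≤1} |z|² dμ + ∫_{|z|>1} dμ < ∞`. A measure on `ℝ^N ∖ {0}` is a measure on `ℝ^N` which does
not charge the origin; that it is finite on compact subsets of `ℝ^N ∖ {0}` (hence Radon) follows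
from the integral condition. -/
structure IsSymmLevyMeasure {N : ℕ} (μ : Measure (Space N)) : Prop where
  zero : μ {0} = 0
  symm : μ.map (fun z => -z) = μ
  levy : (∫⁻ z in {z : Space N | 0 < ‖z‖ ∧ ‖z‖ ≤ 1}, ENNReal.ofReal (‖z‖ ^ 2) ∂μ)
      + μ {z : Space N | 1 < ‖z‖} < ⊤

/-- The Levy operator
`𝓛^μ[ψ](x) = ∫_{z ≠ 0} (ψ(x+z) - ψ(x) - z·Dψ(x) 1_{|z|≤1}) dμ(z)`. -/
def levyOp {N : ℕ} (μ : Measure (Space N)) (ψ : Space N → ℝ) (x : Space N) : ℝ :=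
  ∫ z in {z : Space N | z ≠ 0},
    (ψ (x + z) - ψ x - (if ‖z‖ ≤ 1 then fderiv ℝ ψ x z else 0)) ∂μ

/-- The diffusion operator `𝔏 = c Δ + 𝓛^μ`. -/
def diffusionOp {N : ℕ} (c : ℝ) (μ : Measure (Space N)) (ψ : Space N → ℝ) (x : Space N) : ℝ :=
  c * Laplacian.laplacian ψ x + levyOp μ ψ x

/-! ### Assumptions on the nonlinearity and on the data -/

/-- `φ ∈ C^{0,γ}_loc(ℝ)` and `φ` is nondecreasing. -/
structure AdmissibleNonlinearity (γ : NNReal) (φ : ℝ → ℝ) : Prop where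
  holder : ∀ K : Set ℝ, IsCompact K → ∃ C : NNReal, HolderOnWith C γ φ K
  mono : Monotone φ

/-- `g` is measurable on `Q_T` and `∫_0^T (‖g(·,t)‖_{L¹} + ‖g(·,t)‖_{L^∞}) dt < ∞`. -/
structure AdmissibleSource {N : ℕ} (T : ℝ) (g : ℝ → Space N → ℝ) : Prop where
  meas : AEStronglyMeasurable (fun p : ℝ × Space N => g p.1 p.2)
    (volume.restrict (cylinder N T))
  bound : (∫⁻ t in Ioo 0 T, (eLpNorm (g t) 1 volume + eLpNorm (g t) ⊤ volume)) < ⊤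

/-- `u₀ ∈ L¹(ℝ^N) ∩ L^∞(ℝ^N)`. -/
structure AdmissibleInitial {N : ℕ} (u₀ : Space N → ℝ) : Prop where
  memL1 : MemLp u₀ 1 volume
  memLinfty : MemLp u₀ ⊤ volume

/-! ### Very weak solutions -/

/-- Test functions in `C_c^∞(ℝ^N × [0,T))`, as (restrictions to `t ≥ 0` of) smooth functions on
`ℝ × ℝ^N` with compact support in `{t < T}`. They need not vanish at `t = 0`. -/
structure IsTestFunction {N : ℕ} (T : ℝ) (ψ : ℝ × Space N → ℝ) : Prop where
  smooth : ContDiff ℝ ∞ ψ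
  compact : HasCompactSupport ψ
  supp : tsupport ψ ⊆ Iio T ×ˢ univ

/-- Very weak solutions of `∂ₜu - 𝔏[φ(u)] = g` in `Q_T`, `u(·,0) = u₀`. -/
structure IsVeryWeakSolution {N : ℕ} (T c : ℝ) (μ : Measure (Space N)) (φ : ℝ → ℝ)
    (u₀ : Space N → ℝ) (g : ℝ → Space N → ℝ) (u : ℝ → Space N → ℝ) : Prop where
  locInt : LocallyIntegrableOn (fun p : ℝ × Space N => u p.1 p.2) (Ico 0 T ×ˢ univ) volume
  opInt : ∀ ψ : ℝ × Space N → ℝ, IsTestFunction T ψ →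
    IntegrableOn (fun p : ℝ × Space N =>
      φ (u p.1 p.2) * diffusionOp c μ (fun y => ψ (p.1, y)) p.2) (cylinder N T) volume
  weakEq : ∀ ψ : ℝ × Space N → ℝ, IsTestFunction T ψ →
    (∫ p in cylinder N T,
        (u p.1 p.2 * deriv (fun s => ψ (s, p.2)) p.1
          + φ (u p.1 p.2) * diffusionOp c μ (fun y => ψ (p.1, y)) p.2
          + g p.1 p.2 * ψ p))
      + ∫ x, u₀ x * ψ (0, x) = 0

/-- `u ∈ C([0,T]; L^r(ℝ^N))`. -/
structure MemCtLp {N : ℕ} (T : ℝ) (r : ENNReal) (u : ℝ → Space N → ℝ) : Prop where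
  memLp : ∀ t ∈ Icc 0 T, MemLp (u t) r volume
  cont : ∀ t ∈ Icc 0 T,
    Tendsto (fun s => eLpNorm (u s - u t) r volume) (𝓝[Icc 0 T] t) (𝓝 0)

/-- The distance in `C([0,T]; L^r(ℝ^N))`: `sup_{t ∈ [0,T]} ‖u(·,t) - v(·,t)‖_{L^r}`. -/
def distCtLp {N : ℕ} (T : ℝ) (r : ENNReal) (u v : ℝ → Space N → ℝ) : ENNReal :=
  ⨆ t ∈ Icc 0 T, eLpNorm (u t - v t) r volume

/-- `u ∈ L¹(Q_T) ∩ L^∞(Q_T) ∩ C([0,T]; L^r(ℝ^N))`. -/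
structure MemSolutionClass {N : ℕ} (T : ℝ) (r : ENNReal) (u : ℝ → Space N → ℝ) : Prop where
  memL1 : MemLp (fun p : ℝ × Space N => u p.1 p.2) 1 (volume.restrict (cylinder N T))
  memLinfty : MemLp (fun p : ℝ × Space N => u p.1 p.2) ⊤ (volume.restrict (cylinder N T))
  memCt : MemCtLp T r u

/-! ### Grids -/

/-- A (possibly nonuniform) time grid `0 = t_0 < t_1 < ⋯ < t_J = T`; only the values `node j` with
`j ≤ J` are meaningful. -/
structure TimeGrid (T : ℝ) where
  J : ℕ
  node : ℕ → ℝ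
  node_zero : node 0 = 0
  node_last : node J = T
  node_lt : ∀ j < J, node j < node (j + 1)

/-- The time step `Δt_{j+1} = t_{j+1} - t_j`. -/
def TimeGrid.step {T : ℝ} (G : TimeGrid T) (j : ℕ) : ℝ := G.node (j + 1) - G.node j

/-- The mesh size `Δt = max_j Δt_j`. -/
def TimeGrid.mesh {T : ℝ} (G : TimeGrid T) : ℝ := ⨆ j : Fin G.J, G.step j

/-- The grid point `x_β = h β ∈ 𝓖_h = h ℤ^N`. -/
def gridPoint {N : ℕ} (h : ℝ) (β : Idx N) : Space N := WithLp.toLp 2 (fun i => h * (β i : ℝ))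

/-- The cell `x_β + R_h`, `R_h = h (-1/2, 1/2]^N`. -/
def gridCell {N : ℕ} (h : ℝ) (β : Idx N) : Set (Space N) :=
  {x | ∀ i, x i - h * β i ∈ Ioc (-(h / 2)) (h / 2)}

/-- The index of the unique cell containing `x` (for `h > 0`). -/
def cellIndex {N : ℕ} (h : ℝ) (x : Space N) : Idx N := fun i => ⌈x i / h - 1 / 2⌉

theorem mem_gridCell_iff {N : ℕ} {h : ℝ} (hh : 0 < h) (β : Idx N) (x : Space N) :
    x ∈ gridCell h β ↔ cellIndex h x = β := by
  unfold gridCell cellIndex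
  rw [funext_iff]
  refine forall_congr' fun i => ?_
  rw [Int.ceil_eq_iff, mem_Ioc]
  have e : x i = h * (x i / h) := by field_simp
  constructor
  · rintro ⟨h1, h2⟩
    rw [e] at h1 h2
    constructor
    · by_contra hc
      nlinarith
    · by_contra hc
      nlinarith
  · rintro ⟨h1, h2⟩
    rw [e]
    constructor <;> nlinarith

/-- The piecewise constant interpolant `Ū(x) = ∑_β 1_{x_β + R_h}(x) U_β`. -/
def spaceInterp {N : ℕ} (h : ℝ) (U : Idx N → ℝ) (x : Space N) : ℝ := U (cellIndex h x)

theorem spaceInterp_eq_tsum {N : ℕ} {h : ℝ} (hh : 0 < h) (U : Idx N → ℝ) (x : Space N) :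
    spaceInterp h U x = ∑' β : Idx N, (gridCell h β).indicator (fun _ => U β) x := by
  rw [tsum_eq_single (cellIndex h x)]
  · rw [indicator_of_mem ((mem_gridCell_iff hh _ x).2 rfl)]
    rfl
  · intro β hβ
    exact indicator_of_notMem (fun hx => hβ ((mem_gridCell_iff hh β x).1 hx).symm) _

/-- The interpolant of `U_β^j`, piecewise linear in time and piecewise constant in space. -/
def interpolant {N : ℕ} {T : ℝ} (h : ℝ) (G : TimeGrid T) (U : ℕ → Idx N → ℝ)
    (t : ℝ) (x : Space N) : ℝ :=
  ({G.node 0} : Set ℝ).indicator (fun _ => spaceInterp h (U 0) x) t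
    + ∑ j ∈ Finset.range G.J, (Ioc (G.node j) (G.node (j + 1))).indicator
        (fun s => spaceInterp h (U j) x
          + (s - G.node j) / (G.node (j + 1) - G.node j)
            * (spaceInterp h (U (j + 1)) x - spaceInterp h (U j) x)) t

/-! ### Discrete operators -/

/-- Nodes and weights of a discrete operator: symmetric summable weights `ω_γ = ω_{-γ} ≥ 0` and grid
points `z_γ = h * offset γ ∈ 𝓖_h` with `z_{-γ} = -z_γ`, for `0 ≠ γ ∈ ℤ^N`. Values at `γ = 0` are never
used. The standard choice is `offset γ = γ`. -/
structure Stencil (N : ℕ) where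
  offset : Idx N → Idx N
  weight : Idx N → ℝ
  offset_neg : ∀ γ ≠ 0, offset (-γ) = -offset γ
  weight_neg : ∀ γ ≠ 0, weight (-γ) = weight γ
  weight_nonneg : ∀ γ ≠ 0, 0 ≤ weight γ
  weight_summable : Summable fun γ : {γ : Idx N // γ ≠ 0} => weight γ

/-- `𝓛^h` on grid functions: `∑_{γ≠0} (ψ(x_β+z_γ) - ψ(x_β)) ω_γ`. -/
def Stencil.gridOp {N : ℕ} (S : Stencil N) (ψ : Idx N → ℝ) (β : Idx N) : ℝ :=
  ∑' γ : {γ : Idx N // γ ≠ 0}, (ψ (β + S.offset γ) - ψ β) * S.weight γ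

/-- `𝓛^h` on functions on `ℝ^N`: `∑_{γ≠0} (ψ(x+z_γ) - ψ(x)) ω_γ`. -/
def Stencil.op {N : ℕ} (S : Stencil N) (h : ℝ) (ψ : Space N → ℝ) (x : Space N) : ℝ :=
  ∑' γ : {γ : Idx N // γ ≠ 0}, (ψ (x + gridPoint h (S.offset γ)) - ψ x) * S.weight γ

/-- The truncated moment `∑_{γ ≠ 0, |z_γ| ∈ I} |z_γ|^k ω_γ ∈ [0,∞]`. -/
def Stencil.moment {N : ℕ} (S : Stencil N) (h : ℝ) (k : ℕ) (I : Set ℝ) : ENNReal :=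
  ∑' γ : {γ : Idx N // γ ≠ 0},
    I.indicator (fun ρ => ENNReal.ofReal (ρ ^ k * S.weight γ)) ‖gridPoint h (S.offset γ)‖

/-- The standard finite difference Laplacian `Δ_h`. -/
def discreteLaplacian {N : ℕ} (h : ℝ) (ψ : Space N → ℝ) (x : Space N) : ℝ :=
  ∑ i : Fin N, (ψ (x + h • EuclideanSpace.single i (1 : ℝ))
    + ψ (x - h • EuclideanSpace.single i (1 : ℝ)) - 2 * ψ x) / h ^ 2

/-- `sup_{0<h<1} {∑_{h≤|z_γ|≤1} |z_γ|² ω_{γ,h} + ∑_{|z_γ|>1} ω_{γ,h}} < ∞`. -/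
def LevyWeights {N : ℕ} (S : ℝ → Stencil N) : Prop :=
  (⨆ h ∈ Ioo (0 : ℝ) 1, ((S h).moment h 2 (Icc h 1) + (S h).moment h 0 (Ioi 1))) < ⊤

/-- `sup_{0<h<1} {∑_{h≤|z_γ|≤1} |z_γ|² ω_{γ,h} + ∑_{|z_γ|>1} |z_γ| ω_{γ,h}} < ∞`. -/
def FirstMomentWeights {N : ℕ} (S : ℝ → Stencil N) : Prop :=
  (⨆ h ∈ Ioo (0 : ℝ) 1, ((S h).moment h 2 (Icc h 1) + (S h).moment h 1 (Ioi 1))) < ⊤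

/-- In addition to `LevyWeights`,
`sup_{R>1} sup_{0<h<1} {R^{α-2} ∑_{1<|z_γ|≤R} |z_γ|² ω_{γ,h} + R^α ∑_{|z_γ|>R} ω_{γ,h}} < ∞`. -/
def FractionalWeights {N : ℕ} (α : ℝ) (S : ℝ → Stencil N) : Prop :=
  LevyWeights S ∧
    (⨆ R ∈ Ioi (1 : ℝ), ⨆ h ∈ Ioo (0 : ℝ) 1,
      (ENNReal.ofReal (R ^ (α - 2)) * (S h).moment h 2 (Ioc 1 R)
        + ENNReal.ofReal (R ^ α) * (S h).moment h 0 (Ioi R))) < ⊤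

/-- Consistency: `𝓛^h[ψ] → 𝔏[ψ]` in `L¹(ℝ^N)` as `h → 0⁺`, for all `ψ ∈ C_c^∞(ℝ^N)`. -/
def Consistent {N : ℕ} (c : ℝ) (μ : Measure (Space N)) (S : ℝ → Stencil N) : Prop :=
  ∀ ψ : Space N → ℝ, ContDiff ℝ ∞ ψ → HasCompactSupport ψ →
    Tendsto (fun h => eLpNorm ((S h).op h ψ - diffusionOp c μ ψ) 1 volume) (𝓝[>] 0) (𝓝 0)

/-! ### The numerical scheme -/

/-- `U_β^0 = h^{-N} ∫_{x_β+R_h} u₀ dx`. -/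
def discreteInitial {N : ℕ} (h : ℝ) (u₀ : Space N → ℝ) (β : Idx N) : ℝ :=
  1 / h ^ N * ∫ x in gridCell h β, u₀ x

/-- `G_β^{j+1} = (h^N Δt_{j+1})^{-1} ∫_{t_j}^{t_{j+1}} ∫_{x_β+R_h} g dx dτ`. -/
def discreteSource {N : ℕ} {T : ℝ} (h : ℝ) (G : TimeGrid T) (g : ℝ → Space N → ℝ)
    (j : ℕ) (β : Idx N) : ℝ :=
  1 / (h ^ N * G.step j) *
    ∫ p in Ioo (G.node j) (G.node (j + 1)) ×ˢ gridCell h β, g p.1 p.2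

/-- `U_β^j` (`0 ≤ j ≤ J`) is a summable solution of the implicit scheme
`U_β^j = U_β^{j-1} + Δt_j 𝓛^h[φ(U^j)]_β + Δt_j G_β^j`, `1 ≤ j ≤ J`, with the initial values `U_β^0`.
Summability is part of the notion of solution: the scheme alone does not determine `U`. -/
structure IsSchemeSolution {N : ℕ} {T : ℝ} (h : ℝ) (S : Stencil N) (G : TimeGrid T) (φ : ℝ → ℝ)
    (u₀ : Space N → ℝ) (g : ℝ → Space N → ℝ) (U : ℕ → Idx N → ℝ) : Prop where
  init : ∀ β, U 0 β = discreteInitial h u₀ β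
  scheme : ∀ j < G.J, ∀ β,
    U (j + 1) β = U j β + G.step j * S.gridOp (fun η => φ (U (j + 1) η)) β
      + G.step j * discreteSource h G g j β
  summable : ∀ j ≤ G.J, Summable (U j)

end GPME

end

/-! The proof is a compactness argument. Uniform estimates make the interpolants relatively compact
in $C([0,T];L^1)$, every limit point is a very weak solution in the class where uniqueness is
assumed, so all limit points agree and the whole family converges. The $L^1$ convergence improves to
$L^r$ because the interpolants are uniformly bounded.

The estimates rest on monotonicity. At a maximum of a summable grid function the operator applied to
$\varphi(U)$ is nonpositive, which gives a uniform $L^\infty$ bound (`exists_scheme_bound`). For the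
difference $w$ of two solutions, multiplication by $\mathrm{sign}(w)$, a discrete Kato inequality
and the symmetry of $\mathcal L^h$ give an $L^1$ balance against a cut-off $\zeta_R$, with the flux
$\int|p|\,|\mathcal L^h\zeta_R|$ as error, where $p$ is the difference of the nonlinearities
(`Stencil.step_estimate`).

The flux is the crux, since $\varphi$ is only Hölder: $|p|\le C|w|^\gamma$ need not be integrable.
Splitting at the level $|w|=R^{-N}$ bounds the flux by a multiple of $R^{N(1-\gamma)}$ times the
truncated moment $\sum\min(|z|^2/R^2,1)\,\omega$ (`integral_flux_le`). This moment is
$O(R^{-\theta})$ with $\theta=2,1,\alpha$ in the three cases, and the three conditions on $\gamma$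
all give $N(1-\gamma)<\theta$ (`exists_trunc_decay`). Hence the flux vanishes as $R\to\infty$.
Letting $R\to\infty$ gives the $L^1$ contraction, which applied to translates controls spatial
oscillation; fixing $R$ gives uniformly small tails (`IsSchemeDiff.contraction`,
`IsSchemeDiff.tail`).

Time regularity is first obtained in a dual sense, by testing the scheme with mollifiers, and is
turned into strong $L^1$ equicontinuity by the control of translations and tails
(`exists_node_time_le`). A Kolmogorov–Riesz and Arzelà–Ascoli argument along ultrafilters gives
limits without extraction of subsequences (`exists_mem_integral_sub_le`, `exists_limit`). The scheme
satisfies an exact weak identity (`weak_identity`), whose terms converge by consistency and by the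
same splitting of Hölder differences (`weakEq_limit`). -/

namespace GPME

/-! ### Discrete operators on functions -/

section Operators

variable {N : ℕ}

/-- The second difference `ψ(x+z) + ψ(x-z) - 2ψ(x)`. -/
def secondDiff {E : Type*} [AddCommGroup E] (ψ : E → ℝ) (x z : E) : ℝ :=
  ψ (x + z) + ψ (x - z) - 2 * ψ x

/-- The truncated second moment `∑_γ min(|z_γ|²/R², 1) ω_γ`. -/
noncomputable def Stencil.trunc (S : Stencil N) (h R : ℝ) : ℝ :=
  ∑' γ : {γ : Idx N // γ ≠ 0}, min (‖gridPoint h (S.offset γ)‖ ^ 2 / R ^ 2) 1 * S.weight γ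

/-- The total mass of the weights. -/
noncomputable def Stencil.mass (S : Stencil N) : ℝ :=
  ∑' γ : {γ : Idx N // γ ≠ 0}, S.weight γ

theorem Stencil.wnn (S : Stencil N) (γ : {γ : Idx N // γ ≠ 0}) : 0 ≤ S.weight γ :=
  S.weight_nonneg γ γ.2

/-- Negation of nonzero multi-indices. -/
def negIdx (N : ℕ) : {γ : Idx N // γ ≠ 0} ≃ {γ : Idx N // γ ≠ 0} :=
  (Equiv.neg (Idx N)).subtypeEquiv (by intro a; simp)

@[simp] theorem negIdx_coe (γ : {γ : Idx N // γ ≠ 0}) : (negIdx N γ : Idx N) = -γ := rfl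

theorem gridPoint_neg (h : ℝ) (β : Idx N) : gridPoint h (-β) = -gridPoint h β := by
  ext i; simp [gridPoint]

theorem Stencil.shift_neg (S : Stencil N) (h : ℝ) (γ : {γ : Idx N // γ ≠ 0}) :
    gridPoint h (S.offset (negIdx N γ)) = -gridPoint h (S.offset γ) := by
  rw [negIdx_coe, S.offset_neg γ γ.2, gridPoint_neg]

theorem Stencil.summable_mul (S : Stencil N) {f : {γ : Idx N // γ ≠ 0} → ℝ} {B : ℝ}
    (hf : ∀ γ, |f γ| ≤ B) : Summable fun γ => f γ * S.weight γ := by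
  refine Summable.of_norm_bounded (S.weight_summable.mul_left B) fun γ => ?_
  rw [Real.norm_eq_abs, abs_mul, abs_of_nonneg (S.wnn γ)]
  exact mul_le_mul_of_nonneg_right (hf γ) (S.wnn γ)

theorem Stencil.abs_tsum_mul_le (S : Stencil N) {f : {γ : Idx N // γ ≠ 0} → ℝ} {B : ℝ}
    (hf : ∀ γ, |f γ| ≤ B) : |∑' γ, f γ * S.weight γ| ≤ B * S.mass := by
  rw [Stencil.mass, ← tsum_mul_left, ← Real.norm_eq_abs]
  refine tsum_of_norm_bounded (S.weight_summable.mul_left B).hasSum fun γ => ?_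
  rw [Real.norm_eq_abs, abs_mul, abs_of_nonneg (S.wnn γ)]
  exact mul_le_mul_of_nonneg_right (hf γ) (S.wnn γ)

theorem abs_sub_le_two_mul {q : Space N → ℝ} {B : ℝ} (hq : ∀ x, |q x| ≤ B) (x y : Space N) :
    |q x - q y| ≤ 2 * B := by
  have := abs_sub (q x) (q y)
  linarith [hq x, hq y]

theorem Stencil.summable_op (S : Stencil N) (h : ℝ) {q : Space N → ℝ} {B : ℝ}
    (hq : ∀ x, |q x| ≤ B) (x : Space N) :
    Summable fun γ : {γ : Idx N // γ ≠ 0} =>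
      (q (x + gridPoint h (S.offset γ)) - q x) * S.weight γ :=
  S.summable_mul fun _ => abs_sub_le_two_mul hq _ _

theorem Stencil.abs_op_le_mass (S : Stencil N) (h : ℝ) {q : Space N → ℝ} {B : ℝ}
    (hq : ∀ x, |q x| ≤ B) (x : Space N) : |S.op h q x| ≤ 2 * B * S.mass :=
  S.abs_tsum_mul_le fun _ => abs_sub_le_two_mul hq _ _

theorem Stencil.measurable_op (S : Stencil N) (h : ℝ) {q : Space N → ℝ} (hq : Measurable q) :
    Measurable (S.op h q) := by
  unfold Stencil.op
  refine Measurable.tsum fun γ => ?_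
  fun_prop

theorem Stencil.measurable_op_prod (S : Stencil N) (h : ℝ) {ψ : ℝ × Space N → ℝ}
    (hψ : Measurable ψ) :
    Measurable fun p : ℝ × Space N => S.op h (fun y => ψ (p.1, y)) p.2 := by
  unfold Stencil.op
  refine Measurable.tsum fun γ => ?_
  fun_prop

/-- Discrete Kato inequality. The central terms of both sides coincide, and each neighbour satisfies
$\sigma p(x+z)\le|p(x+z)|$; nonnegativity of the weights does the rest. -/
theorem Stencil.op_abs (S : Stencil N) (h : ℝ) {p : Space N → ℝ} {B : ℝ}
    (hp : ∀ x, |p x| ≤ B) {x : Space N} {σ : ℝ} (hσ : |σ| ≤ 1) (hσp : σ * p x = |p x|) :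
    σ * S.op h p x ≤ S.op h (fun y => |p y|) x := by
  unfold Stencil.op
  rw [← tsum_mul_left]
  refine Summable.tsum_le_tsum (fun γ => ?_) ((S.summable_op h hp x).mul_left σ)
    (S.summable_op h (q := fun y => |p y|) (B := B) (by simpa using hp) x)
  rw [← mul_assoc]
  refine mul_le_mul_of_nonneg_right ?_ (S.wnn γ)
  rw [mul_sub, hσp]
  refine sub_le_sub_right ?_ _
  refine (le_abs_self _).trans ?_
  rw [abs_mul]
  exact mul_le_of_le_one_left (abs_nonneg _) hσ

theorem Stencil.op_sub (S : Stencil N) (h : ℝ) {p q : Space N → ℝ} {B B' : ℝ}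
    (hp : ∀ x, |p x| ≤ B) (hq : ∀ x, |q x| ≤ B') (x : Space N) :
    S.op h (fun y => p y - q y) x = S.op h p x - S.op h q x := by
  unfold Stencil.op
  rw [← (S.summable_op h hp x).tsum_sub (S.summable_op h hq x)]
  refine tsum_congr fun γ => ?_
  ring

theorem Stencil.op_comp_add_right (S : Stencil N) (h : ℝ) (p : Space N → ℝ) (ξ x : Space N) :
    S.op h (fun y => p (y + ξ)) x = S.op h p (x + ξ) := by
  unfold Stencil.op
  refine tsum_congr fun γ => ?_
  rw [add_right_comm]

theorem Stencil.op_sub_const (S : Stencil N) (h : ℝ) (p : Space N → ℝ) (k : ℝ) (x : Space N) :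
    S.op h (fun y => p y - k) x = S.op h p x := by
  unfold Stencil.op
  refine tsum_congr fun γ => ?_
  ring

/-- Pairing $\gamma$ with $-\gamma$ cancels first-order terms. This is why second moments near the
origin are enough, although the total mass of the weights may blow up as $h\to0$. -/
theorem Stencil.op_eq_half (S : Stencil N) (h : ℝ) {ψ : Space N → ℝ} {B : ℝ}
    (hψ : ∀ x, |ψ x| ≤ B) (x : Space N) :
    S.op h ψ x = 1 / 2 * ∑' γ : {γ : Idx N // γ ≠ 0},
      secondDiff ψ x (gridPoint h (S.offset γ)) * S.weight γ := by
  have h1 := S.summable_op h hψ x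
  have h2 : S.op h ψ x = ∑' γ : {γ : Idx N // γ ≠ 0},
      (ψ (x - gridPoint h (S.offset γ)) - ψ x) * S.weight γ := by
    unfold Stencil.op
    rw [← (negIdx N).tsum_eq]
    refine tsum_congr fun γ => ?_
    rw [S.shift_neg, negIdx_coe, S.weight_neg γ γ.2, sub_eq_add_neg x]
  have h3 : Summable fun γ : {γ : Idx N // γ ≠ 0} =>
      (ψ (x - gridPoint h (S.offset γ)) - ψ x) * S.weight γ :=
    S.summable_mul fun _ => abs_sub_le_two_mul hψ _ _
  have h4 : ∑' γ : {γ : Idx N // γ ≠ 0},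
      secondDiff ψ x (gridPoint h (S.offset γ)) * S.weight γ = S.op h ψ x + S.op h ψ x := by
    conv_rhs => rw [h2]; rw [← h2]
    conv_rhs => arg 2; rw [h2]
    unfold Stencil.op
    rw [← h1.tsum_add h3]
    refine tsum_congr fun γ => ?_
    unfold secondDiff; ring
  rw [h4]; ring

theorem truncFactor_nonneg (z : Space N) (R : ℝ) : 0 ≤ min (‖z‖ ^ 2 / R ^ 2) 1 := by positivity

theorem Stencil.summable_trunc (S : Stencil N) (h R : ℝ) :
    Summable fun γ : {γ : Idx N // γ ≠ 0} =>
      min (‖gridPoint h (S.offset γ)‖ ^ 2 / R ^ 2) 1 * S.weight γ :=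
  S.summable_mul (B := 1) fun γ => by
    rw [abs_of_nonneg (truncFactor_nonneg _ _)]; exact min_le_right _ _

theorem Stencil.abs_op_le (S : Stencil N) (h : ℝ) {ψ : Space N → ℝ} {A B R : ℝ}
    (hψ : ∀ x, |ψ x| ≤ B) {x : Space N}
    (hA : ∀ z, |secondDiff ψ x z| ≤ A * min (‖z‖ ^ 2 / R ^ 2) 1) :
    |S.op h ψ x| ≤ A * S.trunc h R := by
  have hA0 : 0 ≤ A * S.trunc h R := by
    rw [Stencil.trunc, ← tsum_mul_left]
    refine tsum_nonneg fun γ => ?_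
    rw [← mul_assoc]
    exact mul_nonneg ((abs_nonneg _).trans (hA _)) (S.wnn γ)
  rw [S.op_eq_half h hψ, abs_mul]
  have : |∑' γ : {γ : Idx N // γ ≠ 0},
      secondDiff ψ x (gridPoint h (S.offset γ)) * S.weight γ| ≤ A * S.trunc h R := by
    rw [Stencil.trunc, ← tsum_mul_left, ← Real.norm_eq_abs]
    refine tsum_of_norm_bounded ((S.summable_trunc h R).mul_left A).hasSum fun γ => ?_
    rw [Real.norm_eq_abs, abs_mul, abs_of_nonneg (S.wnn γ), ← mul_assoc]
    exact mul_le_mul_of_nonneg_right (hA _) (S.wnn γ)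
  rw [abs_of_pos (by norm_num : (0 : ℝ) < 1 / 2)]
  linarith

theorem integrable_secondDiff {ψ : Space N → ℝ} (hψ : Integrable ψ) (z : Space N) :
    Integrable fun x => secondDiff ψ x z :=
  ((hψ.comp_add_right z).add (hψ.comp_sub_right z)).sub (hψ.const_mul 2)

/-- Purely qualitative: the bound used is $2\|\psi\|_1$ times the total mass, which is finite for
each $h$ but not uniform in $h$. -/
theorem Stencil.integrable_op (S : Stencil N) (h : ℝ) {ψ : Space N → ℝ} (hm : Measurable ψ)
    (hi : Integrable ψ) : Integrable (S.op h ψ) := by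
  have hint : ∀ γ : {γ : Idx N // γ ≠ 0}, Integrable fun x =>
      (ψ (x + gridPoint h (S.offset γ)) - ψ x) * S.weight γ := fun γ =>
    ((hi.comp_add_right _).sub hi).mul_const _
  refine ⟨(S.measurable_op h hm).aestronglyMeasurable, ?_⟩
  have hb : ∀ γ : {γ : Idx N // γ ≠ 0},
      ∫⁻ x, ‖(ψ (x + gridPoint h (S.offset γ)) - ψ x) * S.weight γ‖ₑ
        ≤ ENNReal.ofReal ((2 * ∫ x, |ψ x|) * S.weight γ) := by
    intro γ
    rw [← ofReal_integral_norm_eq_lintegral_enorm (hint γ)]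
    refine ENNReal.ofReal_le_ofReal ?_
    simp_rw [norm_mul, Real.norm_eq_abs, abs_of_nonneg (S.wnn γ)]
    rw [integral_mul_const]
    refine mul_le_mul_of_nonneg_right ?_ (S.wnn γ)
    have h1 : ∫ x, |ψ (x + gridPoint h (S.offset γ))| = ∫ x, |ψ x| :=
      integral_add_right_eq_self (fun x => |ψ x|) _
    calc _ ≤ ∫ x, (|ψ (x + gridPoint h (S.offset γ))| + |ψ x|) := by
          refine integral_mono ((hi.comp_add_right _).sub hi).abs
            ((hi.comp_add_right _).abs.add hi.abs) fun x => abs_sub _ _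
      _ = _ := by
          rw [integral_add (hi.comp_add_right _).abs hi.abs, h1]; ring
  unfold HasFiniteIntegral
  calc ∫⁻ x, ‖S.op h ψ x‖ₑ
      ≤ ∫⁻ x, ∑' γ : {γ : Idx N // γ ≠ 0},
        ‖(ψ (x + gridPoint h (S.offset γ)) - ψ x) * S.weight γ‖ₑ :=
        lintegral_mono fun x => enorm_tsum_le_tsum_enorm
    _ = ∑' γ : {γ : Idx N // γ ≠ 0},
        ∫⁻ x, ‖(ψ (x + gridPoint h (S.offset γ)) - ψ x) * S.weight γ‖ₑ :=
        lintegral_tsum fun γ => (hint γ).1.enorm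
    _ ≤ ∑' γ : {γ : Idx N // γ ≠ 0}, ENNReal.ofReal ((2 * ∫ x, |ψ x|) * S.weight γ) :=
        ENNReal.tsum_le_tsum hb
    _ < ⊤ := (S.weight_summable.mul_left _).tsum_ofReal_lt_top

/-- The quantitative $L^1$ bound: Tonelli is applied to the symmetrized series, so only the
truncated moment at scale $R$ enters, not the mass. -/
theorem Stencil.integral_abs_op_le (S : Stencil N) (h : ℝ) {ψ : Space N → ℝ} {A B R : ℝ}
    (hm : Measurable ψ) (hi : Integrable ψ) (hψ : ∀ x, |ψ x| ≤ B)
    (hA : ∀ z, ∫ x, |secondDiff ψ x z| ≤ A * min (‖z‖ ^ 2 / R ^ 2) 1) :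
    ∫ x, |S.op h ψ x| ≤ A * S.trunc h R := by
  have hA0 : ∀ γ : {γ : Idx N // γ ≠ 0},
      0 ≤ A * min (‖gridPoint h (S.offset γ)‖ ^ 2 / R ^ 2) 1 := fun γ =>
    (integral_nonneg fun x => abs_nonneg _).trans (hA _)
  have hA1 : 0 ≤ A * S.trunc h R := by
    rw [Stencil.trunc, ← tsum_mul_left]
    refine tsum_nonneg fun γ => ?_
    rw [← mul_assoc]
    exact mul_nonneg (hA0 γ) (S.wnn γ)
  have hsm : Summable fun γ : {γ : Idx N // γ ≠ 0} =>
      A * (min (‖gridPoint h (S.offset γ)‖ ^ 2 / R ^ 2) 1 * S.weight γ) :=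
    (S.summable_trunc h R).mul_left A
  have key : ∫⁻ x, ‖S.op h ψ x‖ₑ ≤ ENNReal.ofReal (A * S.trunc h R) := by
    calc ∫⁻ x, ‖S.op h ψ x‖ₑ
        ≤ ∫⁻ x, ∑' γ : {γ : Idx N // γ ≠ 0},
          ‖secondDiff ψ x (gridPoint h (S.offset γ)) * S.weight γ‖ₑ := by
          refine lintegral_mono fun x => ?_
          rw [S.op_eq_half h hψ, enorm_mul]
          refine (mul_le_of_le_one_left zero_le ?_).trans enorm_tsum_le_tsum_enorm
          rw [Real.enorm_eq_ofReal (by norm_num)]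
          exact ENNReal.ofReal_le_one.2 (by norm_num)
      _ = ∑' γ : {γ : Idx N // γ ≠ 0},
          ∫⁻ x, ‖secondDiff ψ x (gridPoint h (S.offset γ)) * S.weight γ‖ₑ :=
          lintegral_tsum fun γ => ((integrable_secondDiff hi _).mul_const _).1.enorm
      _ ≤ ∑' γ : {γ : Idx N // γ ≠ 0}, ENNReal.ofReal
          (A * (min (‖gridPoint h (S.offset γ)‖ ^ 2 / R ^ 2) 1 * S.weight γ)) := by
          refine ENNReal.tsum_le_tsum fun γ => ?_
          rw [← ofReal_integral_norm_eq_lintegral_enorm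
            ((integrable_secondDiff hi _).mul_const _)]
          refine ENNReal.ofReal_le_ofReal ?_
          simp_rw [norm_mul, Real.norm_eq_abs, abs_of_nonneg (S.wnn γ)]
          rw [integral_mul_const, ← mul_assoc]
          exact mul_le_mul_of_nonneg_right (hA _) (S.wnn γ)
      _ = _ := by
          rw [Stencil.trunc, ← tsum_mul_left, ENNReal.ofReal_tsum_of_nonneg _ hsm]
          intro γ
          rw [← mul_assoc]
          exact mul_nonneg (hA0 γ) (S.wnn γ)
  rw [← ofReal_integral_norm_eq_lintegral_enorm (S.integrable_op h hm hi)] at key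
  exact (ENNReal.ofReal_le_ofReal_iff hA1).1 key

theorem Stencil.integral_tsum_mul (S : Stencil N) {F : {γ : Idx N // γ ≠ 0} → Space N → ℝ} {C : ℝ}
    (hF : ∀ γ, Integrable (F γ)) (hC : ∀ γ, ∫ x, |F γ x| ≤ C) :
    ∫ x, ∑' γ, F γ x * S.weight γ = ∑' γ, (∫ x, F γ x) * S.weight γ := by
  have h1 := hasSum_integral_of_summable_integral_norm (F := fun γ x => F γ x * S.weight γ)
    (fun γ => (hF γ).mul_const _) ?_
  · rw [← h1.tsum_eq]
    exact tsum_congr fun γ => integral_mul_const _ _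
  · refine Summable.of_nonneg_of_le (fun γ => integral_nonneg fun x => norm_nonneg _)
      (fun γ => ?_) (S.weight_summable.mul_left C)
    simp_rw [norm_mul, Real.norm_eq_abs, abs_of_nonneg (S.wnn γ)]
    rw [integral_mul_const]
    exact mul_le_mul_of_nonneg_right (hC γ) (S.wnn γ)

/-- Self-adjointness of the discrete operator for the pairing of $L^1$ with bounded functions.
Summable weights allow the exchange of sum and integral on both sides. -/
theorem Stencil.integral_mul_op (S : Stencil N) (h : ℝ) {ζ q : Space N → ℝ} {B : ℝ}
    (hq : ∀ x, |q x| ≤ B) (hqm : Measurable q) (hζ : Integrable ζ) :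
    ∫ x, ζ x * S.op h q x = ∫ x, q x * S.op h ζ x := by
  have hB : 0 ≤ B := (abs_nonneg _).trans (hq 0)
  have hint : ∀ z, Integrable fun x => ζ x * q (x + z) := fun z =>
    hζ.mul_bdd (c := B) (hqm.comp (measurable_id.add_const z)).aestronglyMeasurable
      (Eventually.of_forall fun x => hq _)
  have hint0 : Integrable fun x => ζ x * q x := by simpa using hint 0
  have hint' : ∀ z, Integrable fun x => q x * ζ (x + z) := fun z => by
    simp_rw [mul_comm (q _)]
    exact (hζ.comp_add_right z).mul_bdd (c := B) hqm.aestronglyMeasurable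
      (Eventually.of_forall hq)
  have hint0' : Integrable fun x => q x * ζ x := by simpa using hint' 0
  have e1 : ∫ x, ζ x * S.op h q x = ∑' γ : {γ : Idx N // γ ≠ 0},
      (∫ x, ζ x * (q (x + gridPoint h (S.offset γ)) - q x)) * S.weight γ := by
    rw [← S.integral_tsum_mul (C := ∫ x, 2 * B * |ζ x|)]
    · congr 1; ext x
      unfold Stencil.op
      rw [← tsum_mul_left]
      simp_rw [mul_assoc]
    · intro γ
      simp_rw [mul_sub]; exact (hint _).sub hint0
    · intro γ
      refine integral_mono (Integrable.abs ?_) (hζ.abs.const_mul _) fun x => ?_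
      · simp_rw [mul_sub]; exact (hint _).sub hint0
      · simp only [abs_mul]
        rw [mul_comm]
        exact mul_le_mul_of_nonneg_right (abs_sub_le_two_mul hq _ _) (abs_nonneg _)
  have e2 : ∫ x, q x * S.op h ζ x = ∑' γ : {γ : Idx N // γ ≠ 0},
      (∫ x, q x * (ζ (x + gridPoint h (S.offset γ)) - ζ x)) * S.weight γ := by
    have hi : ∀ γ : {γ : Idx N // γ ≠ 0}, Integrable fun x =>
        q x * (ζ (x + gridPoint h (S.offset γ)) - ζ x) := fun γ => by
      simp_rw [mul_sub]; exact (hint' _).sub hint0'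
    rw [← S.integral_tsum_mul (C := 2 * B * ∫ x, |ζ x|) hi]
    · congr 1; ext x
      unfold Stencil.op
      rw [← tsum_mul_left]
      simp_rw [mul_assoc]
    · intro γ
      have h1 : ∫ x, |ζ (x + gridPoint h (S.offset γ))| = ∫ x, |ζ x| :=
        integral_add_right_eq_self (fun x => |ζ x|) _
      calc _ ≤ ∫ x, B * (|ζ (x + gridPoint h (S.offset γ))| + |ζ x|) := by
            refine integral_mono (hi γ).abs
              (((hζ.comp_add_right _).abs.add hζ.abs).const_mul _) fun x => ?_
            simp only [abs_mul]
            exact mul_le_mul (hq x) (abs_sub _ _) (abs_nonneg _) hB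
        _ = _ := by
            rw [integral_const_mul, integral_add (hζ.comp_add_right _).abs hζ.abs, h1]; ring
  -- Reversing the index on the left turns $q(x+z)$ into $q(x-z)$; translating the integral by $z$
  -- then moves the shift onto $\zeta$.
  rw [e1, e2, ← (negIdx N).tsum_eq]
  refine tsum_congr fun γ => ?_
  rw [S.shift_neg, negIdx_coe, S.weight_neg γ γ.2]
  congr 1
  set z := gridPoint h (S.offset γ)
  simp_rw [mul_sub]
  rw [integral_sub (hint _) hint0, integral_sub (hint' _) hint0',
    ← integral_add_right_eq_self (fun x => ζ x * q (x + -z)) z]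
  simp only [add_neg_cancel_right]
  simp_rw [mul_comm (ζ _)]

/-! ### Second differences of test functions -/

/-- The gradient is Lipschitz, so $s\mapsto\psi(x+sz)+\psi(x-sz)$ has derivative at most $2K\|z\|^2$
on $[0,1]$. The space is general because the bound is used both on $\mathbb R^N$ and on space-time.
-/
theorem exists_secondDiff_le {E : Type*} [NormedAddCommGroup E] [NormedSpace ℝ E]
    {ψ : E → ℝ} (hψ : ContDiff ℝ ∞ ψ) (hc : HasCompactSupport ψ) :
    ∃ A, 0 ≤ A ∧ ∀ x z, |secondDiff ψ x z| ≤ A * ‖z‖ ^ 2 := by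
  have hd : ContDiff ℝ 1 (fderiv ℝ ψ) := hψ.fderiv_right (by norm_cast)
  obtain ⟨K, hK⟩ := hd.lipschitzWith_of_hasCompactSupport (hc.fderiv ℝ) (by norm_num)
  refine ⟨2 * K, by positivity, fun x z => ?_⟩
  have hdiff : Differentiable ℝ ψ := hψ.differentiable (by simp)
  set f : ℝ → ℝ := fun s => ψ (x + s • z) + ψ (x - s • z) with hf
  have hder : ∀ s, HasDerivAt f (fderiv ℝ ψ (x + s • z) z - fderiv ℝ ψ (x - s • z) z) s := by
    intro s
    have h1 : HasDerivAt (fun s : ℝ => x + s • z) z s := by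
      simpa using ((hasDerivAt_id s).smul_const z).const_add x
    have h2 : HasDerivAt (fun s : ℝ => x - s • z) (-z) s := by
      simpa using ((hasDerivAt_id s).smul_const z).const_sub x
    have := ((hdiff _).hasFDerivAt.comp_hasDerivAt s h1).add
      ((hdiff _).hasFDerivAt.comp_hasDerivAt s h2)
    refine this.congr_deriv ?_
    simp [sub_eq_add_neg]
  have := norm_image_sub_le_of_norm_deriv_le_segment_01' (f := f) (C := 2 * K * ‖z‖ ^ 2)
    (fun s _ => (hder s).hasDerivWithinAt) ?_
  · have e : f 1 - f 0 = secondDiff ψ x z := by simp [hf, secondDiff]; ring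
    rwa [e] at this
  · intro s hs
    rw [← sub_apply]
    refine (ContinuousLinearMap.le_opNorm _ _).trans ?_
    have h3 := hK.dist_le_mul (x + s • z) (x - s • z)
    rw [dist_eq_norm, dist_eq_norm] at h3
    have h4 : ‖x + s • z - (x - s • z)‖ ≤ 2 * ‖z‖ := by
      have : x + s • z - (x - s • z) = (2 * s) • z := by
        rw [mul_smul, two_smul]; abel
      rw [this, norm_smul, Real.norm_eq_abs, abs_of_nonneg (by linarith [hs.1])]
      nlinarith [norm_nonneg z, hs.2]
    calc _ ≤ K * (2 * ‖z‖) * ‖z‖ := by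
          refine mul_le_mul_of_nonneg_right (h3.trans ?_) (norm_nonneg _)
          exact mul_le_mul_of_nonneg_left h4 K.2
      _ = _ := by ring

/-- Control of the second differences of a family of functions on `ℝ^N`. -/
theorem integral_secondDiff_le {ψ : Space N → ℝ} {A ρ : ℝ} (hψ : Continuous ψ) (hA : 0 ≤ A)
    (hb : ∀ x, |ψ x| ≤ A) (hs : ∀ x, ρ < ‖x‖ → ψ x = 0)
    (h2 : ∀ x z, |secondDiff ψ x z| ≤ A * ‖z‖ ^ 2) (z : Space N) :
    ∫ x, |secondDiff ψ x z|
      ≤ 4 * A * volume.real (Metric.closedBall (0 : Space N) (ρ + 1)) * min (‖z‖ ^ 2) 1 := by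
  have hfin : volume (Metric.closedBall (0 : Space N) (ρ + 1)) < ⊤ :=
    measure_closedBall_lt_top
  have hcs : HasCompactSupport ψ :=
    HasCompactSupport.of_support_subset_isCompact (isCompact_closedBall (0 : Space N) ρ)
      fun x hx => by
        rw [mem_closedBall_zero_iff]
        by_contra hc
        exact hx (hs x (not_le.1 hc))
  have hi : Integrable ψ := hψ.integrable_of_hasCompactSupport hcs
  have hind : ∀ k : ℝ, Integrable
      ((Metric.closedBall (0 : Space N) (ρ + 1)).indicator fun _ => k) := fun k =>
    (integrable_indicator_iff measurableSet_closedBall).2 (integrableOn_const hfin.ne)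
  have hint : ∀ k : ℝ, ∫ x, (Metric.closedBall (0 : Space N) (ρ + 1)).indicator (fun _ => k) x
      = k * volume.real (Metric.closedBall (0 : Space N) (ρ + 1)) := fun k => by
    rw [integral_indicator measurableSet_closedBall, setIntegral_const, smul_eq_mul, mul_comm]
  set V := volume.real (Metric.closedBall (0 : Space N) (ρ + 1)) with hV
  have hV0 : 0 ≤ V := measureReal_nonneg
  -- Short shifts keep the support inside the ball of radius $\rho+1$, where the quadratic bound is
  -- integrated. Long shifts only use the triangle inequality, at the cost of $4\int|\psi|$.
  rcases le_or_gt ‖z‖ 1 with hz | hz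
  · rw [min_eq_left (by nlinarith [norm_nonneg z])]
    calc _ ≤ ∫ x, (Metric.closedBall (0 : Space N) (ρ + 1)).indicator
            (fun _ => A * ‖z‖ ^ 2) x := by
          refine integral_mono (integrable_secondDiff hi z).abs (hind _) fun x => ?_
          by_cases hx : x ∈ Metric.closedBall (0 : Space N) (ρ + 1)
          · rw [indicator_of_mem hx]; exact h2 x z
          · rw [indicator_of_notMem hx]
            rw [mem_closedBall_zero_iff, not_le] at hx
            have e1 : ψ (x + z) = 0 := hs _ (by
              have := norm_sub_le (x + z) z; rw [add_sub_cancel_right] at this; linarith)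
            have e2 : ψ (x - z) = 0 := hs _ (by
              have := norm_add_le (x - z) z; rw [sub_add_cancel] at this; linarith)
            have e3 : ψ x = 0 := hs _ (by linarith)
            simp [secondDiff, e1, e2, e3]
      _ = A * ‖z‖ ^ 2 * V := hint _
      _ ≤ _ := by
          have : 0 ≤ A * ‖z‖ ^ 2 * V := by positivity
          nlinarith
  · rw [min_eq_right (by nlinarith)]
    have hψV : ∫ x, |ψ x| ≤ A * V := by
      rw [← hint]
      refine integral_mono hi.abs (hind _) fun x => ?_
      by_cases hx : x ∈ Metric.closedBall (0 : Space N) (ρ + 1)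
      · rw [indicator_of_mem hx]; exact hb x
      · rw [indicator_of_notMem hx]
        rw [mem_closedBall_zero_iff, not_le] at hx
        simp [hs x (by linarith)]
    have i1 : ∫ x, |ψ (x + z)| = ∫ x, |ψ x| := integral_add_right_eq_self (fun x => |ψ x|) _
    have i2 : ∫ x, |ψ (x - z)| = ∫ x, |ψ x| := integral_sub_right_eq_self (fun x => |ψ x|) _
    calc _ ≤ ∫ x, (|ψ (x + z)| + |ψ (x - z)| + 2 * |ψ x|) := by
          refine integral_mono (integrable_secondDiff hi z).abs
            (((hi.comp_add_right z).abs.add (hi.comp_sub_right z).abs).add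
              (hi.abs.const_mul 2)) fun x => ?_
          unfold secondDiff
          have := abs_sub (ψ (x + z) + ψ (x - z)) (2 * ψ x)
          rw [abs_mul, abs_two] at this
          linarith [abs_add_le (ψ (x + z)) (ψ (x - z))]
      _ = 4 * ∫ x, |ψ x| := by
          have j1 : Integrable fun x => |ψ (x + z)| := (hi.comp_add_right z).abs
          have j2 : Integrable fun x => |ψ (x - z)| := (hi.comp_sub_right z).abs
          have j3 : Integrable fun x => |ψ (x + z)| + |ψ (x - z)| := j1.add j2
          rw [integral_add j3 (hi.abs.const_mul 2), integral_add j1 j2, i1, i2,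
            integral_const_mul]
          ring
      _ ≤ _ := by linarith

theorem abs_secondDiff_le_min {ψ : Space N → ℝ} {A : ℝ} (hA : 0 ≤ A)
    (hb : ∀ x, |ψ x| ≤ A) (h2 : ∀ x z, |secondDiff ψ x z| ≤ A * ‖z‖ ^ 2) (x z : Space N) :
    |secondDiff ψ x z| ≤ 4 * A * min (‖z‖ ^ 2) 1 := by
  rcases le_or_gt ‖z‖ 1 with hz | hz
  · rw [min_eq_left (by nlinarith [norm_nonneg z])]
    have : 0 ≤ A * ‖z‖ ^ 2 := by positivity
    linarith [h2 x z]
  · rw [min_eq_right (by nlinarith)]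
    unfold secondDiff
    have := abs_sub (ψ (x + z) + ψ (x - z)) (2 * ψ x)
    rw [abs_mul, abs_two] at this
    linarith [abs_add_le (ψ (x + z)) (ψ (x - z)), hb (x + z), hb (x - z), hb x]

/-- Smooth cut-off functions at scale `R`, with the induced bounds on the discrete operators. -/
theorem exists_cutoff (N : ℕ) : ∃ ζ : ℝ → Space N → ℝ, ∃ A : ℝ, 0 ≤ A ∧ ∀ R > 0,
    Continuous (ζ R) ∧ HasCompactSupport (ζ R) ∧ (∀ x, 0 ≤ ζ R x) ∧ (∀ x, ζ R x ≤ 1) ∧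
    (∀ x, ‖x‖ ≤ R → ζ R x = 1) ∧ (∀ x, 2 * R ≤ ‖x‖ → ζ R x = 0) ∧
    ∀ (S : Stencil N) (h : ℝ), (∀ x, |S.op h (ζ R) x| ≤ A * S.trunc h R) ∧
      ∫ x, |S.op h (ζ R) x| ≤ A * R ^ N * S.trunc h R := by
  -- One bump, equal to $1$ on the unit ball and supported in the ball of radius $2$, is rescaled to
  -- $\zeta_R(x)=b(x/R)$. Its second differences then scale like $\|z\|^2/R^2$.
  let b : ContDiffBump (0 : Space N) := ⟨1, 2, by norm_num, by norm_num⟩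
  obtain ⟨A₀, hA₀, h2⟩ := exists_secondDiff_le (b.contDiff (n := ⊤)) b.hasCompactSupport
  set A₁ := max A₀ 1 with hA₁
  have hA₁0 : 0 ≤ A₁ := hA₀.trans (le_max_left _ _)
  have hb1 : ∀ x, |b x| ≤ A₁ := fun x => by
    rw [abs_of_nonneg b.nonneg]; exact b.le_one.trans (le_max_right _ _)
  have h2' : ∀ x z, |secondDiff b x z| ≤ A₁ * ‖z‖ ^ 2 := fun x z =>
    (h2 x z).trans (mul_le_mul_of_nonneg_right (le_max_left _ _) (by positivity))
  have hs : ∀ x : Space N, 2 < ‖x‖ → b x = 0 := fun x hx =>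
    b.zero_of_le_dist (by rw [dist_zero_right]; exact hx.le)
  set V := volume.real (Metric.closedBall (0 : Space N) (2 + 1)) with hV
  have hV0 : 0 ≤ V := measureReal_nonneg
  refine ⟨fun R x => b (R⁻¹ • x), max (4 * A₁) (4 * A₁ * V), by positivity, fun R hR => ?_⟩
  have hcont : Continuous fun x : Space N => b (R⁻¹ • x) :=
    b.continuous.comp (continuous_const_smul _)
  have hcs : HasCompactSupport fun x : Space N => b (R⁻¹ • x) :=
    b.hasCompactSupport.comp_smul (inv_ne_zero hR.ne')
  have hsd : ∀ x z : Space N, secondDiff (fun x => b (R⁻¹ • x)) x z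
      = secondDiff b (R⁻¹ • x) (R⁻¹ • z) := fun x z => by
    simp only [secondDiff, smul_add, smul_sub]
  have hnorm : ∀ z : Space N, ‖R⁻¹ • z‖ ^ 2 = ‖z‖ ^ 2 / R ^ 2 := fun z => by
    rw [norm_smul, norm_inv, Real.norm_eq_abs, abs_of_pos hR]; field_simp
  refine ⟨hcont, hcs, fun x => b.nonneg, fun x => b.le_one, fun x hx => ?_, fun x hx => ?_,
    fun S h => ⟨fun x => ?_, ?_⟩⟩
  · refine b.one_of_mem_closedBall ?_
    rw [mem_closedBall_zero_iff, norm_smul, norm_inv, Real.norm_eq_abs, abs_of_pos hR]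
    change R⁻¹ * ‖x‖ ≤ 1
    rw [inv_mul_le_iff₀ hR]; linarith
  · refine b.zero_of_le_dist ?_
    rw [dist_zero_right, norm_smul, norm_inv, Real.norm_eq_abs, abs_of_pos hR]
    change 2 ≤ R⁻¹ * ‖x‖
    rw [le_inv_mul_iff₀ hR]; linarith
  · refine S.abs_op_le h (fun x => hb1 (R⁻¹ • x)) fun z => ?_
    rw [hsd, ← hnorm]
    exact (abs_secondDiff_le_min hA₁0 hb1 h2' _ _).trans
      (mul_le_mul_of_nonneg_right (le_max_left _ _) (by positivity))
  · refine S.integral_abs_op_le h hcont.measurable (hcont.integrable_of_hasCompactSupport hcs)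
      (fun x => hb1 (R⁻¹ • x)) fun z => ?_
    simp_rw [hsd]
    -- The factor $R^N$ of the integral bound is the Jacobian of this dilation.
    rw [Measure.integral_comp_smul volume (fun x => |secondDiff b x (R⁻¹ • z)|),
      finrank_euclideanSpace_fin, ← hnorm, smul_eq_mul, inv_pow, inv_inv,
      abs_of_pos (pow_pos hR _), mul_comm (max _ _), mul_assoc]
    refine mul_le_mul_of_nonneg_left ?_ (pow_pos hR _).le
    exact (integral_secondDiff_le b.continuous hA₁0 hb1 hs h2' _).trans
      (mul_le_mul_of_nonneg_right (le_max_right _ _) (by positivity))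

/-! ### Decay of the truncated moments -/

/-- A nonzero point of $h\mathbb Z^N$ has a coordinate of modulus at least $h$. Hence the moments
over $h\le|z|\le1$ see every nontrivial short jump. -/
theorem gridPoint_norm_ge {h : ℝ} (hh : 0 < h) {β : Idx N} (hβ : gridPoint h β ≠ 0) :
    h ≤ ‖gridPoint h β‖ := by
  have : ∃ i, β i ≠ 0 := by
    by_contra hc
    push Not at hc
    exact hβ (by ext i; simp [gridPoint, hc i])
  obtain ⟨i, hi⟩ := this
  refine le_trans ?_ (PiLp.norm_apply_le (gridPoint h β) i)
  simp only [gridPoint, Real.norm_eq_abs, abs_mul, abs_of_pos hh]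
  have : (1 : ℝ) ≤ |(β i : ℝ)| := by exact_mod_cast Int.one_le_abs hi
  nlinarith

theorem Stencil.ofReal_trunc (S : Stencil N) (h R : ℝ) :
    ENNReal.ofReal (S.trunc h R) = ∑' γ : {γ : Idx N // γ ≠ 0},
      ENNReal.ofReal (min (‖gridPoint h (S.offset γ)‖ ^ 2 / R ^ 2) 1 * S.weight γ) :=
  ENNReal.ofReal_tsum_of_nonneg
    (fun γ => mul_nonneg (truncFactor_nonneg _ _) (S.wnn γ)) (S.summable_trunc h R)

/-- A pointwise bound of the truncation factor by the functions in the moment conditions gives a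
bound of the truncated moment. -/
theorem Stencil.ofReal_trunc_le (S : Stencil N) {h R : ℝ} (hh : 0 < h) {a b c : ENNReal}
    {k : ℕ} {I J : Set ℝ}
    (hb : ∀ ρ w : ℝ, h ≤ ρ → 0 ≤ w → ENNReal.ofReal (min (ρ ^ 2 / R ^ 2) 1 * w)
      ≤ a * (Icc h 1).indicator (fun ρ => ENNReal.ofReal (ρ ^ 2 * w)) ρ
        + b * I.indicator (fun ρ => ENNReal.ofReal (ρ ^ 2 * w)) ρ
        + c * J.indicator (fun ρ => ENNReal.ofReal (ρ ^ k * w)) ρ) :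
    ENNReal.ofReal (S.trunc h R)
      ≤ a * S.moment h 2 (Icc h 1) + b * S.moment h 2 I + c * S.moment h k J := by
  rw [S.ofReal_trunc]
  unfold Stencil.moment
  rw [← ENNReal.tsum_mul_left, ← ENNReal.tsum_mul_left, ← ENNReal.tsum_mul_left,
    ← ENNReal.tsum_add, ← ENNReal.tsum_add]
  refine ENNReal.tsum_le_tsum fun γ => ?_
  -- A nonzero index may have zero offset. No moment condition restricts its weight, but its
  -- truncation factor is zero.
  by_cases h0 : gridPoint h (S.offset γ) = 0
  · simp [h0]
  · exact hb _ _ (gridPoint_norm_ge hh h0) (S.wnn γ)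

/-- For $R>1$ the factor $\min(\rho^2/R^2,1)$ is at most $\rho^2/R$ when $\rho\le1$, and at most
$\rho/R$ when $\rho>1$. -/
theorem trunc_le_of_firstMoment {S : ℝ → Stencil N} (hS : FirstMomentWeights S) :
    ∃ C, 0 ≤ C ∧ ∀ h ∈ Ioo (0 : ℝ) 1, ∀ R > 1, (S h).trunc h R ≤ C * R ^ (-(1 : ℝ)) := by
  refine ⟨_, ENNReal.toReal_nonneg (a := ⨆ h ∈ Ioo (0 : ℝ) 1,
    ((S h).moment h 2 (Icc h 1) + (S h).moment h 1 (Ioi 1))), fun h hh R hR => ?_⟩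
  have hR0 : 0 < R := by linarith
  have hle := le_iSup₂ (f := fun h (_ : h ∈ Ioo (0 : ℝ) 1) =>
    ((S h).moment h 2 (Icc h 1) + (S h).moment h 1 (Ioi 1))) h hh
  have key : ENNReal.ofReal ((S h).trunc h R) ≤
      (⨆ h ∈ Ioo (0 : ℝ) 1, ((S h).moment h 2 (Icc h 1) + (S h).moment h 1 (Ioi 1)))
        * ENNReal.ofReal (R ^ (-(1 : ℝ))) := by
    refine ((S h).ofReal_trunc_le hh.1 (a := ENNReal.ofReal (R ^ (-(1 : ℝ)))) (b := 0)
      (c := ENNReal.ofReal (R ^ (-(1 : ℝ)))) (k := 1) (I := univ) (J := Ioi 1)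
      fun ρ w hρ hw => ?_).trans ?_
    · rw [Real.rpow_neg_one]
      have hi : 0 < R⁻¹ := by positivity
      have hi1 : R⁻¹ ≤ 1 := inv_le_one_of_one_le₀ hR.le
      have e : ρ ^ 2 / R ^ 2 = R⁻¹ * R⁻¹ * ρ ^ 2 := by field_simp
      have hρ0 : 0 < ρ := hh.1.trans_le hρ
      rcases le_or_gt ρ 1 with h1 | h1
      · rw [indicator_of_mem (mem_Icc.2 ⟨hρ, h1⟩), ← ENNReal.ofReal_mul hi.le, ← mul_assoc]
        refine le_add_right (le_add_right (ENNReal.ofReal_le_ofReal ?_))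
        refine mul_le_mul_of_nonneg_right ((min_le_left _ _).trans ?_) hw
        rw [e]
        refine mul_le_mul_of_nonneg_right ?_ (by positivity)
        nlinarith
      · rw [indicator_of_mem (show ρ ∈ Ioi 1 from h1), ← ENNReal.ofReal_mul hi.le, ← mul_assoc]
        refine le_add_left (ENNReal.ofReal_le_ofReal ?_)
        refine mul_le_mul_of_nonneg_right ?_ hw
        rw [e, pow_one]
        rcases le_or_gt (R⁻¹ * ρ) 1 with h2 | h2
        · refine (min_le_left _ _).trans ?_
          have : 0 < R⁻¹ * ρ := by positivity
          nlinarith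
        · exact (min_le_right _ _).trans h2.le
    · rw [zero_mul, add_zero, ← mul_add, mul_comm]
      exact mul_le_mul_left hle _
  rw [← ENNReal.ofReal_toReal hS.ne, ← ENNReal.ofReal_mul ENNReal.toReal_nonneg] at key
  exact (ENNReal.ofReal_le_ofReal_iff (by positivity)).1 key

/-- Three ranges of jumps: for $\rho\le1$ one uses $R^{-2}\le R^{-\alpha}$; for $1<\rho\le R$ the
identity $R^{-2}=R^{-\alpha}R^{\alpha-2}$; for $\rho>R$ the identity $1=R^{-\alpha}R^{\alpha}$. The
last two produce exactly the weights of the fractional moment condition. -/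
theorem trunc_le_of_fractional {S : ℝ → Stencil N} {α : ℝ} (hα : α < 2)
    (hS : FractionalWeights α S) :
    ∃ C, 0 ≤ C ∧ ∀ h ∈ Ioo (0 : ℝ) 1, ∀ R > 1, (S h).trunc h R ≤ C * R ^ (-α) := by
  obtain ⟨hL, hF⟩ := hS
  unfold LevyWeights at hL
  set C₁ := ⨆ h ∈ Ioo (0 : ℝ) 1, ((S h).moment h 2 (Icc h 1) + (S h).moment h 0 (Ioi 1))
    with hC₁
  set C₂ := ⨆ R ∈ Ioi (1 : ℝ), ⨆ h ∈ Ioo (0 : ℝ) 1,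
      (ENNReal.ofReal (R ^ (α - 2)) * (S h).moment h 2 (Ioc 1 R)
        + ENNReal.ofReal (R ^ α) * (S h).moment h 0 (Ioi R)) with hC₂
  refine ⟨(C₁ + C₂).toReal, ENNReal.toReal_nonneg, fun h hh R hR => ?_⟩
  have hR0 : 0 < R := by linarith
  have hle1 : (S h).moment h 2 (Icc h 1) ≤ C₁ := le_self_add.trans (le_iSup₂
    (f := fun h (_ : h ∈ Ioo (0 : ℝ) 1) =>
    ((S h).moment h 2 (Icc h 1) + (S h).moment h 0 (Ioi 1))) h hh)
  have hle2 : ENNReal.ofReal (R ^ (α - 2)) * (S h).moment h 2 (Ioc 1 R)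
        + ENNReal.ofReal (R ^ α) * (S h).moment h 0 (Ioi R) ≤ C₂ :=
    (le_iSup₂ (f := fun h (_ : h ∈ Ioo (0 : ℝ) 1) =>
      (ENNReal.ofReal (R ^ (α - 2)) * (S h).moment h 2 (Ioc 1 R)
        + ENNReal.ofReal (R ^ α) * (S h).moment h 0 (Ioi R))) h hh).trans
      (le_iSup₂ (f := fun R (_ : R ∈ Ioi (1 : ℝ)) => ⨆ h ∈ Ioo (0 : ℝ) 1,
      (ENNReal.ofReal (R ^ (α - 2)) * (S h).moment h 2 (Ioc 1 R)
        + ENNReal.ofReal (R ^ α) * (S h).moment h 0 (Ioi R))) R hR)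
  have key : ENNReal.ofReal ((S h).trunc h R) ≤ (C₁ + C₂) * ENNReal.ofReal (R ^ (-α)) := by
    have hRα : 0 < R ^ (-α) := Real.rpow_pos_of_pos hR0 _
    have eb : ENNReal.ofReal (R ^ (-α) * R ^ (α - 2)) = ENNReal.ofReal (R ^ (-α)) *
        ENNReal.ofReal (R ^ (α - 2)) := ENNReal.ofReal_mul hRα.le
    have ec : ENNReal.ofReal (R ^ (-α) * R ^ α) = ENNReal.ofReal (R ^ (-α)) *
        ENNReal.ofReal (R ^ α) := ENNReal.ofReal_mul hRα.le
    have r2 : R ^ (-α) * R ^ (α - 2) = (R ^ 2)⁻¹ := by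
      rw [← Real.rpow_add hR0, ← Real.rpow_natCast, ← Real.rpow_neg hR0.le]; congr 1; push_cast; ring
    have r0 : R ^ (-α) * R ^ α = 1 := by rw [← Real.rpow_add hR0]; simp
    have rle : (R ^ 2)⁻¹ ≤ R ^ (-α) := by
      rw [← Real.rpow_natCast, ← Real.rpow_neg hR0.le]
      exact Real.rpow_le_rpow_of_exponent_le hR.le (by push_cast; linarith)
    refine ((S h).ofReal_trunc_le hh.1 (a := ENNReal.ofReal (R ^ (-α)))
      (b := ENNReal.ofReal (R ^ (-α) * R ^ (α - 2)))
      (c := ENNReal.ofReal (R ^ (-α) * R ^ α)) (k := 0) (I := Ioc 1 R) (J := Ioi R)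
      fun ρ w hρ hw => ?_).trans ?_
    · rw [r2, r0]
      have e : ρ ^ 2 / R ^ 2 = (R ^ 2)⁻¹ * ρ ^ 2 := by field_simp
      rcases le_or_gt ρ 1 with h1 | h1
      · rw [indicator_of_mem (mem_Icc.2 ⟨hρ, h1⟩), ← ENNReal.ofReal_mul hRα.le, ← mul_assoc]
        refine le_add_right (le_add_right (ENNReal.ofReal_le_ofReal ?_))
        refine mul_le_mul_of_nonneg_right ((min_le_left _ _).trans ?_) hw
        rw [e]
        exact mul_le_mul_of_nonneg_right rle (by positivity)
      · rcases le_or_gt ρ R with h2 | h2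
        · rw [indicator_of_mem (show ρ ∈ Ioc 1 R from ⟨h1, h2⟩),
            ← ENNReal.ofReal_mul (by positivity : 0 ≤ (R ^ 2)⁻¹), ← mul_assoc (R ^ 2)⁻¹]
          refine le_add_right (le_add_left (ENNReal.ofReal_le_ofReal ?_))
          refine mul_le_mul_of_nonneg_right ((min_le_left _ _).trans ?_) hw
          rw [e]
        · rw [indicator_of_mem (show ρ ∈ Ioi R from h2),
            ← ENNReal.ofReal_mul zero_le_one, ← mul_assoc (1 : ℝ)]
          refine le_add_left (ENNReal.ofReal_le_ofReal ?_)
          refine mul_le_mul_of_nonneg_right ((min_le_right _ _).trans ?_) hw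
          simp
    · rw [eb, ec, mul_assoc, mul_assoc, add_assoc, ← mul_add, ← mul_add, mul_comm]
      exact mul_le_mul_left (add_le_add hle1 hle2) _
  rw [← ENNReal.ofReal_toReal (ENNReal.add_lt_top.2 ⟨hL, hF⟩).ne,
    ← ENNReal.ofReal_mul ENNReal.toReal_nonneg] at key
  exact (ENNReal.ofReal_le_ofReal_iff (by positivity)).1 key

/-- The truncated moment is the operator evaluated at the origin on $x\mapsto\min(|x|^2/R^2,1)$. It
can therefore be computed from the formula for $\Delta_h$, without identifying the individual
weights. -/
theorem trunc_le_of_laplacian {S : ℝ → Stencil N}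
    (hS : ∀ h > 0, ∀ ψ x, (S h).op h ψ x = discreteLaplacian h ψ x) :
    ∃ C, 0 ≤ C ∧ ∀ h ∈ Ioo (0 : ℝ) 1, ∀ R > 1, (S h).trunc h R ≤ C * R ^ (-(2 : ℝ)) := by
  refine ⟨2 * N, by positivity, fun h hh R hR => ?_⟩
  have hR0 : 0 < R := by linarith
  have e : (S h).trunc h R = (S h).op h (fun x => min (‖x‖ ^ 2 / R ^ 2) 1) 0 := by
    unfold Stencil.trunc Stencil.op
    refine tsum_congr fun γ => ?_
    simp
  rw [e, hS h hh.1]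
  unfold discreteLaplacian
  have hb : ∀ i : Fin N, (min (‖(0 : Space N) + h • EuclideanSpace.single i (1 : ℝ)‖ ^ 2 / R ^ 2) 1
      + min (‖(0 : Space N) - h • EuclideanSpace.single i (1 : ℝ)‖ ^ 2 / R ^ 2) 1
      - 2 * min (‖(0 : Space N)‖ ^ 2 / R ^ 2) 1) / h ^ 2 ≤ 2 * R ^ (-(2 : ℝ)) := by
    intro i
    have h0 := hh.1
    rw [zero_add, zero_sub, norm_neg, norm_smul, PiLp.norm_single, norm_one, mul_one,
      Real.norm_eq_abs, abs_of_pos hh.1, norm_zero, Real.rpow_neg hR0.le, Real.rpow_two,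
      div_le_iff₀ (by positivity)]
    have := min_le_left (h ^ 2 / R ^ 2) 1
    have e : h ^ 2 / R ^ 2 = (R ^ 2)⁻¹ * h ^ 2 := by field_simp
    rw [e] at this ⊢
    simp
    linarith
  refine (Finset.sum_le_sum fun i _ => hb i).trans ?_
  simp; linarith

/-- In each of the three cases the truncated moments decay faster than `R^{-N(1-γ)}`. -/
theorem exists_trunc_decay (hN : 1 ≤ N) {γ : ℝ} {S : ℝ → Stencil N}
    (hS :
      ((∀ h > 0, ∀ ψ x, (S h).op h ψ x = discreteLaplacian h ψ x)
          ∧ LevyWeights S ∧ max ((N : ℝ) - 2) 0 / N < γ)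
      ∨ (FirstMomentWeights S ∧ ((N : ℝ) - 1) / N < γ)
      ∨ (∃ α : ℝ, 0 < α ∧ α < 2 ∧ FractionalWeights α S ∧ max ((N : ℝ) - α) 0 / N < γ)) :
    ∃ θ C : ℝ, N * (1 - γ) < θ ∧ 0 ≤ C ∧
      ∀ h ∈ Ioo (0 : ℝ) 1, ∀ R > 1, (S h).trunc h R ≤ C * R ^ (-θ) := by
  have hN0 : (0 : ℝ) < N := by exact_mod_cast hN
  have aux : ∀ θ : ℝ, max ((N : ℝ) - θ) 0 / N < γ → N * (1 - γ) < θ := fun θ h => by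
    rw [div_lt_iff₀ hN0] at h
    have := le_max_left ((N : ℝ) - θ) 0
    nlinarith
  rcases hS with ⟨h1, -, h2⟩ | ⟨h1, h2⟩ | ⟨α, -, hα, h1, h2⟩
  · obtain ⟨C, hC⟩ := trunc_le_of_laplacian h1
    exact ⟨2, C, aux _ h2, hC⟩
  · obtain ⟨C, hC⟩ := trunc_le_of_firstMoment h1
    refine ⟨1, C, ?_, hC⟩
    rw [div_lt_iff₀ hN0] at h2
    nlinarith
  · obtain ⟨C, hC⟩ := trunc_le_of_fractional hα h1
    exact ⟨α, C, aux _ h2, hC⟩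

/-- The Levy condition in the form used below: the truncated moments at scale one are bounded. -/
theorem trunc_one_le {θ C : ℝ} {S : Stencil N} {h : ℝ}
    (hS : ∀ R > 1, S.trunc h R ≤ C * R ^ (-θ)) :
    S.trunc h 1 ≤ 4 * (C * 2 ^ (-θ)) := by
  -- The decay is known only for $R>1$, so scale $1$ is compared with scale $2$:
  -- $\min(a,1)\le4\min(a/4,1)$.
  refine le_trans ?_ (mul_le_mul_of_nonneg_left (hS 2 (by norm_num)) (by norm_num))
  unfold Stencil.trunc
  rw [← tsum_mul_left]
  refine Summable.tsum_le_tsum (fun γ => ?_) (S.summable_trunc h 1)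
    ((S.summable_trunc h 2).mul_left 4)
  rw [← mul_assoc]
  refine mul_le_mul_of_nonneg_right ?_ (S.wnn γ)
  have := sq_nonneg ‖gridPoint h (S.offset γ)‖
  rw [mul_min_of_nonneg _ _ (by norm_num : (0 : ℝ) ≤ 4)]
  exact min_le_min (by ring_nf; rfl) (by norm_num)

end Operators

end GPME

namespace GPME

/-! ### `L¹` estimates -/

theorem integral_abs_le_add {α : Type*} [MeasurableSpace α] {μ : Measure α} {f a b : α → ℝ}
    (ha : Integrable a μ) (hb : Integrable b μ) (h : ∀ x, |f x| ≤ a x + b x) :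
    ∫ x, |f x| ∂μ ≤ ∫ x, a x ∂μ + ∫ x, b x ∂μ := by
  rw [← integral_add ha hb]
  exact integral_mono_of_nonneg (ae_of_all _ fun x => abs_nonneg _) (ha.add hb) (ae_of_all _ h)

theorem integral_abs_le_add₃ {α : Type*} [MeasurableSpace α] {μ : Measure α} {f a b c : α → ℝ}
    (ha : Integrable a μ) (hb : Integrable b μ) (hc : Integrable c μ)
    (h : ∀ x, |f x| ≤ a x + b x + c x) :
    ∫ x, |f x| ∂μ ≤ ∫ x, a x ∂μ + ∫ x, b x ∂μ + ∫ x, c x ∂μ := by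
  rw [← integral_add ha hb]
  exact integral_abs_le_add (ha.add hb) hc h

theorem setIntegral_abs_le_add₃ {α : Type*} [MeasurableSpace α] {μ : Measure α} {s : Set α}
    {f a b c : α → ℝ} (hs : MeasurableSet s)
    (ha : IntegrableOn a s μ) (hb : IntegrableOn b s μ) (hc : IntegrableOn c s μ)
    (h : ∀ x ∈ s, |f x| ≤ a x + b x + c x) :
    ∫ x in s, |f x| ∂μ ≤ ∫ x in s, a x ∂μ + ∫ x in s, b x ∂μ + ∫ x in s, c x ∂μ := by
  have hab : IntegrableOn (fun x => a x + b x) s μ := ha.add hb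
  rw [← integral_add ha hb, ← integral_add hab hc]
  exact integral_mono_of_nonneg (ae_of_all _ fun x => abs_nonneg _) (hab.add hc)
    ((ae_restrict_iff' hs).2 (ae_of_all _ h))

/-! ### Time grids -/

section TimeGrids

variable {T : ℝ}

theorem TimeGrid.node_mono (G : TimeGrid T) {i j : ℕ} (hij : i ≤ j) (hj : j ≤ G.J) :
    G.node i ≤ G.node j := by
  induction j, hij using Nat.le_induction with
  | base => exact le_rfl
  | succ k hk ih => exact (ih (by omega)).trans (G.node_lt k (by omega)).le

theorem TimeGrid.node_nonneg (G : TimeGrid T) {j : ℕ} (hj : j ≤ G.J) : 0 ≤ G.node j := by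
  rw [← G.node_zero]; exact G.node_mono (Nat.zero_le _) hj

theorem TimeGrid.node_le (G : TimeGrid T) {j : ℕ} (hj : j ≤ G.J) : G.node j ≤ T := by
  exact (G.node_mono hj le_rfl).trans_eq G.node_last

theorem TimeGrid.step_pos (G : TimeGrid T) {j : ℕ} (hj : j < G.J) : 0 < G.step j :=
  sub_pos.2 (G.node_lt j hj)

theorem TimeGrid.step_le_mesh (G : TimeGrid T) {j : ℕ} (hj : j < G.J) : G.step j ≤ G.mesh :=
  le_ciSup (f := fun j : Fin G.J => G.step j) (Set.finite_range _).bddAbove ⟨j, hj⟩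

theorem TimeGrid.sum_step (G : TimeGrid T) (j : ℕ) :
    ∑ k ∈ Finset.range j, G.step k = G.node j := by
  unfold TimeGrid.step
  rw [Finset.sum_range_sub, G.node_zero, sub_zero]

/-- Every time in `(0,T]` lies in one of the intervals of the grid. -/
theorem TimeGrid.exists_mem (G : TimeGrid T) {t : ℝ} (ht : t ∈ Ioc 0 T) :
    ∃ j < G.J, t ∈ Ioc (G.node j) (G.node (j + 1)) := by
  classical
  have hex : ∃ j, t ≤ G.node j := ⟨G.J, by rw [G.node_last]; exact ht.2⟩
  have hle : Nat.find hex ≤ G.J := Nat.find_min' hex (by rw [G.node_last]; exact ht.2)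
  have h0 : Nat.find hex ≠ 0 := fun h0 => by
    have := Nat.find_spec hex
    rw [h0, G.node_zero] at this
    exact absurd ht.1 (not_lt.2 this)
  obtain ⟨k, hk⟩ := Nat.exists_eq_succ_of_ne_zero h0
  refine ⟨k, by omega, not_le.1 (Nat.find_min hex (by omega)), ?_⟩
  have := Nat.find_spec hex
  rwa [hk] at this

/-- The open space-time slab between two consecutive nodes. -/
def TimeGrid.slab (N : ℕ) (G : TimeGrid T) (j : ℕ) : Set (ℝ × Space N) :=
  Ioo (G.node j) (G.node (j + 1)) ×ˢ univ

theorem TimeGrid.measurableSet_slab (N : ℕ) (G : TimeGrid T) (j : ℕ) :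
    MeasurableSet (G.slab N j) := measurableSet_Ioo.prod MeasurableSet.univ

theorem TimeGrid.slab_subset (N : ℕ) (G : TimeGrid T) {j : ℕ} (hj : j < G.J) :
    G.slab N j ⊆ cylinder N T := by
  refine prod_mono ?_ subset_rfl
  exact Ioo_subset_Ioo (G.node_nonneg hj.le) (G.node_le hj)

theorem TimeGrid.slab_disjoint (N : ℕ) (G : TimeGrid T) {s : Finset ℕ}
    (hs : ∀ j ∈ s, j < G.J) :
    (s : Set ℕ).Pairwise (Function.onFun Disjoint (G.slab N)) := by
  have key : ∀ i j : ℕ, i < j → j < G.J → Disjoint (G.slab N i) (G.slab N j) := by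
    intro i j hij hj
    rw [Set.disjoint_left]
    rintro p ⟨h1, -⟩ ⟨h2, -⟩
    have := G.node_mono (show i + 1 ≤ j from hij) hj.le
    exact absurd (h1.2.trans_le this) (not_lt.2 h2.1.le)
  intro i hi j hj hij
  rcases lt_or_gt_of_ne hij with h | h
  · exact key i j h (hs j hj)
  · exact (key j i h (hs i hi)).symm

theorem volume_null_slice (N : ℕ) (t : ℝ) :
    volume ({t} ×ˢ (univ : Set (Space N)) : Set (ℝ × Space N)) = 0 := by
  rw [Measure.volume_eq_prod, Measure.prod_prod]; simp

/-- The open slabs omit only slices at the nodes, which are null. This lets integrals over the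
cylinder be split along the time grid. -/
theorem TimeGrid.iUnion_slab_ae (N : ℕ) (G : TimeGrid T) :
    (⋃ j ∈ Finset.range G.J, G.slab N j : Set (ℝ × Space N)) =ᵐ[volume] cylinder N T := by
  have hnull : volume (⋃ j : ℕ, ({G.node j} ×ˢ (univ : Set (Space N)) : Set (ℝ × Space N))) = 0 :=
    measure_iUnion_null fun j => volume_null_slice N _
  filter_upwards [measure_eq_zero_iff_ae_notMem.1 hnull] with p hp
  simp only [mem_iUnion, not_exists] at hp
  refine propext ⟨fun h => ?_, fun h => ?_⟩
  · obtain ⟨j, hj⟩ := mem_iUnion.1 h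
    obtain ⟨hj, hm⟩ := mem_iUnion.1 hj
    exact G.slab_subset N (Finset.mem_range.1 hj) hm
  · obtain ⟨j, hj, hm⟩ := G.exists_mem (Ioo_subset_Ioc_self h.1)
    refine mem_iUnion.2 ⟨j, mem_iUnion.2 ⟨Finset.mem_range.2 hj, ⟨⟨hm.1, ?_⟩, mem_univ _⟩⟩⟩
    refine lt_of_le_of_ne hm.2 fun he => hp (j + 1) ⟨he, mem_univ _⟩

theorem TimeGrid.sum_setIntegral_slab (N : ℕ) (G : TimeGrid T) {f : ℝ × Space N → ℝ}
    (hf : IntegrableOn f (cylinder N T)) :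
    ∑ j ∈ Finset.range G.J, ∫ p in G.slab N j, f p = ∫ p in cylinder N T, f p := by
  rw [← setIntegral_congr_set (G.iUnion_slab_ae N), integral_biUnion_finset]
  · exact fun j _ => G.measurableSet_slab N j
  · exact G.slab_disjoint N fun j hj => Finset.mem_range.1 hj
  · exact fun j hj => hf.mono_set (G.slab_subset N (Finset.mem_range.1 hj))

theorem TimeGrid.sum_Ico_setIntegral_slab_le (N : ℕ) (G : TimeGrid T) {f : ℝ × Space N → ℝ}
    (hf : IntegrableOn f (cylinder N T)) (h0 : ∀ p, 0 ≤ f p) {i j : ℕ} (hj : j ≤ G.J) :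
    ∑ k ∈ Finset.Ico i j, ∫ p in G.slab N k, f p
      ≤ ∫ p in cylinder N T ∩ (Ioo (G.node i) (G.node j) ×ˢ univ), f p := by
  have hlt : ∀ k ∈ Finset.Ico i j, k < G.J := fun k hk => (Finset.mem_Ico.1 hk).2.trans_le hj
  rw [← integral_biUnion_finset]
  · refine setIntegral_mono_set (hf.mono_set inter_subset_left) (ae_of_all _ h0)
      (Eventually.of_forall ?_)
    intro p hp
    obtain ⟨k, hk⟩ := mem_iUnion.1 hp
    obtain ⟨hk, hm⟩ := mem_iUnion.1 hk
    refine ⟨G.slab_subset N (hlt k hk) hm, ⟨?_, ?_⟩, mem_univ _⟩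
    · exact (G.node_mono (Finset.mem_Ico.1 hk).1 (hlt k hk).le).trans_lt hm.1.1
    · exact hm.1.2.trans_le (G.node_mono (Finset.mem_Ico.1 hk).2 hj)
  · exact fun j _ => G.measurableSet_slab N j
  · exact G.slab_disjoint N hlt
  · exact fun k hk => hf.mono_set (G.slab_subset N (hlt k hk))

theorem restrict_prod_univ (N : ℕ) (s : Set ℝ) :
    (volume : Measure (ℝ × Space N)).restrict (s ×ˢ univ)
      = (volume.restrict s).prod (volume : Measure (Space N)) := by
  rw [Measure.volume_eq_prod, ← Measure.prod_restrict, Measure.restrict_univ]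

theorem integrableOn_slab_snd {N : ℕ} (s : Set ℝ) (hs : volume s ≠ ⊤) {f : Space N → ℝ}
    (hf : Integrable f) : IntegrableOn (fun p : ℝ × Space N => f p.2) (s ×ˢ univ) := by
  have : IsFiniteMeasure (volume.restrict s) := ⟨by simpa using hs.lt_top⟩
  rw [IntegrableOn, restrict_prod_univ]
  exact hf.comp_snd _

theorem setIntegral_prod_univ_snd {N : ℕ} (s : Set ℝ) (f : Space N → ℝ) :
    ∫ p in s ×ˢ (univ : Set (Space N)), f p.2 = volume.real s * ∫ x, f x := by
  rw [restrict_prod_univ, integral_fun_snd]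
  simp [Measure.real]

theorem TimeGrid.setIntegral_slab_snd {N : ℕ} (G : TimeGrid T) {j : ℕ} (hj : j < G.J)
    (f : Space N → ℝ) : ∫ p in G.slab N j, f p.2 = G.step j * ∫ x, f x := by
  unfold TimeGrid.slab
  rw [setIntegral_prod_univ_snd, Real.volume_real_Ioo_of_le (G.node_lt j hj).le]
  rfl

theorem TimeGrid.integrableOn_slab_snd {N : ℕ} (G : TimeGrid T) (j : ℕ)
    {f : Space N → ℝ} (hf : Integrable f) :
    IntegrableOn (fun p : ℝ × Space N => f p.2) (G.slab N j) :=
  GPME.integrableOn_slab_snd _ (by simp) hf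

end TimeGrids

/-! ### Grid cells and cell averages -/

section Cells

variable {N : ℕ} {T : ℝ}

theorem measurable_cellIndex (h : ℝ) : Measurable (cellIndex (N := N) h) := by
  refine measurable_pi_iff.2 fun i => Int.measurable_ceil.comp ?_
  fun_prop

theorem measurable_spaceInterp (h : ℝ) (U : Idx N → ℝ) : Measurable (spaceInterp h U) :=
  (measurable_of_countable U).comp (measurable_cellIndex h)

theorem gridCell_eq_preimage {h : ℝ} (hh : 0 < h) (β : Idx N) :
    gridCell h β = cellIndex h ⁻¹' {β} := by
  ext x; exact mem_gridCell_iff hh β x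

theorem measurableSet_gridCell {h : ℝ} (hh : 0 < h) (β : Idx N) :
    MeasurableSet (gridCell h β) := by
  rw [gridCell_eq_preimage hh]
  exact measurable_cellIndex h (measurableSet_singleton β)

theorem volume_gridCell {h : ℝ} (hh : 0 < h) (β : Idx N) :
    volume (gridCell h β) = ENNReal.ofReal (h ^ N) := by
  have e : gridCell h β = (WithLp.ofLp : Space N → Fin N → ℝ) ⁻¹'
      (univ.pi fun i => Ioc (h * β i - h / 2) (h * β i + h / 2)) := by
    ext x
    simp only [gridCell, mem_ofPred_eq, mem_preimage, mem_univ_pi, mem_Ioc]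
    refine forall_congr' fun i => ?_
    constructor <;> rintro ⟨h1, h2⟩ <;> constructor <;> linarith
  rw [e, (PiLp.volume_preserving_ofLp (Fin N)).measure_preimage
    (MeasurableSet.univ_pi fun i => measurableSet_Ioc).nullMeasurableSet, Real.volume_pi_Ioc]
  have : ∀ i : Fin N, h * β i + h / 2 - (h * β i - h / 2) = h := fun i => by ring
  simp only [this, Finset.prod_const, Finset.card_univ, Fintype.card_fin]
  rw [ENNReal.ofReal_pow hh.le]

theorem lintegral_cellIndex {h : ℝ} (hh : 0 < h) (f : Idx N → ENNReal) :
    ∫⁻ x, f (cellIndex h x) = ∑' β, f β * ENNReal.ofReal (h ^ N) := by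
  rw [← lintegral_map (measurable_of_countable f) (measurable_cellIndex h), lintegral_countable']
  refine tsum_congr fun β => ?_
  rw [Measure.map_apply (measurable_cellIndex h) (measurableSet_singleton β),
    ← gridCell_eq_preimage hh, volume_gridCell hh]

theorem integrable_spaceInterp {h : ℝ} (hh : 0 < h) {U : Idx N → ℝ} (hU : Summable U) :
    Integrable (spaceInterp h U) := by
  refine ⟨(measurable_spaceInterp h U).aestronglyMeasurable, ?_⟩
  unfold HasFiniteIntegral
  have := lintegral_cellIndex hh (fun β => ‖U β‖ₑ)
  refine this.trans_lt ?_
  rw [ENNReal.tsum_mul_right]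
  refine ENNReal.mul_lt_top ?_ ENNReal.ofReal_lt_top
  have h1 := hU.norm.tsum_ofReal_lt_top
  simpa only [ofReal_norm] using h1

theorem cellIndex_add_gridPoint {h : ℝ} (hh : 0 < h) (x : Space N) (η : Idx N) :
    cellIndex h (x + gridPoint h η) = cellIndex h x + η := by
  funext i
  simp only [cellIndex, gridPoint, PiLp.add_apply, Pi.add_apply]
  rw [← Int.ceil_add_intCast]
  congr 1
  field_simp
  ring

theorem Stencil.op_spaceInterp (S : Stencil N) {h : ℝ} (hh : 0 < h) (V : Idx N → ℝ)
    (x : Space N) : S.op h (spaceInterp h V) x = S.gridOp V (cellIndex h x) := by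
  unfold Stencil.op Stencil.gridOp spaceInterp
  refine tsum_congr fun γ => ?_
  rw [cellIndex_add_gridPoint hh]

theorem norm_sub_le_of_cellIndex_eq {h : ℝ} (hh : 0 < h) {x y : Space N}
    (hxy : cellIndex h x = cellIndex h y) : ‖x - y‖ ≤ √N * h := by
  have hx := (mem_gridCell_iff hh _ x).2 hxy
  have hy := (mem_gridCell_iff hh _ y).2 rfl
  rw [EuclideanSpace.norm_eq]
  have : ∑ i, ‖(x - y) i‖ ^ 2 ≤ N * h ^ 2 := by
    calc _ ≤ ∑ _i : Fin N, h ^ 2 := by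
          refine Finset.sum_le_sum fun i _ => ?_
          rw [Real.norm_eq_abs, sq_abs, PiLp.sub_apply]
          have h1 := hx i
          have h2 := hy i
          rw [mem_Ioc] at h1 h2
          refine sq_le_sq' ?_ ?_ <;> linarith
      _ = _ := by simp
  calc _ ≤ √(N * h ^ 2) := Real.sqrt_le_sqrt this
    _ = _ := by rw [Real.sqrt_mul (by positivity), Real.sqrt_sq hh.le]

/-- The piecewise constant function with the averages of `g` over the space-time cells of the
`j`-th time step. -/
noncomputable def sourceInterp (h : ℝ) (G : TimeGrid T) (g : ℝ → Space N → ℝ) (j : ℕ) :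
    Space N → ℝ := spaceInterp h (discreteSource h G g j)

theorem measurable_sourceInterp (h : ℝ) (G : TimeGrid T) (g : ℝ → Space N → ℝ) (j : ℕ) :
    Measurable (sourceInterp h G g j) := measurable_spaceInterp _ _

theorem slab_eq_iUnion {h : ℝ} (hh : 0 < h) (G : TimeGrid T) (j : ℕ) :
    G.slab N j = ⋃ β : Idx N, Ioo (G.node j) (G.node (j + 1)) ×ˢ gridCell h β := by
  ext p
  simp only [TimeGrid.slab, mem_prod, mem_univ, and_true, mem_iUnion, exists_and_left,
    mem_gridCell_iff hh, exists_eq', and_true]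

/-- Averaging over cells contracts $L^1$: the normalization of each average cancels the volume of
its space-time cell, and the cells partition the slab. -/
theorem lintegral_sourceInterp_le {h : ℝ} (hh : 0 < h) (G : TimeGrid T) (g : ℝ → Space N → ℝ)
    {j : ℕ} (hj : j < G.J) :
    ENNReal.ofReal (G.step j) * ∫⁻ x, ‖sourceInterp h G g j x‖ₑ
      ≤ ∫⁻ p in G.slab N j, ‖g p.1 p.2‖ₑ := by
  have hs := G.step_pos hj
  have e1 : ∫⁻ x, ‖sourceInterp h G g j x‖ₑ
      = ∑' β, ‖discreteSource h G g j β‖ₑ * ENNReal.ofReal (h ^ N) :=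
    lintegral_cellIndex hh (fun β => ‖discreteSource h G g j β‖ₑ)
  rw [e1, ← ENNReal.tsum_mul_left, slab_eq_iUnion hh, lintegral_iUnion]
  · refine ENNReal.tsum_le_tsum fun β => ?_
    refine le_trans (le_of_eq ?_) (enorm_integral_le_lintegral_enorm _)
    unfold discreteSource
    rw [enorm_mul, Real.enorm_eq_ofReal (by positivity), mul_comm (ENNReal.ofReal _) ‖_‖ₑ,
      mul_assoc, mul_comm, mul_assoc, mul_assoc, ← ENNReal.ofReal_mul (by positivity),
      ← ENNReal.ofReal_mul (by positivity)]
    have : 1 / (h ^ N * G.step j) * (h ^ N * G.step j) = 1 := by field_simp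
    rw [this]; simp
  · exact fun β => measurableSet_Ioo.prod (measurableSet_gridCell hh β)
  · intro a b hab
    refine Set.disjoint_left.2 fun p h1 h2 => hab ?_
    exact ((mem_gridCell_iff hh a _).1 h1.2).symm.trans ((mem_gridCell_iff hh b _).1 h2.2)

theorem integrable_sourceInterp {h : ℝ} (hh : 0 < h) (G : TimeGrid T) {g : ℝ → Space N → ℝ}
    {j : ℕ} (hj : j < G.J)
    (hg : IntegrableOn (fun p : ℝ × Space N => g p.1 p.2) (G.slab N j)) :
    Integrable (sourceInterp h G g j) := by
  refine ⟨(measurable_sourceInterp h G g j).aestronglyMeasurable, ?_⟩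
  have := (lintegral_sourceInterp_le hh G g hj).trans_lt hg.2
  by_contra hc
  unfold HasFiniteIntegral at hc
  rw [not_lt, top_le_iff] at hc
  rw [hc, ENNReal.mul_top (by simpa using G.step_pos hj)] at this
  exact lt_irrefl _ this

theorem integral_sourceInterp_le {h : ℝ} (hh : 0 < h) (G : TimeGrid T) {g : ℝ → Space N → ℝ}
    {j : ℕ} (hj : j < G.J)
    (hg : IntegrableOn (fun p : ℝ × Space N => g p.1 p.2) (G.slab N j)) :
    G.step j * ∫ x, |sourceInterp h G g j x| ≤ ∫ p in G.slab N j, |g p.1 p.2| := by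
  have h1 := lintegral_sourceInterp_le hh G g hj
  rw [← ofReal_integral_norm_eq_lintegral_enorm hg,
    ← ofReal_integral_norm_eq_lintegral_enorm (integrable_sourceInterp hh G hj hg),
    ← ENNReal.ofReal_mul (G.step_pos hj).le] at h1
  exact (ENNReal.ofReal_le_ofReal_iff (integral_nonneg fun _ => norm_nonneg _)).1 h1

theorem sourceInterp_sub {h : ℝ} (G : TimeGrid T) {g k : ℝ → Space N → ℝ} {j : ℕ}
    (hg : IntegrableOn (fun p : ℝ × Space N => g p.1 p.2) (G.slab N j))
    (hk : IntegrableOn (fun p : ℝ × Space N => k p.1 p.2) (G.slab N j)) (x : Space N) :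
    sourceInterp h G (fun t y => g t y - k t y) j x
      = sourceInterp h G g j x - sourceInterp h G k j x := by
  have hsub : Ioo (G.node j) (G.node (j + 1)) ×ˢ gridCell h (cellIndex h x) ⊆ G.slab N j :=
    prod_mono subset_rfl (subset_univ _)
  simp only [sourceInterp, spaceInterp, discreteSource]
  rw [← mul_sub, ← integral_sub (hg.mono_set hsub) (hk.mono_set hsub)]

/-- An average differs from a value by at most the oscillation over the cell. -/
theorem abs_sourceInterp_sub_le {h : ℝ} (hh : 0 < h) (G : TimeGrid T) {k : ℝ → Space N → ℝ}
    {j : ℕ} (hj : j < G.J)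
    (hk : IntegrableOn (fun p : ℝ × Space N => k p.1 p.2) (G.slab N j)) {p : ℝ × Space N} {ε : ℝ}
    (hε : ∀ q : ℝ × Space N, q.1 ∈ Ioo (G.node j) (G.node (j + 1)) →
      cellIndex h q.2 = cellIndex h p.2 → |k q.1 q.2 - k p.1 p.2| ≤ ε) :
    |sourceInterp h G k j p.2 - k p.1 p.2| ≤ ε := by
  set C := Ioo (G.node j) (G.node (j + 1)) ×ˢ gridCell h (cellIndex h p.2) with hC
  have hs := G.step_pos hj
  have hvol : volume C = ENNReal.ofReal (h ^ N * G.step j) := by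
    rw [hC, Measure.volume_eq_prod, Measure.prod_prod, Real.volume_Ioo, volume_gridCell hh,
      ← ENNReal.ofReal_mul (sub_pos.2 (G.node_lt j hj)).le, mul_comm]
    rfl
  have hreal : volume.real C = h ^ N * G.step j := by
    rw [Measure.real, hvol, ENNReal.toReal_ofReal (by positivity)]
  have hfin : volume C < ⊤ := by rw [hvol]; exact ENNReal.ofReal_lt_top
  have hsub : C ⊆ G.slab N j := prod_mono subset_rfl (subset_univ _)
  have e : sourceInterp h G k j p.2 - k p.1 p.2
      = 1 / (h ^ N * G.step j) * ∫ q in C, (k q.1 q.2 - k p.1 p.2) := by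
    rw [integral_sub (hk.mono_set hsub) (integrableOn_const hfin.ne), setIntegral_const, hreal,
      smul_eq_mul, mul_sub]
    simp only [sourceInterp, spaceInterp, discreteSource]
    field_simp
    rw [hC]
  rw [e, abs_mul, abs_of_pos (by positivity), one_div, inv_mul_le_iff₀ (by positivity), mul_comm,
    ← hreal]
  rw [← Real.norm_eq_abs]
  refine norm_setIntegral_le_of_norm_le_const hfin fun q hq => ?_
  exact hε q hq.1 ((mem_gridCell_iff hh _ _).1 hq.2)

/-- The discretized source converges in `L¹(Q_T)`. -/
theorem tendsto_sourceInterp {g : ℝ → Space N → ℝ}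
    (hg : IntegrableOn (fun p : ℝ × Space N => g p.1 p.2) (cylinder N T))
    (hT : 0 < T) {G : ℝ → TimeGrid T} (hG : Tendsto (fun h => (G h).mesh) (𝓝[>] 0) (𝓝 0)) :
    Tendsto (fun h => ∑ j ∈ Finset.range (G h).J, ∫ p in (G h).slab N j,
      |sourceInterp h (G h) g j p.2 - g p.1 p.2|) (𝓝[>] 0) (𝓝 0) := by
  have hcm : MeasurableSet (cylinder N T) := measurableSet_Ioo.prod MeasurableSet.univ
  refine Metric.tendsto_nhds.2 fun ε hε => ?_
  -- Density of continuous compactly supported functions. The approximation error $\varepsilon/4$ is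
  -- paid twice, once for $g$ and once for its averages, since averaging is a contraction.
  obtain ⟨k, hkc, hgk, hkcont, hkint⟩ :=
    ((integrable_indicator_iff hcm).2 hg).exists_hasCompactSupport_integral_sub_le
      (show 0 < ε / 4 by positivity)
  obtain ⟨ρ, hρ⟩ := hkc.isBounded.exists_norm_le
  set V := volume.real (Metric.closedBall (0 : Space N) (ρ + 1)) with hV
  have hV0 : 0 ≤ V := measureReal_nonneg
  have hε1 : 0 < ε / (4 * (T * V + 1)) := by positivity
  -- This oscillation bound, integrated over time $T$ and a ball of volume $V$, contributes at most
  -- $\varepsilon/4$. Below, cells of diameter less than $1$ also ensure that averages of $k$ vanish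
  -- outside the ball of radius $\rho+1$.
  obtain ⟨δ, hδ, hunif⟩ := Metric.uniformContinuous_iff.1
    (hkc.uniformContinuous_of_continuous hkcont) _ hε1
  have hsmall : ∀ᶠ h : ℝ in 𝓝[>] 0, 0 < h ∧ √N * h < min δ 1 ∧ (G h).mesh < δ := by
    have h1 : Tendsto (fun h : ℝ => √N * h) (𝓝[>] 0) (𝓝 0) := by
      have : Tendsto (fun h : ℝ => √N * h) (𝓝 0) (𝓝 (√N * 0)) :=
        (continuous_const.mul continuous_id).tendsto 0
      rw [mul_zero] at this
      exact this.mono_left nhdsWithin_le_nhds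
    filter_upwards [self_mem_nhdsWithin, h1.eventually_lt_const (show 0 < min δ 1 by positivity),
      hG.eventually_lt_const hδ] with h a b c using ⟨a, b, c⟩
  filter_upwards [hsmall] with h ⟨hh, hhδ, hmesh⟩
  rw [Real.dist_0_eq_abs, abs_of_nonneg (Finset.sum_nonneg fun j _ =>
    integral_nonneg fun p => abs_nonneg _)]
  set k' : ℝ → Space N → ℝ := fun t x => k (t, x) with hk'
  have hkI : IntegrableOn (fun p : ℝ × Space N => k' p.1 p.2) (cylinder N T) := hkint.integrableOn
  have hdI : IntegrableOn (fun p : ℝ × Space N => g p.1 p.2 - k' p.1 p.2) (cylinder N T) :=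
    hg.sub hkI
  have hgk' : ∫ p in cylinder N T, |g p.1 p.2 - k' p.1 p.2| ≤ ε / 4 := by
    refine le_trans ?_ hgk
    rw [← integral_indicator hcm]
    refine integral_mono ((integrable_indicator_iff hcm).2 hdI.abs)
      (((integrable_indicator_iff hcm).2 hg).sub hkint).norm fun p => ?_
    by_cases hp : p ∈ cylinder N T <;> simp [hp, hk']
  have hball : Integrable ((Metric.closedBall (0 : Space N) (ρ + 1)).indicator
      fun _ => ε / (4 * (T * V + 1))) :=
    (integrable_indicator_iff measurableSet_closedBall).2
      (integrableOn_const measure_closedBall_lt_top.ne)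
  have hpt : ∀ j < (G h).J, ∀ p ∈ (G h).slab N j,
      |sourceInterp h (G h) k' j p.2 - k' p.1 p.2|
        ≤ (Metric.closedBall (0 : Space N) (ρ + 1)).indicator
          (fun _ => ε / (4 * (T * V + 1))) p.2 := by
    intro j hj p hp
    refine abs_sourceInterp_sub_le hh _ hj (hkI.mono_set ((G h).slab_subset N hj))
      fun q hq hc => ?_
    have hn := norm_sub_le_of_cellIndex_eq hh hc
    by_cases hx : p.2 ∈ Metric.closedBall (0 : Space N) (ρ + 1)
    · rw [indicator_of_mem hx]
      refine (hunif (a := q) (b := p) ?_).le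
      rw [Prod.dist_eq, max_lt_iff, dist_eq_norm q.2]
      refine ⟨?_, hn.trans_lt (hhδ.trans_le (min_le_left _ _))⟩
      refine lt_of_le_of_lt ?_ (((G h).step_le_mesh hj).trans_lt hmesh)
      rw [Real.dist_eq, abs_le]
      have h1 := hq.1
      have h2 := hq.2
      have h3 := hp.1.1
      have h4 := hp.1.2
      constructor <;> unfold TimeGrid.step <;> linarith
    · rw [indicator_of_notMem hx]
      rw [mem_closedBall_zero_iff, not_le] at hx
      have z : ∀ r : ℝ × Space N, ρ < ‖r.2‖ → k r = 0 := fun r hr => by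
        by_contra hne
        exact absurd ((norm_snd_le r).trans (hρ r (subset_closure hne))) (not_le.2 hr)
      have hq2 : ρ < ‖q.2‖ := by
        have h1 := norm_sub_norm_le p.2 q.2
        rw [norm_sub_rev] at h1
        linarith [hhδ.trans_le (min_le_right δ 1)]
      simp [hk', z q hq2, z p (by linarith)]
  have hterm : ∀ j ∈ Finset.range (G h).J, ∫ p in (G h).slab N j,
      |sourceInterp h (G h) g j p.2 - g p.1 p.2|
      ≤ 2 * (∫ p in (G h).slab N j, |g p.1 p.2 - k' p.1 p.2|)
        + (G h).step j * (ε / (4 * (T * V + 1)) * V) := by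
    intro j hj
    rw [Finset.mem_range] at hj
    have hss := (G h).slab_subset N hj
    have i1 := hg.mono_set hss
    have i2 := hkI.mono_set hss
    have i3 := hdI.mono_set hss
    have s1 := integrable_sourceInterp (g := fun t y => g t y - k' t y) hh (G h) hj i3
    have b1 := integral_sourceInterp_le (g := fun t y => g t y - k' t y) hh (G h) hj i3
    rw [← (G h).setIntegral_slab_snd hj (fun x =>
      |sourceInterp h (G h) (fun t y => g t y - k' t y) j x|)] at b1
    have j1 := (G h).integrableOn_slab_snd j s1.abs
    have j2 := (G h).integrableOn_slab_snd j hball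
    have e2 : ∫ p in (G h).slab N j, (Metric.closedBall (0 : Space N) (ρ + 1)).indicator
        (fun _ => ε / (4 * (T * V + 1))) p.2 = (G h).step j * (ε / (4 * (T * V + 1)) * V) := by
      rw [(G h).setIntegral_slab_snd hj, integral_indicator measurableSet_closedBall,
        setIntegral_const, smul_eq_mul, mul_comm V]
    refine (setIntegral_abs_le_add₃ ((G h).measurableSet_slab N j) j1 i3.norm j2
      fun p hp => ?_).trans ?_
    · refine le_trans ?_ (add_le_add_right (hpt j hj p hp) _)
      rw [sourceInterp_sub _ i1 i2]
      have : sourceInterp h (G h) g j p.2 - g p.1 p.2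
          = (sourceInterp h (G h) g j p.2 - sourceInterp h (G h) k' j p.2)
            + (k' p.1 p.2 - g p.1 p.2)
            + (sourceInterp h (G h) k' j p.2 - k' p.1 p.2) := by ring
      rw [this, Real.norm_eq_abs, abs_sub_comm (g p.1 p.2)]
      exact (abs_add_le _ _).trans (add_le_add_left (abs_add_le _ _) _)
    · rw [e2]
      simp only [Real.norm_eq_abs]
      linarith
  refine (Finset.sum_le_sum hterm).trans_lt ?_
  rw [Finset.sum_add_distrib, ← Finset.mul_sum, (G h).sum_setIntegral_slab N hdI.abs,
    ← Finset.sum_mul, (G h).sum_step, (G h).node_last]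
  have : T * (ε / (4 * (T * V + 1)) * V) ≤ ε / 4 := by
    rw [show T * (ε / (4 * (T * V + 1)) * V) = ε / 4 * (T * V / (T * V + 1)) by field_simp]
    refine mul_le_of_le_one_right (by positivity) ?_
    rw [div_le_one (by positivity)]
    linarith
  linarith

/-- Initial data are treated as a source that does not depend on time, so that their convergence
follows from the one for sources. -/
theorem discreteSource_const {h : ℝ} (hh : 0 < h) (G : TimeGrid T) (u₀ : Space N → ℝ)
    {j : ℕ} (hj : j < G.J) (β : Idx N) :
    discreteSource h G (fun _ => u₀) j β = discreteInitial h u₀ β := by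
  have hs := G.step_pos hj
  unfold discreteSource discreteInitial
  rw [Measure.volume_eq_prod, ← Measure.prod_restrict, integral_fun_snd]
  simp only [MeasurableSet.univ, measureReal_restrict_apply, univ_inter,
    Real.volume_real_Ioo_of_le (G.node_lt j hj).le, smul_eq_mul]
  change 1 / (h ^ N * G.step j) * (G.step j * _) = _
  field_simp

/-- The discretized initial data converge in `L¹(ℝ^N)`. -/
theorem tendsto_initialInterp {u₀ : Space N → ℝ} (hu : Integrable u₀)
    (hT : 0 < T) {G : ℝ → TimeGrid T} (hG : Tendsto (fun h => (G h).mesh) (𝓝[>] 0) (𝓝 0)) :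
    Tendsto (fun h => ∫ x, |spaceInterp h (discreteInitial h u₀) x - u₀ x|)
      (𝓝[>] 0) (𝓝 0) := by
  -- For a time-independent source the sum over the steps is $T$ times the spatial error, hence the
  -- factor $T^{-1}$.
  have h1 := (tendsto_sourceInterp (g := fun _ => u₀)
    (GPME.integrableOn_slab_snd _ (by simp) hu) hT hG).const_mul T⁻¹
  rw [mul_zero] at h1
  refine h1.congr' ?_
  filter_upwards [self_mem_nhdsWithin] with h hh
  have : ∀ j ∈ Finset.range (G h).J, ∫ p in (G h).slab N j,
      |sourceInterp h (G h) (fun _ => u₀) j p.2 - u₀ p.2|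
        = (G h).step j * ∫ x, |spaceInterp h (discreteInitial h u₀) x - u₀ x| := by
    intro j hj
    rw [Finset.mem_range] at hj
    rw [(G h).setIntegral_slab_snd hj (fun x =>
      |sourceInterp h (G h) (fun _ => u₀) j x - u₀ x|)]
    simp only [sourceInterp, spaceInterp, discreteSource_const hh (G h) u₀ hj]
  rw [Finset.sum_congr rfl this, ← Finset.sum_mul, (G h).sum_step, (G h).node_last]
  field_simp

end Cells

end GPME

namespace GPME

section Comparison

variable {N : ℕ} {T : ℝ}

/-! ### The weighted `L¹` estimate -/

/-- The equation is multiplied by $\mathrm{sign}(w')\,\zeta$. The sign turns $p$ into $|p|$ under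
the operator (Kato), and self-adjointness moves the operator onto the weight, leaving only a flux
term. -/
theorem Stencil.step_estimate (S : Stencil N) (h : ℝ) {w w' a p ζ : Space N → ℝ} {Δ B : ℝ}
    (hΔ : 0 ≤ Δ) (heq : ∀ x, w' x = w x + Δ * a x + Δ * S.op h p x)
    (hp : ∀ x, |p x| ≤ B) (hpm : Measurable p) (hsign : ∀ x, 0 ≤ w' x * p x)
    (hzero : ∀ x, w' x = 0 → p x = 0) (hw : Integrable w) (ha : Integrable a)
    (hζ : Integrable ζ) (hζm : Measurable ζ) (hζ0 : ∀ x, 0 ≤ ζ x) (hζ1 : ∀ x, ζ x ≤ 1) :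
    ∫ x, ζ x * |w' x| ≤ (∫ x, ζ x * |w x|) + Δ * (∫ x, ζ x * |a x|)
      + Δ * ∫ x, |p x| * |S.op h ζ x| := by
  have hpt : ∀ x, |w' x| ≤ |w x| + Δ * |a x| + Δ * S.op h (fun y => |p y|) x := by
    intro x
    -- Where $w'$ vanishes its sign is $0$, so the identity requires $p=0$ there; elsewhere $p$ has
    -- the sign of $w'$.
    have hσp : SignType.sign (w' x) * p x = |p x| := by
      rcases lt_trichotomy (w' x) 0 with h0 | h0 | h0
      · have : p x ≤ 0 := by
          by_contra hc
          exact absurd (hsign x) (not_le.2 (mul_neg_of_neg_of_pos h0 (not_le.1 hc)))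
        simp [sign_neg h0, abs_of_nonpos this]
      · simp [hzero x h0]
      · have : 0 ≤ p x := nonneg_of_mul_nonneg_right (hsign x) h0
        simp [sign_pos h0, abs_of_nonneg this]
    have hσ1 : |((SignType.sign (w' x) : SignType) : ℝ)| ≤ 1 := by
      rcases SignType.sign (w' x) with _ | _ | _ <;> simp
    have hle : ∀ y : ℝ, (SignType.sign (w' x) : ℝ) * y ≤ |y| := fun y => by
      refine (le_abs_self _).trans ?_
      rw [abs_mul]
      exact mul_le_of_le_one_left (abs_nonneg _) hσ1
    have hk := S.op_abs h hp hσ1 hσp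
    have e : |w' x| = SignType.sign (w' x) * w x + Δ * (SignType.sign (w' x) * a x)
        + Δ * (SignType.sign (w' x) * S.op h p x) := by
      rw [← sign_mul_self (w' x)]
      linear_combination (SignType.sign (w' x) : ℝ) * heq x
    rw [e]
    gcongr
    · exact hle _
    · exact hle _
  have hbd : ∀ f : Space N → ℝ, Integrable f → Integrable fun x => ζ x * |f x| := fun f hf =>
    hf.abs.bdd_mul (c := 1) hζm.aestronglyMeasurable
      (Eventually.of_forall fun x => by
        rw [Real.norm_eq_abs, abs_of_nonneg (hζ0 x)]; exact hζ1 x)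
  have hpa : ∀ x, |(fun y => |p y|) x| ≤ B := by simpa using hp
  have hpam : Measurable fun y => |p y| := by fun_prop
  have hop : Integrable fun x => ζ x * S.op h (fun y => |p y|) x :=
    hζ.mul_bdd (c := 2 * B * S.mass) (S.measurable_op h hpam).aestronglyMeasurable
      (Eventually.of_forall fun x => S.abs_op_le_mass h hpa x)
  have hopζ : Integrable fun x => |p x| * |S.op h ζ x| :=
    (S.integrable_op h hζm hζ).abs.bdd_mul (c := B) hpam.aestronglyMeasurable
      (Eventually.of_forall hpa)
  have hopζ' : Integrable fun x => |p x| * S.op h ζ x :=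
    (S.integrable_op h hζm hζ).bdd_mul (c := B) hpam.aestronglyMeasurable
      (Eventually.of_forall hpa)
  have i1 : Integrable fun x => ζ x * |w x| + Δ * (ζ x * |a x|) :=
    (hbd w hw).add ((hbd a ha).const_mul Δ)
  calc _ ≤ ∫ x, (ζ x * |w x| + Δ * (ζ x * |a x|) + Δ * (ζ x * S.op h (fun y => |p y|) x)) := by
        refine integral_mono_of_nonneg (ae_of_all _ fun x =>
          mul_nonneg (hζ0 x) (abs_nonneg _)) (i1.add (hop.const_mul Δ)) (ae_of_all _ fun x => ?_)
        have := mul_le_mul_of_nonneg_left (hpt x) (hζ0 x)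
        simp only
        linarith
    _ = (∫ x, ζ x * |w x|) + Δ * (∫ x, ζ x * |a x|) + Δ * ∫ x, |p x| * S.op h ζ x := by
        rw [integral_add i1 (hop.const_mul Δ), integral_add (hbd w hw) ((hbd a ha).const_mul Δ),
          integral_const_mul, integral_const_mul, S.integral_mul_op h hpa hpam hζ]
    _ ≤ _ := by
        refine add_le_add_right (mul_le_mul_of_nonneg_left (integral_mono hopζ' hopζ fun x => ?_) hΔ) _
        exact mul_le_mul_of_nonneg_left (le_abs_self _) (abs_nonneg _)

/-- The difference `w` of two solutions of the scheme, with `p` the difference of the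
nonlinearities and `a` that of the sources. -/
structure IsSchemeDiff (S : Stencil N) (h : ℝ) (G : TimeGrid T) (γ C : ℝ)
    (w a p : ℕ → Space N → ℝ) : Prop where
  eq : ∀ j < G.J, ∀ x,
    w (j + 1) x = w j x + G.step j * a j x + G.step j * S.op h (p (j + 1)) x
  int : ∀ j ≤ G.J, Integrable (w j)
  intSource : ∀ j < G.J, Integrable (a j)
  meas : ∀ j ≤ G.J, Measurable (p j)
  holder : ∀ j ≤ G.J, ∀ x, |p j x| ≤ C * |w j x| ^ γ
  sign : ∀ j ≤ G.J, ∀ x, 0 ≤ w j x * p j x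
  bdd : ∃ B, ∀ j ≤ G.J, ∀ x, |p j x| ≤ B

theorem IsSchemeDiff.weighted {S : Stencil N} {h : ℝ} {G : TimeGrid T} {γ C : ℝ} (hγ : 0 < γ)
    {w a p : ℕ → Space N → ℝ} (H : IsSchemeDiff S h G γ C w a p) {ζ : Space N → ℝ}
    (hζ : Integrable ζ) (hζm : Measurable ζ) (hζ0 : ∀ x, 0 ≤ ζ x) (hζ1 : ∀ x, ζ x ≤ 1)
    {j : ℕ} (hj : j ≤ G.J) :
    ∫ x, ζ x * |w j x| ≤ (∫ x, ζ x * |w 0 x|)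
      + (∑ k ∈ Finset.range j, G.step k * ∫ x, ζ x * |a k x|)
      + ∑ k ∈ Finset.range j, G.step k * ∫ x, |p (k + 1) x| * |S.op h ζ x| := by
  obtain ⟨B, hB⟩ := H.bdd
  induction j with
  | zero => simp
  | succ k ih =>
    rw [Finset.sum_range_succ, Finset.sum_range_succ]
    have := S.step_estimate h (G.step_pos hj).le (H.eq k hj) (hB _ hj) (H.meas _ hj)
      (H.sign _ hj) (fun x hx => by
        have := H.holder _ hj x
        rw [hx, abs_zero, Real.zero_rpow hγ.ne', mul_zero] at this
        exact abs_nonpos_iff.1 this) (H.int _ (by omega)) (H.intSource k hj) hζ hζm hζ0 hζ1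
    linarith [ih (by omega)]

/-! ### The flux through the cut-off functions -/

/-- Below the level $K$ the constant term dominates, above it the linear one does, because
$s^{\gamma-1}\le K^{\gamma-1}$. The level $K$ is a free parameter to be optimized. -/
theorem rpow_le_affine {s K γ : ℝ} (hs : 0 ≤ s) (hK : 0 < K) (h0 : 0 < γ) (h1 : γ ≤ 1) :
    s ^ γ ≤ K ^ (γ - 1) * s + K ^ γ := by
  have hKγ : 0 < K ^ γ := Real.rpow_pos_of_pos hK _
  have hKγ1 : 0 < K ^ (γ - 1) := Real.rpow_pos_of_pos hK _
  rcases le_or_gt s K with h | h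
  · have := Real.rpow_le_rpow hs h h0.le
    nlinarith [mul_nonneg hKγ1.le hs]
  · have hs0 : 0 < s := hK.trans h
    have e : s ^ γ = s ^ (γ - 1) * s := by
      rw [Real.rpow_sub_one hs0.ne']; field_simp
    have := Real.rpow_le_rpow_of_nonpos hK h.le (by linarith : γ - 1 ≤ 0)
    rw [e]
    nlinarith [mul_le_mul_of_nonneg_right this hs]

/-- The power $|w|^\gamma$ need not be integrable, so it is split at level $K$: the linear part
pairs with the sup bound of $e$, the constant part with its $L^1$ bound. It serves both the flux
estimate and the passage to the limit in the nonlinearity. -/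
theorem integral_holder_mul_le {α : Type*} [MeasurableSpace α] {μ : Measure α}
    {w p e : α → ℝ} {γ C K A B L : ℝ} (h0 : 0 < γ) (h1 : γ ≤ 1)
    (hC : 0 ≤ C) (hK : 0 < K) (hp : ∀ᵐ x ∂μ, |p x| ≤ C * |w x| ^ γ) (hw : Integrable w μ)
    (hL : ∫ x, |w x| ∂μ ≤ L) (he : Integrable e μ) (hA0 : 0 ≤ A) (hA : ∀ x, |e x| ≤ A)
    (hB : ∫ x, |e x| ∂μ ≤ B) :
    ∫ x, |p x| * |e x| ∂μ ≤ C * (K ^ (γ - 1) * A * L + K ^ γ * B) := by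
  have hKγ : 0 < K ^ γ := Real.rpow_pos_of_pos hK _
  have hKγ1 : 0 < K ^ (γ - 1) := Real.rpow_pos_of_pos hK _
  calc _ ≤ ∫ x, (C * (K ^ (γ - 1) * A) * |w x| + C * K ^ γ * |e x|) ∂μ := by
        refine integral_mono_of_nonneg (ae_of_all _ fun x => by positivity)
          ((hw.abs.const_mul _).add (he.abs.const_mul _)) ?_
        filter_upwards [hp] with x hpx
        calc |p x| * |e x| ≤ C * (K ^ (γ - 1) * |w x| + K ^ γ) * |e x| := by
              refine mul_le_mul_of_nonneg_right (hpx.trans ?_) (abs_nonneg _)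
              exact mul_le_mul_of_nonneg_left (rpow_le_affine (abs_nonneg _) hK h0 h1) hC
          _ = C * K ^ (γ - 1) * |w x| * |e x| + C * K ^ γ * |e x| := by ring
          _ ≤ _ := by
              have : C * K ^ (γ - 1) * |w x| * |e x| ≤ C * K ^ (γ - 1) * |w x| * A :=
                mul_le_mul_of_nonneg_left (hA x) (by positivity)
              linarith
    _ = C * (K ^ (γ - 1) * A) * ∫ x, |w x| ∂μ + C * K ^ γ * ∫ x, |e x| ∂μ := by
        rw [integral_add (hw.abs.const_mul _) (he.abs.const_mul _), integral_const_mul,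
          integral_const_mul]
    _ ≤ C * (K ^ (γ - 1) * A) * L + C * K ^ γ * B := by gcongr
    _ = _ := by ring

/-- A choice of smooth cut-off functions. -/
noncomputable def cutoff (N : ℕ) : ℝ → Space N → ℝ := (exists_cutoff N).choose

/-- The constant in the estimates of the discrete operators on `cutoff`. -/
noncomputable def cutoffConst (N : ℕ) : ℝ := (exists_cutoff N).choose_spec.choose

theorem cutoffConst_nonneg (N : ℕ) : 0 ≤ cutoffConst N :=
  (exists_cutoff N).choose_spec.choose_spec.1

theorem cutoff_spec (N : ℕ) : ∀ R > 0,
    Continuous (cutoff N R) ∧ HasCompactSupport (cutoff N R) ∧ (∀ x, 0 ≤ cutoff N R x) ∧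
    (∀ x, cutoff N R x ≤ 1) ∧ (∀ x, ‖x‖ ≤ R → cutoff N R x = 1) ∧
    (∀ x, 2 * R ≤ ‖x‖ → cutoff N R x = 0) ∧
    ∀ (S : Stencil N) (h : ℝ), (∀ x, |S.op h (cutoff N R) x| ≤ cutoffConst N * S.trunc h R) ∧
      ∫ x, |S.op h (cutoff N R) x| ≤ cutoffConst N * R ^ N * S.trunc h R :=
  (exists_cutoff N).choose_spec.choose_spec.2

theorem cutoff_integrable {R : ℝ} (hR : 0 < R) : Integrable (cutoff N R) :=
  (cutoff_spec N R hR).1.integrable_of_hasCompactSupport (cutoff_spec N R hR).2.1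

theorem abs_cutoff_le {R : ℝ} (hR : 0 < R) (x : Space N) : |cutoff N R x| ≤ 1 := by
  obtain ⟨-, -, h0, h1, -⟩ := cutoff_spec N R hR
  rw [abs_of_nonneg (h0 x)]; exact h1 x

/-- The level $K=R^{-N}$ balances the two parts: the operator on $\zeta_R$ is $O(R^{-\theta})$ in
sup norm and $O(R^{N-\theta})$ in $L^1$, so both contribute $R^{N(1-\gamma)-\theta}$. The exponent
is negative precisely when $N(1-\gamma)<\theta$. -/
theorem integral_flux_le {S : Stencil N} {h R θ γ C C₀ L : ℝ} (h0 : 0 < γ) (h1 : γ ≤ 1)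
    (hC : 0 ≤ C) (hC₀ : 0 ≤ C₀) (hR : 0 < R) (hS : S.trunc h R ≤ C₀ * R ^ (-θ))
    {w p : Space N → ℝ} (hp : ∀ x, |p x| ≤ C * |w x| ^ γ) (hw : Integrable w)
    (hL : ∫ x, |w x| ≤ L) :
    ∫ x, |p x| * |S.op h (cutoff N R) x|
      ≤ C * cutoffConst N * C₀ * (L + 1) * R ^ (N * (1 - γ) - θ) := by
  obtain ⟨hc, -, -, -, -, -, hop⟩ := cutoff_spec N R hR
  have hA := cutoffConst_nonneg N
  have hRθ : 0 < R ^ (-θ) := Real.rpow_pos_of_pos hR _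
  have hL0 : 0 ≤ L := (integral_nonneg fun _ => abs_nonneg _).trans hL
  have key := integral_holder_mul_le (K := R ^ (-(N : ℝ))) h0 h1 hC (Real.rpow_pos_of_pos hR _)
    (ae_of_all _ hp) hw hL (S.integrable_op h hc.measurable (cutoff_integrable hR))
    (mul_nonneg hA (mul_nonneg hC₀ hRθ.le))
    (fun x => ((hop S h).1 x).trans (mul_le_mul_of_nonneg_left hS hA))
    ((hop S h).2.trans (mul_le_mul_of_nonneg_left hS (by positivity)))
  refine key.trans (le_of_eq ?_)
  have e1 : (R ^ (-(N : ℝ))) ^ (γ - 1) * R ^ (-θ) = R ^ (N * (1 - γ) - θ) := by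
    rw [← Real.rpow_mul hR.le, ← Real.rpow_add hR]; congr 1; ring
  have e2 : (R ^ (-(N : ℝ))) ^ γ * (R ^ N * R ^ (-θ)) = R ^ (N * (1 - γ) - θ) := by
    rw [← Real.rpow_mul hR.le, ← Real.rpow_natCast, ← Real.rpow_add hR, ← Real.rpow_add hR]
    congr 1; ring
  calc _ = C * cutoffConst N * C₀ * (L * ((R ^ (-(N : ℝ))) ^ (γ - 1) * R ^ (-θ))
        + (R ^ (-(N : ℝ))) ^ γ * (R ^ N * R ^ (-θ))) := by ring
    _ = _ := by rw [e1, e2]; ring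

theorem tendsto_flux_bound {θ γ : ℝ} (hθ : N * (1 - γ) < θ) (K : ℝ) :
    Tendsto (fun R : ℝ => K * R ^ (N * (1 - γ) - θ)) atTop (𝓝 0) := by
  have h := tendsto_rpow_neg_atTop (y := θ - N * (1 - γ)) (by linarith)
  rw [neg_sub] at h
  simpa using h.const_mul K

theorem tendsto_integral_cutoff_mul {f : Space N → ℝ} (hf : Integrable f) :
    Tendsto (fun R : ℝ => ∫ x, cutoff N R x * f x) atTop (𝓝 (∫ x, f x)) := by
  refine tendsto_integral_filter_of_dominated_convergence (fun x => |f x|) ?_ ?_ hf.abs ?_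
  · filter_upwards [eventually_gt_atTop 0] with R hR
    exact (cutoff_spec N R hR).1.aestronglyMeasurable.mul hf.1
  · filter_upwards [eventually_gt_atTop 0] with R hR
    refine ae_of_all _ fun x => ?_
    rw [norm_mul]
    exact mul_le_of_le_one_left (abs_nonneg _) (abs_cutoff_le hR x)
  · refine ae_of_all _ fun x => ?_
    refine tendsto_const_nhds.congr' ?_
    filter_upwards [eventually_gt_atTop 0, eventually_ge_atTop ‖x‖] with R hR hx
    rw [(cutoff_spec N R hR).2.2.2.2.1 x hx, one_mul]

/-- The `L¹` contraction. -/
theorem IsSchemeDiff.contraction {S : Stencil N} {h : ℝ} {G : TimeGrid T} {γ C θ C₀ : ℝ}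
    (h0 : 0 < γ) (h1 : γ ≤ 1) (hC : 0 ≤ C) (hC₀ : 0 ≤ C₀) (hθ : N * (1 - γ) < θ)
    (hS : ∀ R > 1, S.trunc h R ≤ C₀ * R ^ (-θ))
    {w a p : ℕ → Space N → ℝ} (H : IsSchemeDiff S h G γ C w a p) {j : ℕ} (hj : j ≤ G.J) :
    ∫ x, |w j x| ≤ (∫ x, |w 0 x|) + ∑ k ∈ Finset.range j, G.step k * ∫ x, |a k x| := by
  -- No uniformity is needed here: $L$ only has to be finite for this solution, since it multiplies
  -- a quantity that vanishes as $R\to\infty$.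
  set L := ∑ k ∈ Finset.range (G.J + 1), ∫ x, |w k x| with hL
  have hLk : ∀ k ≤ G.J, ∫ x, |w k x| ≤ L := fun k hk =>
    Finset.single_le_sum (f := fun k => ∫ x, |w k x|)
      (fun k _ => integral_nonneg fun x => abs_nonneg _) (Finset.mem_range.2 (by omega))
  set K := ∑ k ∈ Finset.range j, G.step k * (C * cutoffConst N * C₀ * (L + 1)) with hK
  have hlim := (tendsto_const_nhds (x := (∫ x, |w 0 x|) +
    ∑ k ∈ Finset.range j, G.step k * ∫ x, |a k x|)).add (tendsto_flux_bound (N := N) hθ K)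
  rw [add_zero] at hlim
  refine le_of_tendsto_of_tendsto (tendsto_integral_cutoff_mul (H.int j hj).abs) hlim ?_
  filter_upwards [eventually_gt_atTop 1] with R hR
  have hR0 : 0 < R := by linarith
  obtain ⟨hc, -, hn, hle, -, -, -⟩ := cutoff_spec N R hR0
  have hcut : ∀ f : Space N → ℝ, Integrable f → ∫ x, cutoff N R x * |f x| ≤ ∫ x, |f x| := by
    intro f hf
    refine integral_mono_of_nonneg (ae_of_all _ fun x => mul_nonneg (hn x) (abs_nonneg _)) hf.abs
      (ae_of_all _ fun x => mul_le_of_le_one_left (abs_nonneg _) (hle x))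
  refine (H.weighted h0 (cutoff_integrable hR0) hc.measurable hn hle hj).trans ?_
  refine add_le_add (add_le_add (hcut _ (H.int 0 (Nat.zero_le _)))
    (Finset.sum_le_sum fun k hk => ?_)) ?_
  · have hk' : k < G.J := (Finset.mem_range.1 hk).trans_le hj
    exact mul_le_mul_of_nonneg_left (hcut _ (H.intSource k hk')) (G.step_pos hk').le
  · rw [hK, Finset.sum_mul]
    refine Finset.sum_le_sum fun k hk => ?_
    have hk' : k < G.J := (Finset.mem_range.1 hk).trans_le hj
    rw [mul_assoc]
    exact mul_le_mul_of_nonneg_left (integral_flux_le h0 h1 hC hC₀ hR0 (hS R hR)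
      (H.holder _ hk') (H.int _ hk') (hLk _ hk')) (G.step_pos hk').le

/-- The uniform tail estimate. -/
theorem IsSchemeDiff.tail {S : Stencil N} {h : ℝ} {G : TimeGrid T} {γ C θ C₀ L : ℝ}
    (h0 : 0 < γ) (h1 : γ ≤ 1) (hC : 0 ≤ C) (hC₀ : 0 ≤ C₀) (hθ : N * (1 - γ) < θ)
    (hS : ∀ R > 1, S.trunc h R ≤ C₀ * R ^ (-θ))
    {w a p : ℕ → Space N → ℝ} (H : IsSchemeDiff S h G γ C w a p)
    (hL : ∀ k ≤ G.J, ∫ x, |w k x| ≤ L) {R : ℝ} (hR : 1 < R) {j : ℕ} (hj : j ≤ G.J) :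
    ∫ x in {x | 2 * R < ‖x‖}, |w j x| ≤ (∫ x in {x | R < ‖x‖}, |w 0 x|)
      + (∑ k ∈ Finset.range j, G.step k * ∫ x in {x | R < ‖x‖}, |a k x|)
      + T * (C * cutoffConst N * C₀ * (L + 1)) * R ^ (N * (1 - γ) - θ) := by
  have hR0 : 0 < R := by linarith
  have hms : ∀ ρ : ℝ, MeasurableSet {x : Space N | ρ < ‖x‖} := fun ρ =>
    measurableSet_lt measurable_const measurable_norm
  set K := C * cutoffConst N * C₀ * (L + 1) with hK
  have hL0 : 0 ≤ L := (integral_nonneg fun _ => abs_nonneg _).trans (hL j hj)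
  have hK0 : 0 ≤ K := by have := cutoffConst_nonneg N; positivity
  obtain ⟨hc, -, hn, hle, hone, hzero, -⟩ := cutoff_spec N R hR0
  have hiw := (H.int j hj).abs
  have hci : Integrable fun x => cutoff N R x * |w j x| :=
    hiw.bdd_mul (c := 1) hc.aestronglyMeasurable (ae_of_all _ fun x => abs_cutoff_le hR0 x)
  set D := (∫ x in {x | R < ‖x‖}, |w 0 x|)
      + ∑ k ∈ Finset.range j, G.step k * ∫ x in {x | R < ‖x‖}, |a k x| with hD
  -- The natural weight $1-\zeta_R$ is not integrable, so $\zeta_{R'}-\zeta_R$ is used and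
  -- $R'\to\infty$ with $R$ fixed. The flux through the outer cut-off disappears; the one through
  -- the inner cut-off stays in the estimate.
  have hlim : Tendsto (fun R' : ℝ => D + T * (K * R ^ (N * (1 - γ) - θ)
      + K * R' ^ (N * (1 - γ) - θ))) atTop (𝓝 (D + T * (K * R ^ (N * (1 - γ) - θ) + 0))) :=
    ((tendsto_const_nhds.add (tendsto_flux_bound (N := N) hθ K)).const_mul T).const_add D
  rw [add_zero, ← mul_assoc] at hlim
  have hlim' : Tendsto (fun R' : ℝ => (∫ x, cutoff N R' x * |w j x|) - ∫ x, cutoff N R x * |w j x|)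
      atTop (𝓝 ((∫ x, |w j x|) - ∫ x, cutoff N R x * |w j x|)) :=
    (tendsto_integral_cutoff_mul hiw).sub_const _
  have hfirst : ∫ x in {x | 2 * R < ‖x‖}, |w j x|
      ≤ (∫ x, |w j x|) - ∫ x, cutoff N R x * |w j x| := by
    rw [← integral_sub hiw hci, ← integral_indicator (hms _)]
    refine integral_mono_of_nonneg (ae_of_all _ fun x => indicator_nonneg
      (fun _ _ => abs_nonneg _) _) (hiw.sub hci) (ae_of_all _ fun x => ?_)
    by_cases hx : 2 * R < ‖x‖
    · rw [indicator_of_mem (show x ∈ {x | 2 * R < ‖x‖} from hx)]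
      simp [hzero x hx.le]
    · rw [indicator_of_notMem (show x ∉ {x | 2 * R < ‖x‖} from hx)]
      simp only [sub_nonneg]
      exact mul_le_of_le_one_left (abs_nonneg _) (hle x)
  refine hfirst.trans (le_of_tendsto_of_tendsto hlim' hlim ?_)
  filter_upwards [eventually_ge_atTop (2 * R)] with R' hR'
  have hR'1 : 1 < R' := by linarith
  have hR'0 : 0 < R' := by linarith
  obtain ⟨hc', -, hn', hle', hone', hzero', -⟩ := cutoff_spec N R' hR'0
  set ζ : Space N → ℝ := fun x => cutoff N R' x - cutoff N R x with hζ
  -- Since $R'\ge2R$, the outer cut-off equals $1$ wherever the inner one is nonzero.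
  have hζ0 : ∀ x, 0 ≤ ζ x := fun x => by
    rcases le_or_gt ‖x‖ R' with hx | hx
    · simp only [hζ, hone' x hx]; linarith [hle x]
    · simp only [hζ, hzero x (by linarith)]; linarith [hn' x]
  have hζ1 : ∀ x, ζ x ≤ 1 := fun x => by simp only [hζ]; linarith [hle' x, hn x]
  have hζR : ∀ x, ‖x‖ ≤ R → ζ x = 0 := fun x hx => by
    simp only [hζ, hone x hx, hone' x (by linarith), sub_self]
  have hcut : ∀ f : Space N → ℝ, Integrable f →
      ∫ x, ζ x * |f x| ≤ ∫ x in {x | R < ‖x‖}, |f x| := by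
    intro f hf
    rw [← integral_indicator (hms _)]
    refine integral_mono_of_nonneg (ae_of_all _ fun x => mul_nonneg (hζ0 x) (abs_nonneg _))
      (hf.abs.indicator (hms _)) (ae_of_all _ fun x => ?_)
    by_cases hx : R < ‖x‖
    · simp only [indicator_of_mem (show x ∈ {x | R < ‖x‖} from hx)]
      exact mul_le_of_le_one_left (abs_nonneg _) (hζ1 x)
    · simp [indicator_of_notMem (show x ∉ {x | R < ‖x‖} from hx), hζR x (not_lt.1 hx)]
  have hci' : Integrable fun x => cutoff N R' x * |w j x| :=
    hiw.bdd_mul (c := 1) hc'.aestronglyMeasurable (ae_of_all _ fun x => abs_cutoff_le hR'0 x)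
  have e : (∫ x, cutoff N R' x * |w j x|) - ∫ x, cutoff N R x * |w j x| = ∫ x, ζ x * |w j x| := by
    rw [← integral_sub hci' hci]
    simp only [hζ, sub_mul]
  rw [e]
  refine (H.weighted h0 ((cutoff_integrable hR'0).sub (cutoff_integrable hR0))
    (hc'.sub hc).measurable hζ0 hζ1 hj).trans ?_
  refine add_le_add (add_le_add (hcut _ (H.int 0 (Nat.zero_le _)))
    (Finset.sum_le_sum fun k hk => ?_)) ?_
  · have hk' : k < G.J := (Finset.mem_range.1 hk).trans_le hj
    exact mul_le_mul_of_nonneg_left (hcut _ (H.intSource k hk')) (G.step_pos hk').le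
  · have hterm : ∀ k ∈ Finset.range j, G.step k * ∫ x, |p (k + 1) x| * |S.op h ζ x|
        ≤ G.step k * (K * R ^ (N * (1 - γ) - θ) + K * R' ^ (N * (1 - γ) - θ)) := by
      intro k hk
      have hk' : k < G.J := (Finset.mem_range.1 hk).trans_le hj
      refine mul_le_mul_of_nonneg_left ?_ (G.step_pos hk').le
      obtain ⟨B, hB⟩ := H.bdd
      have b1 := integral_flux_le h0 h1 hC hC₀ hR0 (hS R hR) (H.holder _ hk') (H.int _ hk')
        (hL _ hk')
      have b2 := integral_flux_le h0 h1 hC hC₀ hR'0 (hS R' hR'1) (H.holder _ hk') (H.int _ hk')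
        (hL _ hk')
      have hpi : ∀ ρ > 0, Integrable fun x => |p (k + 1) x| * |S.op h (cutoff N ρ) x| :=
        fun ρ hρ => (S.integrable_op h (cutoff_spec N ρ hρ).1.measurable
          (cutoff_integrable hρ)).abs.bdd_mul (c := B) (H.meas _ hk').abs.aestronglyMeasurable
          (ae_of_all _ fun x => by simpa using hB _ hk' x)
      refine le_trans ?_ (add_le_add b1 b2)
      rw [← integral_add (hpi R hR0) (hpi R' hR'0)]
      refine integral_mono_of_nonneg (ae_of_all _ fun x => by positivity)
        ((hpi R hR0).add (hpi R' hR'0)) (ae_of_all _ fun x => ?_)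
      simp only
      rw [← mul_add]
      refine mul_le_mul_of_nonneg_left ?_ (abs_nonneg _)
      rw [hζ, S.op_sub h (abs_cutoff_le hR'0) (abs_cutoff_le hR0), add_comm]
      exact abs_sub _ _
    refine (Finset.sum_le_sum hterm).trans ?_
    rw [← Finset.sum_mul, G.sum_step]
    refine mul_le_mul_of_nonneg_right (G.node_le hj) ?_
    positivity

/-! ### The maximum principle -/

/-- If $V$ exceeded $m\ge0$ somewhere, it would attain its maximum, because a summable function
tends to zero at infinity. At a maximum the operator on $\varphi(V)$ is nonpositive, so $V\le W\le
m$ there. -/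
theorem Stencil.le_of_implicit_step (S : Stencil N) {φ : ℝ → ℝ} (hφ : Monotone φ)
    {V W : Idx N → ℝ} {s m : ℝ} (hs : 0 ≤ s) (hV : Summable V) (hm : 0 ≤ m)
    (heq : ∀ β, V β = W β + s * S.gridOp (fun η => φ (V η)) β) (hW : ∀ β, W β ≤ m) (β : Idx N) :
    V β ≤ m := by
  by_contra! hc
  have hfin : {η | V β ≤ V η}.Finite := by
    have := hV.tendsto_cofinite_zero.eventually (gt_mem_nhds (hm.trans_lt hc))
    simpa [Filter.eventually_cofinite] using this
  obtain ⟨η, hη, hmax⟩ := hfin.exists_maximalFor V _ ⟨β, show V β ≤ V β from le_rfl⟩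
  have hle : ∀ ξ, V ξ ≤ V η := fun ξ => by
    rcases le_total (V ξ) (V η) with h | h
    · exact h
    · exact hmax (show V β ≤ V ξ from le_trans hη h) h
  -- Every term is nonpositive; convergence is not needed for the sign, as the default value $0$ of
  -- a divergent `tsum` also satisfies the bound.
  have hop : S.gridOp (fun η => φ (V η)) η ≤ 0 :=
    tsum_nonpos fun γ => mul_nonpos_of_nonpos_of_nonneg (sub_nonpos.2 (hφ (hle _))) (S.wnn γ)
  have := heq η
  have h2 : V β ≤ V η := hη
  nlinarith [hW η, mul_nonneg_of_nonpos_of_nonpos hop (neg_nonpos.2 hs)]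

theorem Stencil.abs_le_of_implicit_step (S : Stencil N) {φ : ℝ → ℝ} (hφ : Monotone φ)
    {V W : Idx N → ℝ} {s m : ℝ} (hs : 0 ≤ s) (hV : Summable V) (hm : 0 ≤ m)
    (heq : ∀ β, V β = W β + s * S.gridOp (fun η => φ (V η)) β) (hW : ∀ β, |W β| ≤ m)
    (β : Idx N) : |V β| ≤ m := by
  refine abs_le'.2 ⟨S.le_of_implicit_step hφ hs hV hm heq (fun β => (abs_le'.1 (hW β)).1) β, ?_⟩
  -- The lower bound is the upper bound for $-V$, which solves the step with the reflected
  -- nonlinearity $-\varphi(-\cdot)$, again nondecreasing.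
  refine S.le_of_implicit_step (φ := fun t => -φ (-t)) (V := fun β => -V β) (W := fun β => -W β)
    (fun a b hab => neg_le_neg (hφ (neg_le_neg hab))) hs hV.neg hm (fun β => ?_)
    (fun β => (abs_le'.1 (hW β)).2) β
  have : S.gridOp (fun η => -φ (- -V η)) β = -S.gridOp (fun η => φ (V η)) β := by
    unfold Stencil.gridOp
    rw [← tsum_neg]
    refine tsum_congr fun γ => ?_
    simp only [neg_neg]; ring
  rw [this]
  simp only [heq β]
  ring

theorem abs_discreteInitial_le {u₀ : Space N → ℝ} (hu : AdmissibleInitial u₀) {h : ℝ}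
    (hh : 0 < h) (β : Idx N) : |discreteInitial h u₀ β| ≤ (eLpNorm u₀ ⊤ volume).toReal := by
  have hv := volume_gridCell hh β
  have hreal : volume.real (gridCell h β) = h ^ N := by
    rw [Measure.real, hv, ENNReal.toReal_ofReal (by positivity)]
  unfold discreteInitial
  rw [abs_mul, abs_of_pos (by positivity), one_div, inv_mul_le_iff₀ (by positivity), mul_comm,
    ← hreal, ← Real.norm_eq_abs]
  refine norm_setIntegral_le_of_norm_le_const_ae (by rw [hv]; exact ENNReal.ofReal_lt_top) ?_
  refine ae_restrict_of_ae ?_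
  filter_upwards [ae_le_eLpNormEssSup (f := u₀) (μ := volume)] with x hx
  rw [← eLpNorm_exponent_top] at hx
  rw [← toReal_enorm]
  exact ENNReal.toReal_mono hu.memLinfty.2.ne hx

/-- The cell volume cancels the factor $h^{-N}$, leaving the time integral of $\|g(t)\|_\infty$ over
the step. Measurability of $t\mapsto\|g(t)\|_\infty$ is never used: upper integrals and their
monotonicity are enough. -/
theorem abs_step_mul_discreteSource_le {g : ℝ → Space N → ℝ} (hg : AdmissibleSource T g) {h : ℝ}
    (hh : 0 < h) (G : TimeGrid T) {j : ℕ} (hj : j < G.J) (β : Idx N) :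
    |G.step j * discreteSource h G g j β|
      ≤ (∫⁻ t in Ioo (G.node j) (G.node (j + 1)), eLpNorm (g t) ⊤ volume).toReal := by
  have hs := G.step_pos hj
  have hsub : Ioo (G.node j) (G.node (j + 1)) ⊆ Ioo 0 T :=
    Ioo_subset_Ioo (G.node_nonneg hj.le) (G.node_le hj)
  have hfin : ∫⁻ t in Ioo (G.node j) (G.node (j + 1)), eLpNorm (g t) ⊤ volume < ⊤ :=
    (lintegral_mono_set hsub).trans_lt
      ((lintegral_mono fun t => le_add_self).trans_lt hg.bound)
  have e : G.step j * discreteSource h G g j β = (h ^ N)⁻¹ *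
      ∫ p in Ioo (G.node j) (G.node (j + 1)) ×ˢ gridCell h β, g p.1 p.2 := by
    unfold discreteSource; field_simp
  have hmeas : AEMeasurable (fun p : ℝ × Space N => ‖g p.1 p.2‖ₑ)
      ((volume.restrict (Ioo (G.node j) (G.node (j + 1)))).prod
        (volume.restrict (gridCell h β))) := by
    rw [Measure.prod_restrict, ← Measure.volume_eq_prod]
    exact (hg.meas.mono_measure (Measure.restrict_mono (prod_mono hsub (subset_univ _))
      le_rfl)).enorm
  have hle : ‖∫ p in Ioo (G.node j) (G.node (j + 1)) ×ˢ gridCell h β, g p.1 p.2‖ₑ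
      ≤ ENNReal.ofReal (h ^ N)
        * ∫⁻ t in Ioo (G.node j) (G.node (j + 1)), eLpNorm (g t) ⊤ volume := by
    refine (enorm_integral_le_lintegral_enorm _).trans ?_
    rw [Measure.volume_eq_prod, ← Measure.prod_restrict, lintegral_prod _ hmeas,
      ← lintegral_const_mul' _ _ ENNReal.ofReal_ne_top]
    refine lintegral_mono fun t => ?_
    rw [← volume_gridCell hh β, mul_comm, ← setLIntegral_const]
    refine lintegral_mono_ae (ae_restrict_of_ae ?_)
    rw [eLpNorm_exponent_top]
    exact ae_le_eLpNormEssSup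
  have hR : |∫ p in Ioo (G.node j) (G.node (j + 1)) ×ˢ gridCell h β, g p.1 p.2|
      ≤ h ^ N * (∫⁻ t in Ioo (G.node j) (G.node (j + 1)), eLpNorm (g t) ⊤ volume).toReal := by
    have := ENNReal.toReal_mono (ENNReal.mul_lt_top ENNReal.ofReal_lt_top hfin).ne hle
    rwa [ENNReal.toReal_mul, ENNReal.toReal_ofReal (by positivity), toReal_enorm,
      Real.norm_eq_abs] at this
  rw [e, abs_mul, abs_of_pos (by positivity), inv_mul_le_iff₀ (by positivity)]
  exact hR

theorem sum_lintegral_nodes_le (G : TimeGrid T) (f : ℝ → ENNReal) {j : ℕ} (hj : j ≤ G.J) :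
    ∑ k ∈ Finset.range j, ∫⁻ t in Ioo (G.node k) (G.node (k + 1)), f t
      ≤ ∫⁻ t in Ioo 0 (G.node j), f t := by
  induction j with
  | zero => simp
  | succ k ih =>
    rw [Finset.sum_range_succ]
    refine (add_le_add_left (ih (by omega)) _).trans ?_
    rw [← lintegral_union measurableSet_Ioo]
    · refine lintegral_mono_set (union_subset ?_ ?_)
      · exact Ioo_subset_Ioo le_rfl (G.node_lt k (by omega)).le
      · exact Ioo_subset_Ioo (G.node_nonneg (by omega)) le_rfl
    · exact Set.disjoint_left.2 fun t h1 h2 => absurd h1.2 (not_lt.2 h2.1.le)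

/-- Iterating the maximum principle adds up to $\|u_0\|_\infty+\int_0^T\|g(t)\|_\infty\,dt$, a bound
independent of $h$, of the stencil and of the time grid. -/
theorem exists_scheme_bound {φ : ℝ → ℝ} (hφ : Monotone φ) {u₀ : Space N → ℝ}
    (hu : AdmissibleInitial u₀) {g : ℝ → Space N → ℝ} (hg : AdmissibleSource T g) :
    ∃ M, 0 ≤ M ∧ ∀ (h : ℝ) (S : Stencil N) (G : TimeGrid T) (U : ℕ → Idx N → ℝ), 0 < h →
      IsSchemeSolution h S G φ u₀ g U → ∀ j ≤ G.J, ∀ β, |U j β| ≤ M := by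
  set m := (eLpNorm u₀ ⊤ volume).toReal with hm
  have hfin : ∫⁻ t in Ioo 0 T, eLpNorm (g t) ⊤ volume < ⊤ :=
    (lintegral_mono fun t => le_add_self).trans_lt hg.bound
  refine ⟨m + (∫⁻ t in Ioo 0 T, eLpNorm (g t) ⊤ volume).toReal, by positivity,
    fun h S G U hh hU j hj β => ?_⟩
  have hterm : ∀ k < G.J, ∫⁻ t in Ioo (G.node k) (G.node (k + 1)), eLpNorm (g t) ⊤ volume ≠ ⊤ :=
    fun k hk => ((lintegral_mono_set (Ioo_subset_Ioo (G.node_nonneg hk.le)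
      (G.node_le hk))).trans_lt hfin).ne
  have key : ∀ j ≤ G.J, ∀ β, |U j β| ≤ m + ∑ k ∈ Finset.range j,
      (∫⁻ t in Ioo (G.node k) (G.node (k + 1)), eLpNorm (g t) ⊤ volume).toReal := by
    intro j
    induction j with
    | zero =>
      intro _ β
      rw [hU.init]
      simpa [hm] using abs_discreteInitial_le hu hh β
    | succ k ih =>
      intro hk β
      refine S.abs_le_of_implicit_step hφ (G.step_pos hk).le (hU.summable _ hk)
        (add_nonneg ENNReal.toReal_nonneg (Finset.sum_nonneg fun _ _ => ENNReal.toReal_nonneg))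
        (W := fun β => U k β + G.step k * discreteSource h G g k β) (fun β => ?_) (fun β => ?_) β
      · rw [hU.scheme k hk β]; ring
      · rw [Finset.sum_range_succ, ← add_assoc]
        exact (abs_add_le _ _).trans (add_le_add (ih (by omega) β)
          (abs_step_mul_discreteSource_le hg hh G hk β))
  refine (key j hj β).trans (add_le_add_right ?_ _)
  rw [← ENNReal.toReal_sum fun k hk => hterm k ((Finset.mem_range.1 hk).trans_le hj)]
  refine ENNReal.toReal_mono hfin.ne ((sum_lintegral_nodes_le G _ hj).trans ?_)
  exact lintegral_mono_set (Ioo_subset_Ioo le_rfl (G.node_le hj))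

end Comparison

end GPME

namespace GPME

/-! ### Continuity of translations, tails, absolute continuity -/

section Integrals

/-- Density of continuous compactly supported functions, for which dominated convergence applies.
The generality covers initial data on $\mathbb R^N$ and sources on space-time. -/
theorem tendsto_integral_translate_sub {E : Type*} [NormedAddCommGroup E] [NormedSpace ℝ E]
    [FiniteDimensional ℝ E] [MeasurableSpace E] [BorelSpace E] {μ : Measure E}
    [μ.IsAddHaarMeasure] {f : E → ℝ} (hf : Integrable f μ) :
    Tendsto (fun ξ => ∫ x, |f (x + ξ) - f x| ∂μ) (𝓝 0) (𝓝 0) := by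
  have : ProperSpace E := FiniteDimensional.proper ℝ E
  refine Metric.tendsto_nhds.2 fun ε hε => ?_
  obtain ⟨k, hkc, hfk, hkcont, hkint⟩ :=
    hf.exists_hasCompactSupport_integral_sub_le (show 0 < ε / 4 by positivity)
  have hk : Tendsto (fun ξ => ∫ x, |k (x + ξ) - k x| ∂μ) (𝓝 0) (𝓝 0) := by
    obtain ⟨ρ, hρ⟩ := hkc.isBounded.exists_norm_le
    obtain ⟨B, hB⟩ := hkcont.bounded_above_of_compact_support hkc
    have hlim := tendsto_integral_filter_of_dominated_convergence (μ := μ) (l := 𝓝 (0 : E))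
      (F := fun ξ x => |k (x + ξ) - k x|) (f := fun _ => (0 : ℝ))
      ((Metric.closedBall (0 : E) (ρ + 1)).indicator fun _ => B + B) ?_ ?_ ?_ ?_
    · simpa using hlim
    · exact Eventually.of_forall fun ξ => by fun_prop
    · filter_upwards [Metric.ball_mem_nhds (0 : E) one_pos] with ξ hξ
      refine ae_of_all _ fun x => ?_
      rw [mem_ball_zero_iff] at hξ
      rw [Real.norm_eq_abs, abs_abs]
      by_cases hx : x ∈ Metric.closedBall (0 : E) (ρ + 1)
      · rw [indicator_of_mem hx]
        exact (abs_sub _ _).trans (add_le_add (hB _) (hB _))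
      · rw [indicator_of_notMem hx]
        rw [mem_closedBall_zero_iff, not_le] at hx
        have z : ∀ y : E, ρ < ‖y‖ → k y = 0 := fun y hy => by
          by_contra hne
          exact absurd (hρ y (subset_closure hne)) (not_le.2 hy)
        have h1 : ‖x‖ ≤ ‖x + ξ‖ + ‖ξ‖ := by
          simpa using norm_sub_le (x + ξ) ξ
        rw [z x (by linarith), z (x + ξ) (by linarith)]; simp
    · exact (integrable_indicator_iff measurableSet_closedBall).2
        (integrableOn_const measure_closedBall_lt_top.ne)
    · refine ae_of_all _ fun x => ?_
      have : Tendsto (fun ξ => |k (x + ξ) - k x|) (𝓝 0) (𝓝 |k (x + 0) - k x|) :=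
        (Continuous.tendsto (by fun_prop) 0)
      simpa using this
  filter_upwards [hk.eventually_lt_const (show 0 < ε / 4 by positivity)] with ξ hξ
  rw [Real.dist_0_eq_abs, abs_of_nonneg (integral_nonneg fun x => abs_nonneg _)]
  have i1 : Integrable (fun x => |f x - k x|) μ := (hf.sub hkint).abs
  have i2 : Integrable (fun x => |f (x + ξ) - k (x + ξ)|) μ := i1.comp_add_right ξ
  have i3 : Integrable (fun x => |k (x + ξ) - k x|) μ :=
    ((hkint.comp_add_right ξ).sub hkint).abs
  have e : ∫ x, |f (x + ξ) - k (x + ξ)| ∂μ = ∫ x, |f x - k x| ∂μ :=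
    integral_add_right_eq_self (fun x => |f x - k x|) ξ
  have h3 := integral_abs_le_add₃ (f := fun x => f (x + ξ) - f x) i2 i3 i1 fun x => by
    have : f (x + ξ) - f x = (f (x + ξ) - k (x + ξ)) + (k (x + ξ) - k x) - (f x - k x) := by ring
    rw [this]
    exact (abs_sub _ _).trans (add_le_add_left (abs_add_le _ _) _)
  rw [e] at h3
  simp only [Real.norm_eq_abs] at hfk
  linarith

/-- The function $n$ is left free so that tails in $|x|$ can also be taken for functions on
space-time. -/
theorem tendsto_setIntegral_tail {α : Type*} [MeasurableSpace α] {μ : Measure α} {f n : α → ℝ}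
    (hf : Integrable f μ) (hn : Measurable n) :
    Tendsto (fun R : ℝ => ∫ x in {x | R < n x}, |f x| ∂μ) atTop (𝓝 0) := by
  have hlim := tendsto_integral_filter_of_dominated_convergence (μ := μ) (l := atTop)
    (F := fun (R : ℝ) x => {x | R < n x}.indicator (fun x => |f x|) x) (f := fun _ => (0 : ℝ))
    (fun x => |f x|) ?_ ?_ hf.abs ?_
  · simp only [integral_zero] at hlim
    refine hlim.congr fun R => ?_
    rw [integral_indicator (measurableSet_lt measurable_const hn)]
  · exact Eventually.of_forall fun R =>
      hf.abs.1.indicator (measurableSet_lt measurable_const hn)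
  · refine Eventually.of_forall fun R => ae_of_all _ fun x => ?_
    exact (norm_indicator_le_norm_self _ _).trans (by simp)
  · refine ae_of_all _ fun x => tendsto_const_nhds.congr' ?_
    filter_upwards [eventually_ge_atTop (n x)] with R hR
    rw [indicator_of_notMem]
    simpa using hR

variable {N : ℕ} {T : ℝ}

/-- Short time slabs still have infinite measure in space-time, so absolute continuity of the
integral is applied to the time marginal $t\mapsto\|g(t,\cdot)\|_{L^1}$. -/
theorem exists_setIntegral_cylinder_le {g : ℝ × Space N → ℝ}
    (hg : IntegrableOn g (cylinder N T)) {ε : ℝ} (hε : 0 < ε) :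
    ∃ η > 0, ∀ a b : ℝ, b - a ≤ η →
      ∫ p in cylinder N T ∩ (Ioo a b ×ˢ univ), |g p| ≤ ε := by
  have hg2 : ∫⁻ t in Ioo 0 T, ∫⁻ x, ‖g (t, x)‖ₑ ≠ ⊤ := by
    have h1 := hg.2
    have h2 := hg.1.enorm
    unfold HasFiniteIntegral at h1
    rw [cylinder, restrict_prod_univ] at h1 h2
    rw [lintegral_prod _ h2] at h1
    exact h1.ne
  obtain ⟨δ, hδ, hδ'⟩ := exists_pos_setLIntegral_lt_of_measure_lt hg2
    (ε := ENNReal.ofReal ε) (by simpa using hε)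
  obtain ⟨η, hη, hηδ⟩ : ∃ η > 0, ENNReal.ofReal η < δ := by
    obtain ⟨η, h1, h2⟩ := ENNReal.lt_iff_exists_nnreal_btwn.1 hδ
    exact ⟨η, by exact_mod_cast h1, by simpa using h2⟩
  refine ⟨η, hη, fun a b hab => ?_⟩
  have hsub : IntegrableOn g (cylinder N T ∩ (Ioo a b ×ˢ univ)) := hg.mono_set inter_subset_left
  have e : cylinder N T ∩ (Ioo a b ×ˢ (univ : Set (Space N)))
      = (Ioo 0 T ∩ Ioo a b) ×ˢ univ := by
    rw [cylinder, prod_inter_prod, inter_univ]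
  have key : ∫⁻ p in cylinder N T ∩ (Ioo a b ×ˢ univ), ‖g p‖ₑ ≤ ENNReal.ofReal ε := by
    have hm := hsub.1.enorm
    rw [e, restrict_prod_univ] at hm ⊢
    rw [lintegral_prod _ hm, inter_comm, ← Measure.restrict_restrict measurableSet_Ioo]
    refine (hδ' _ ?_).le
    refine ((Measure.restrict_apply_le _ _).trans ?_).trans_lt hηδ
    rw [Real.volume_Ioo]
    exact ENNReal.ofReal_le_ofReal hab
  rw [← ofReal_integral_norm_eq_lintegral_enorm hsub] at key
  exact (ENNReal.ofReal_le_ofReal_iff hε.le).1 key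

/-- `L¹` norms are controlled by tails, translations and mollified values. -/
theorem integral_abs_le_of_mollified {ρ f : Space N → ℝ} {δ R ε κ : ℝ} (hρc : Continuous ρ)
    (hρi : Integrable ρ) (hρ0 : ∀ x, 0 ≤ ρ x) (hρ1 : ∫ x, ρ x = 1)
    (hρs : ∀ x, δ < ‖x‖ → ρ x = 0)
    (hf : Integrable f) (hfm : Measurable f)
    (htr : ∀ ξ, ‖ξ‖ ≤ δ → ∫ x, |f (x + ξ) - f x| ≤ ε)
    (htail : ∫ x in {x | R < ‖x‖}, |f x| ≤ ε)
    (hmol : ∀ x, ‖x‖ ≤ R → |∫ y, f y * ρ (y - x)| ≤ κ) :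
    ∫ x, |f x| ≤ 2 * ε + κ * volume.real (Metric.closedBall (0 : Space N) R) := by
  have hms : MeasurableSet {x : Space N | R < ‖x‖} :=
    measurableSet_lt measurable_const measurable_norm
  obtain ⟨B, hB⟩ := hρc.bounded_above_of_compact_support
    (HasCompactSupport.of_support_subset_isCompact (isCompact_closedBall (0 : Space N) δ)
      fun y hy => by
        rw [mem_closedBall_zero_iff]
        by_contra hc
        exact hy (hρs y (not_le.1 hc)))
  have hfix : ∀ ξ, Integrable fun x => (f (x + ξ) - f x) * ρ ξ := fun ξ =>
    ((hf.comp_add_right ξ).sub hf).mul_const _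
  have hprod : Integrable (fun p : Space N × Space N => (f (p.1 + p.2) - f p.1) * ρ p.2)
      (volume.prod volume) := by
    have hm : AEStronglyMeasurable (fun p : Space N × Space N => (f (p.1 + p.2) - f p.1) * ρ p.2)
        (volume.prod volume) := by
      have := hρc.measurable
      exact Measurable.aestronglyMeasurable (by fun_prop)
    refine (integrable_prod_iff' hm).2 ⟨ae_of_all _ hfix, ?_⟩
    refine Integrable.mono' (g := fun ξ => 2 * (∫ x, |f x|) * ρ ξ) (hρi.const_mul _)
      hm.norm.prod_swap.integral_prod_right' (ae_of_all _ fun ξ => ?_)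
    rw [Real.norm_eq_abs, abs_of_nonneg (integral_nonneg fun _ => norm_nonneg _)]
    simp_rw [norm_mul, Real.norm_eq_abs, abs_of_nonneg (hρ0 ξ)]
    rw [integral_mul_const]
    refine mul_le_mul_of_nonneg_right ?_ (hρ0 ξ)
    have e1 : ∫ x, |f (x + ξ)| = ∫ x, |f x| := integral_add_right_eq_self (fun x => |f x|) ξ
    have := integral_abs_le_add (f := fun x => f (x + ξ) - f x)
      (hf.comp_add_right ξ).abs hf.abs (fun x => abs_sub _ _)
    linarith
  -- The distance between $f$ and its mollification is an average of translation errors with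
  -- probability density $\rho$, by Fubini.
  have hmolint : ∫ x, |∫ ξ, (f (x + ξ) - f x) * ρ ξ| ≤ ε := by
    calc _ ≤ ∫ x, ∫ ξ, |f (x + ξ) - f x| * ρ ξ := by
          refine integral_mono hprod.integral_prod_left.abs ?_ fun x => ?_
          · have := hprod.abs.integral_prod_left
            simpa only [abs_mul, abs_of_nonneg (hρ0 _)] using this
          · refine (abs_integral_le_integral_abs).trans (le_of_eq ?_)
            simp only [abs_mul, abs_of_nonneg (hρ0 _)]
      _ = ∫ ξ, ∫ x, |f (x + ξ) - f x| * ρ ξ := by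
          refine integral_integral_swap ?_
          change Integrable (fun p : Space N × Space N => |f (p.1 + p.2) - f p.1| * ρ p.2) _
          have := hprod.abs
          simpa only [abs_mul, abs_of_nonneg (hρ0 _)] using this
      _ ≤ ∫ ξ, ε * ρ ξ := by
          refine integral_mono_of_nonneg (ae_of_all _ fun ξ => integral_nonneg fun x =>
            mul_nonneg (abs_nonneg _) (hρ0 ξ)) (hρi.const_mul _) (ae_of_all _ fun ξ => ?_)
          simp only
          rw [integral_mul_const]
          rcases le_or_gt ‖ξ‖ δ with h | h
          · exact mul_le_mul_of_nonneg_right (htr ξ h) (hρ0 ξ)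
          · simp [hρs ξ h]
      _ = ε := by rw [integral_const_mul, hρ1, mul_one]
  -- Inside the ball, $|f|$ is at most the mollification error plus the mollified value; outside,
  -- the tail hypothesis is used. This gives the two $\varepsilon$ and the term $\kappa|B_R|$.
  have hsplit : ∀ x, ‖x‖ ≤ R → |f x| ≤ |∫ ξ, (f (x + ξ) - f x) * ρ ξ| + κ := by
    intro x hx
    have hκ : Integrable fun ξ => f (x + ξ) * ρ ξ :=
      (hf.comp_add_left x).mul_bdd (c := B) hρc.aestronglyMeasurable (ae_of_all _ hB)
    have e : ∫ ξ, (f (x + ξ) - f x) * ρ ξ = (∫ y, f y * ρ (y - x)) - f x := by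
      simp_rw [sub_mul]
      rw [integral_sub hκ (hρi.const_mul _), integral_const_mul, hρ1, mul_one,
        ← integral_add_left_eq_self (fun y => f y * ρ (y - x)) x]
      simp
    have := hmol x hx
    rw [e]
    have h3 := abs_sub_abs_le_abs_sub (f x) (∫ y, f y * ρ (y - x))
    rw [abs_sub_comm] at h3
    linarith
  have hind : Integrable ((Metric.closedBall (0 : Space N) R).indicator fun _ => κ) :=
    (integrable_indicator_iff measurableSet_closedBall).2
      (integrableOn_const measure_closedBall_lt_top.ne)
  have h3 := integral_abs_le_add₃ (f := f) (hf.abs.indicator hms) hprod.integral_prod_left.abs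
    hind fun x => by
      by_cases hx : R < ‖x‖
      · rw [indicator_of_mem (show x ∈ {x | R < ‖x‖} from hx), indicator_of_notMem (by
          rw [mem_closedBall_zero_iff, not_le]; exact hx)]
        linarith [abs_nonneg (∫ ξ, (f (x + ξ) - f x) * ρ ξ)]
      · rw [indicator_of_notMem (show x ∉ {x | R < ‖x‖} from hx), indicator_of_mem (by
          rw [mem_closedBall_zero_iff]; exact not_lt.1 hx), zero_add]
        exact hsplit x (not_lt.1 hx)
  rw [integral_indicator hms, integral_indicator measurableSet_closedBall, setIntegral_const,
    smul_eq_mul] at h3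
  linarith

/-- A smooth mollifier supported in the ball of radius `δ`. -/
theorem exists_mollifier (N : ℕ) {δ : ℝ} (hδ : 0 < δ) : ∃ ρ : Space N → ℝ,
    ContDiff ℝ ∞ ρ ∧ HasCompactSupport ρ ∧ (∀ x, 0 ≤ ρ x) ∧ ∫ x, ρ x = 1 ∧
      ∀ x, δ < ‖x‖ → ρ x = 0 := by
  let b : ContDiffBump (0 : Space N) := ⟨δ / 2, δ, by positivity, by linarith⟩
  refine ⟨b.normed volume, b.contDiff_normed, b.hasCompactSupport_normed,
    b.nonneg_normed, b.integral_normed, fun x hx => ?_⟩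
  by_contra hne
  have : x ∈ Function.support (b.normed volume) := hne
  rw [b.support_normed_eq, mem_ball_zero_iff] at this
  exact absurd (this : ‖x‖ < δ) (not_lt.2 hx.le)

end Integrals

end GPME

/-! ### Uniform $L^1$ bounds, spatial equicontinuity and tightness of the discrete solutions -/

namespace GPME

variable {N : ℕ} {T : ℝ}

/-- The family of schemes together with the properties used in the compactness argument. -/
structure SchemeData (γ : ℝ) (φ : ℝ → ℝ) (u₀ : Space N → ℝ) (g : ℝ → Space N → ℝ)
    (S : ℝ → Stencil N) (G : ℝ → TimeGrid T) (U : ℝ → ℕ → Idx N → ℝ) : Prop where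
  pos_time : 0 < T
  pos_exp : 0 < γ
  exp_le : γ ≤ 1
  mono : Monotone φ
  holder : ∀ M, ∃ C, 0 ≤ C ∧ ∀ a b, |a| ≤ M → |b| ≤ M → |φ a - φ b| ≤ C * |a - b| ^ γ
  int_initial : Integrable u₀
  int_source : IntegrableOn (fun p : ℝ × Space N => g p.1 p.2) (cylinder N T)
  mesh : Tendsto (fun h => (G h).mesh) (𝓝[>] 0) (𝓝 0)
  sol : ∀ h > 0, IsSchemeSolution h (S h) (G h) φ u₀ g (U h)
  bdd : ∃ M, 0 ≤ M ∧ ∀ h > 0, ∀ j ≤ (G h).J, ∀ β, |U h j β| ≤ M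
  decay : ∃ θ C : ℝ, N * (1 - γ) < θ ∧ 0 ≤ C ∧
      ∀ h ∈ Ioo (0 : ℝ) 1, ∀ R > 1, (S h).trunc h R ≤ C * R ^ (-θ)

theorem eventually_mem_Ioo_one : ∀ᶠ h : ℝ in 𝓝[>] 0, h ∈ Ioo (0 : ℝ) 1 :=
  Ioo_mem_nhdsGT one_pos

/-- Makes continuity of translations in $L^1$ available on space-time. -/
instance : (volume : Measure (ℝ × Space N)).IsAddHaarMeasure :=
  inferInstanceAs ((volume : Measure ℝ).prod (volume : Measure (Space N))).IsAddHaarMeasure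

theorem slab_translate (ξ : Space N) (G : TimeGrid T) (j : ℕ) :
    (fun p : ℝ × Space N => p + (0, ξ)) ⁻¹' G.slab N j = G.slab N j := by
  ext p; simp [TimeGrid.slab]

theorem cylinder_translate (ξ : Space N) :
    (fun p : ℝ × Space N => p + (0, ξ)) ⁻¹' cylinder N T = cylinder N T := by
  ext p; simp [cylinder]

theorem measurableSet_cylinder : MeasurableSet (cylinder N T) :=
  measurableSet_Ioo.prod MeasurableSet.univ

theorem setIntegral_slab_translate (G : TimeGrid T) (j : ℕ) (ξ : Space N)
    (f : ℝ × Space N → ℝ) :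
    ∫ p in G.slab N j, f (p.1, p.2 + ξ) = ∫ p in G.slab N j, f p := by
  have := (measurePreserving_add_right (volume : Measure (ℝ × Space N))
    ((0, ξ) : ℝ × Space N)).setIntegral_preimage_emb (measurableEmbedding_addRight _) f
    (G.slab N j)
  rw [slab_translate] at this
  rw [← this]
  congr 1; ext p
  rw [Prod.add_def, add_zero]

theorem integrableOn_slab_translate (G : TimeGrid T) (j : ℕ) (ξ : Space N)
    {f : ℝ × Space N → ℝ} (hf : IntegrableOn f (G.slab N j)) :
    IntegrableOn (fun p : ℝ × Space N => f (p.1, p.2 + ξ)) (G.slab N j) := by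
  have := ((measurePreserving_add_right (volume : Measure (ℝ × Space N))
    ((0, ξ) : ℝ × Space N)).integrableOn_comp_preimage (measurableEmbedding_addRight _)).2 hf
  rw [slab_translate] at this
  refine this.congr_fun (fun p _ => ?_) (G.measurableSet_slab N j)
  simp [Prod.add_def]

/-- Translations of the source in `L¹(Q_T)`. -/
theorem exists_translate_cylinder_le {g : ℝ × Space N → ℝ} (hg : IntegrableOn g (cylinder N T))
    {ε : ℝ} (hε : 0 < ε) : ∃ δ > 0, ∀ ξ : Space N, ‖ξ‖ ≤ δ →
      ∫ p in cylinder N T, |g (p.1, p.2 + ξ) - g p| ≤ ε := by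
  -- The source is extended by zero. Since $\xi$ acts in space only, the cylinder is invariant and
  -- the extension creates no boundary error.
  have h1 := tendsto_integral_translate_sub
    ((integrable_indicator_iff measurableSet_cylinder).2 hg)
  obtain ⟨δ, hδ, hb⟩ := Metric.eventually_nhds_iff_ball.1 (h1.eventually_lt_const hε)
  refine ⟨δ / 2, by positivity, fun ξ hξ => ?_⟩
  have h2 := hb (0, ξ) (by
    rw [mem_ball_zero_iff, Prod.norm_def]
    simp only [norm_zero]
    rw [max_lt_iff]
    exact ⟨hδ, by linarith⟩)
  refine le_trans (le_of_eq ?_) h2.le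
  rw [← integral_indicator measurableSet_cylinder]
  congr 1; ext p
  have hiff : p + (0, ξ) ∈ cylinder N T ↔ p ∈ cylinder N T := by
    rw [← mem_preimage (f := fun p : ℝ × Space N => p + (0, ξ)), cylinder_translate]
  by_cases hp : p ∈ cylinder N T
  · rw [indicator_of_mem hp, indicator_of_mem hp, indicator_of_mem (hiff.2 hp), Prod.add_def,
      add_zero]
  · rw [indicator_of_notMem hp, indicator_of_notMem hp,
      indicator_of_notMem (fun h => hp (hiff.1 h))]
    simp

namespace SchemeData

variable {γ : ℝ} {φ : ℝ → ℝ} {u₀ : Space N → ℝ} {g : ℝ → Space N → ℝ}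
  {S : ℝ → Stencil N} {G : ℝ → TimeGrid T} {U : ℝ → ℕ → Idx N → ℝ}

section Basic

variable (D : SchemeData γ φ u₀ g S G U)
include D

theorem integrable {h : ℝ} (hh : 0 < h) {j : ℕ} (hj : j ≤ (G h).J) :
    Integrable (spaceInterp h (U h j)) :=
  integrable_spaceInterp hh ((D.sol h hh).summable j hj)

theorem integrable_source {h : ℝ} (hh : 0 < h) {j : ℕ} (hj : j < (G h).J) :
    Integrable (sourceInterp h (G h) g j) :=
  integrable_sourceInterp hh _ hj (D.int_source.mono_set ((G h).slab_subset N hj))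

/-- All jumps lie on the grid, so the piecewise constant interpolants satisfy the scheme at every
point of $\mathbb R^N$. -/
theorem step_eq {h : ℝ} (hh : 0 < h) {j : ℕ} (hj : j < (G h).J) (x : Space N) :
    spaceInterp h (U h (j + 1)) x = spaceInterp h (U h j) x
      + (G h).step j * sourceInterp h (G h) g j x
      + (G h).step j * (S h).op h (fun y => φ (spaceInterp h (U h (j + 1)) y)) x := by
  have e : (S h).op h (fun y => φ (spaceInterp h (U h (j + 1)) y)) x
      = (S h).gridOp (fun η => φ (U h (j + 1) η)) (cellIndex h x) :=
    (S h).op_spaceInterp hh (fun η => φ (U h (j + 1) η)) x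
  rw [e]
  simp only [spaceInterp, sourceInterp]
  rw [(D.sol h hh).scheme j hj]
  ring

theorem abs_phi_le {M a : ℝ} (ha : |a| ≤ M) : |φ a| ≤ |φ M| + |φ (-M)| := by
  have h1 := D.mono (abs_le.1 ha).1
  have h2 := D.mono (abs_le.1 ha).2
  rw [abs_le]
  constructor
  · linarith [neg_abs_le (φ (-M)), abs_nonneg (φ M)]
  · linarith [le_abs_self (φ M), abs_nonneg (φ (-M))]

theorem phi_sign (a b : ℝ) : 0 ≤ (a - b) * (φ a - φ b) := by
  rcases le_total a b with h | h
  · exact mul_nonneg_of_nonpos_of_nonpos (by linarith) (by linarith [D.mono h])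
  · exact mul_nonneg (by linarith) (by linarith [D.mono h])

/-- Comparison with the zero solution; subtracting $\varphi(0)$ is harmless because the operator
annihilates constants. -/
theorem exists_diff_zero : ∃ C, 0 ≤ C ∧ ∀ h > 0, IsSchemeDiff (S h) h (G h) γ C
    (fun j => spaceInterp h (U h j)) (fun j => sourceInterp h (G h) g j)
    (fun j x => φ (spaceInterp h (U h j) x) - φ 0) := by
  obtain ⟨M, hM, hU⟩ := D.bdd
  obtain ⟨C, hC, hφ⟩ := D.holder M
  refine ⟨C, hC, fun h hh => ⟨fun j hj x => ?_, fun j hj => D.integrable hh hj,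
    fun j hj => D.integrable_source hh hj, fun j hj => ?_, fun j hj x => ?_, fun j hj x => ?_,
    ⟨|φ M| + |φ (-M)| + |φ 0|, fun j hj x => ?_⟩⟩⟩
  · rw [(S h).op_sub_const h (fun y => φ (spaceInterp h (U h (j + 1)) y))]
    exact D.step_eq hh hj x
  · exact (D.mono.measurable.comp (measurable_spaceInterp _ _)).sub_const _
  · simpa using hφ (spaceInterp h (U h j) x) 0 (hU h hh j hj _) (by simpa using hM)
  · simpa using D.phi_sign (spaceInterp h (U h j) x) 0
  · exact (abs_sub _ _).trans (add_le_add_left (D.abs_phi_le (hU h hh j hj _)) _)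

/-- Comparison with a translate. Once the scheme is read on $\mathbb R^N$, the operator commutes
with every translation, not only with those of the grid. -/
theorem exists_diff_translate : ∃ C, 0 ≤ C ∧ ∀ h > 0, ∀ ξ : Space N,
    IsSchemeDiff (S h) h (G h) γ C
    (fun j x => spaceInterp h (U h j) (x + ξ) - spaceInterp h (U h j) x)
    (fun j x => sourceInterp h (G h) g j (x + ξ) - sourceInterp h (G h) g j x)
    (fun j x => φ (spaceInterp h (U h j) (x + ξ)) - φ (spaceInterp h (U h j) x)) := by
  obtain ⟨M, hM, hU⟩ := D.bdd
  obtain ⟨C, hC, hφ⟩ := D.holder M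
  refine ⟨C, hC, fun h hh ξ => ⟨fun j hj x => ?_, fun j hj => ?_,
    fun j hj => ?_, fun j hj => ?_, fun j hj x => ?_, fun j hj x => ?_,
    ⟨|φ M| + |φ (-M)| + (|φ M| + |φ (-M)|), fun j hj x => ?_⟩⟩⟩
  · have hb : ∀ y, |φ (spaceInterp h (U h (j + 1)) y)| ≤ |φ M| + |φ (-M)| := fun y =>
      D.abs_phi_le (hU h hh _ hj _)
    rw [(S h).op_sub h (p := fun y => φ (spaceInterp h (U h (j + 1)) (y + ξ)))
      (q := fun y => φ (spaceInterp h (U h (j + 1)) y)) (fun y => hb (y + ξ)) hb,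
      (S h).op_comp_add_right h (fun y => φ (spaceInterp h (U h (j + 1)) y)) ξ x,
      D.step_eq hh hj x, D.step_eq hh hj (x + ξ)]
    ring
  · exact ((D.integrable hh hj).comp_add_right ξ).sub (D.integrable hh hj)
  · exact ((D.integrable_source hh hj).comp_add_right ξ).sub (D.integrable_source hh hj)
  · have h1 : Measurable fun x => φ (spaceInterp h (U h j) x) :=
      D.mono.measurable.comp (measurable_spaceInterp _ _)
    exact (h1.comp (measurable_id.add_const ξ)).sub h1
  · exact hφ _ _ (hU h hh j hj _) (hU h hh j hj _)
  · exact D.phi_sign _ _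
  · exact (abs_sub _ _).trans (add_le_add (D.abs_phi_le (hU h hh j hj _))
      (D.abs_phi_le (hU h hh j hj _)))

theorem init_eq {h : ℝ} (hh : 0 < h) :
    spaceInterp h (U h 0) = spaceInterp h (discreteInitial h u₀) := by
  funext x
  exact (D.sol h hh).init _

/-- The error of the discretization of the data in `L¹`. -/
theorem eventually_data_le {ε : ℝ} (hε : 0 < ε) : ∀ᶠ h in 𝓝[>] 0,
    h ∈ Ioo (0 : ℝ) 1 ∧ (∫ x, |spaceInterp h (U h 0) x - u₀ x|) ≤ ε ∧
    (∑ j ∈ Finset.range (G h).J, ∫ p in (G h).slab N j,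
      |sourceInterp h (G h) g j p.2 - g p.1 p.2|) ≤ ε := by
  filter_upwards [eventually_mem_Ioo_one,
    (tendsto_initialInterp D.int_initial D.pos_time D.mesh).eventually_lt_const hε,
    (tendsto_sourceInterp D.int_source D.pos_time D.mesh).eventually_lt_const hε]
    with h h1 h2 h3
  rw [D.init_eq h1.1]
  exact ⟨h1, h2.le, h3.le⟩

theorem sum_source_le {h : ℝ} (hh : 0 < h) {i j : ℕ} (hj : j ≤ (G h).J) :
    ∑ k ∈ Finset.Ico i j, (G h).step k * ∫ x, |sourceInterp h (G h) g k x|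
      ≤ ∫ p in cylinder N T ∩ (Ioo ((G h).node i) ((G h).node j) ×ˢ univ), |g p.1 p.2| := by
  refine le_trans (Finset.sum_le_sum fun k hk => ?_)
    ((G h).sum_Ico_setIntegral_slab_le N D.int_source.abs (fun p => abs_nonneg _) hj)
  have hk' := (Finset.mem_Ico.1 hk).2.trans_le hj
  exact integral_sourceInterp_le hh _ hk' (D.int_source.mono_set ((G h).slab_subset N hk'))

/-- The contraction applied against zero. The extra $1$ absorbs the discretization error of $u_0$
for small $h$. -/
theorem exists_L1_bound : ∃ L, 0 ≤ L ∧ ∀ᶠ h in 𝓝[>] 0, ∀ j ≤ (G h).J,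
    ∫ x, |spaceInterp h (U h j) x| ≤ L := by
  obtain ⟨C, hC, hd⟩ := D.exists_diff_zero
  obtain ⟨θ, C₀, hθ, hC₀, hS⟩ := D.decay
  have p1 : 0 ≤ ∫ x, |u₀ x| := integral_nonneg fun _ => abs_nonneg _
  have p2 : 0 ≤ ∫ p in cylinder N T, |g p.1 p.2| := integral_nonneg fun _ => abs_nonneg _
  refine ⟨(∫ x, |u₀ x|) + 1 + ∫ p in cylinder N T, |g p.1 p.2|, by positivity, ?_⟩
  filter_upwards [D.eventually_data_le one_pos] with h ⟨hh, h0, _⟩ j hj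
  refine ((hd h hh.1).contraction D.pos_exp D.exp_le hC hC₀ hθ (hS h hh) hj).trans ?_
  refine add_le_add ?_ ?_
  · have := integral_abs_le_add (f := spaceInterp h (U h 0)) D.int_initial.abs
      ((D.integrable hh.1 (Nat.zero_le _)).sub D.int_initial).abs (fun x => by
        simpa using abs_add_le (u₀ x) (spaceInterp h (U h 0) x - u₀ x))
    refine this.trans (add_le_add_right h0 _)
  · rw [Finset.range_eq_Ico]
    refine (D.sum_source_le hh.1 hj).trans ?_
    exact setIntegral_mono_set D.int_source.abs (ae_of_all _ fun _ => abs_nonneg _)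
      (Eventually.of_forall inter_subset_left)

/-- The contraction reduces translation errors at all nodes to those of the data. Initial datum and
source get $\varepsilon/2$ each, made of three parts $\varepsilon/6$: one translation error of the
exact datum and two discretization errors. -/
theorem exists_translate_le {ε : ℝ} (hε : 0 < ε) : ∃ δ > 0, ∀ᶠ h in 𝓝[>] 0,
    ∀ ξ : Space N, ‖ξ‖ ≤ δ → ∀ j ≤ (G h).J,
      ∫ x, |spaceInterp h (U h j) (x + ξ) - spaceInterp h (U h j) x| ≤ ε := by
  obtain ⟨C, hC, hd⟩ := D.exists_diff_translate
  obtain ⟨θ, C₀, hθ, hC₀, hS⟩ := D.decay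
  obtain ⟨δ₁, hδ₁, hg⟩ := exists_translate_cylinder_le D.int_source
    (show 0 < ε / 6 by positivity)
  obtain ⟨δ₂, hδ₂, hu⟩ := Metric.eventually_nhds_iff_ball.1
    ((tendsto_integral_translate_sub D.int_initial).eventually_lt_const
      (show 0 < ε / 6 by positivity))
  refine ⟨min δ₁ (δ₂ / 2), by positivity, ?_⟩
  filter_upwards [D.eventually_data_le (show 0 < ε / 6 by positivity)] with h ⟨hh, h0, hsrc⟩ ξ hξ
    j hj
  have hξ1 : ‖ξ‖ ≤ δ₁ := hξ.trans (min_le_left _ _)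
  have hξ2 : ξ ∈ Metric.ball (0 : Space N) δ₂ := by
    rw [mem_ball_zero_iff]; linarith [hξ.trans (min_le_right δ₁ (δ₂ / 2))]
  refine ((hd h hh.1 ξ).contraction D.pos_exp D.exp_le hC hC₀ hθ (hS h hh) hj).trans ?_
  have b1 : ∫ x, |spaceInterp h (U h 0) (x + ξ) - spaceInterp h (U h 0) x| ≤ ε / 2 := by
    have i1 : Integrable fun x => |spaceInterp h (U h 0) x - u₀ x| :=
      ((D.integrable hh.1 (Nat.zero_le _)).sub D.int_initial).abs
    have i2 : Integrable fun x => |u₀ (x + ξ) - u₀ x| :=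
      ((D.int_initial.comp_add_right ξ).sub D.int_initial).abs
    have e : ∫ x, |spaceInterp h (U h 0) (x + ξ) - u₀ (x + ξ)|
        = ∫ x, |spaceInterp h (U h 0) x - u₀ x| :=
      integral_add_right_eq_self (fun x => |spaceInterp h (U h 0) x - u₀ x|) ξ
    have := integral_abs_le_add₃
      (f := fun x => spaceInterp h (U h 0) (x + ξ) - spaceInterp h (U h 0) x)
      (i1.comp_add_right ξ) i2 i1 fun x => by
        have e : spaceInterp h (U h 0) (x + ξ) - spaceInterp h (U h 0) x
          = (spaceInterp h (U h 0) (x + ξ) - u₀ (x + ξ)) + (u₀ (x + ξ) - u₀ x)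
            - (spaceInterp h (U h 0) x - u₀ x) := by ring
        rw [e]
        exact (abs_sub _ _).trans (add_le_add_left (abs_add_le _ _) _)
    rw [e] at this
    have := hu ξ hξ2
    linarith
  have b2 : ∑ k ∈ Finset.range j, (G h).step k *
      ∫ x, |sourceInterp h (G h) g k (x + ξ) - sourceInterp h (G h) g k x| ≤ ε / 2 := by
    have hslab : ∀ k ∈ Finset.range (G h).J, (G h).step k *
        ∫ x, |sourceInterp h (G h) g k (x + ξ) - sourceInterp h (G h) g k x|
        ≤ (∫ p in (G h).slab N k, |sourceInterp h (G h) g k p.2 - g p.1 p.2|)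
          + (∫ p in (G h).slab N k, |g p.1 (p.2 + ξ) - g p.1 p.2|)
          + ∫ p in (G h).slab N k, |sourceInterp h (G h) g k p.2 - g p.1 p.2| := by
      intro k hk
      have hk' := Finset.mem_range.1 hk
      have j0 := D.int_source.mono_set ((G h).slab_subset N hk')
      have j1 : IntegrableOn (fun p : ℝ × Space N =>
          |sourceInterp h (G h) g k p.2 - g p.1 p.2|) ((G h).slab N k) :=
        (((G h).integrableOn_slab_snd k (D.integrable_source hh.1 hk')).sub j0).abs
      have j2 := integrableOn_slab_translate (G h) k ξ j1
      have j3 := ((integrableOn_slab_translate (G h) k ξ j0).sub j0).abs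
      rw [← (G h).setIntegral_slab_snd hk' (fun x =>
        |sourceInterp h (G h) g k (x + ξ) - sourceInterp h (G h) g k x|)]
      rw [← setIntegral_slab_translate (G h) k ξ
        (fun p => |sourceInterp h (G h) g k p.2 - g p.1 p.2|)]
      refine (setIntegral_abs_le_add₃ ((G h).measurableSet_slab N k) j2 j3 j1
        fun p _ => ?_).trans (le_of_eq ?_)
      · have e : sourceInterp h (G h) g k (p.2 + ξ) - sourceInterp h (G h) g k p.2
          = (sourceInterp h (G h) g k (p.2 + ξ) - g p.1 (p.2 + ξ)) + (g p.1 (p.2 + ξ) - g p.1 p.2)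
            - (sourceInterp h (G h) g k p.2 - g p.1 p.2) := by ring
        rw [e]
        exact (abs_sub _ _).trans (add_le_add_left (abs_add_le _ _) _)
      · rw [setIntegral_slab_translate (G h) k ξ
          (fun p => |sourceInterp h (G h) g k p.2 - g p.1 p.2|)]
        rfl
    have hnn : ∀ k ∈ Finset.range (G h).J, k ∉ Finset.range j → 0 ≤ (G h).step k *
        ∫ x, |sourceInterp h (G h) g k (x + ξ) - sourceInterp h (G h) g k x| := fun k hk _ =>
      mul_nonneg ((G h).step_pos (Finset.mem_range.1 hk)).le (integral_nonneg fun _ => abs_nonneg _)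
    refine (Finset.sum_le_sum_of_subset_of_nonneg (Finset.range_mono hj) hnn).trans
      ((Finset.sum_le_sum hslab).trans ?_)
    have hgi : IntegrableOn (fun p : ℝ × Space N => g p.1 (p.2 + ξ)) (cylinder N T) := by
      have := ((measurePreserving_add_right (volume : Measure (ℝ × Space N))
        ((0, ξ) : ℝ × Space N)).integrableOn_comp_preimage (measurableEmbedding_addRight _)).2
        D.int_source
      rw [cylinder_translate] at this
      refine this.congr_fun (fun p _ => ?_) measurableSet_cylinder
      simp [Prod.add_def]
    rw [Finset.sum_add_distrib, Finset.sum_add_distrib,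
      (G h).sum_setIntegral_slab N (f := fun p => |g p.1 (p.2 + ξ) - g p.1 p.2|)
        (hgi.sub D.int_source).abs]
    have := hg ξ hξ1
    simp only at this
    linarith
  linarith

/-- The tail estimate reduces everything to five contributions: tail and discretization error of
$u_0$, tail and discretization error of $g$, and the flux through the inner cut-off. The radius is
doubled because that cut-off varies between $R$ and $2R$. -/
theorem exists_tail_le {ε : ℝ} (hε : 0 < ε) : ∃ R > 0, ∀ᶠ h in 𝓝[>] 0,
    ∀ j ≤ (G h).J, ∫ x in {x | R < ‖x‖}, |spaceInterp h (U h j) x| ≤ ε := by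
  obtain ⟨C, hC, hd⟩ := D.exists_diff_zero
  obtain ⟨θ, C₀, hθ, hC₀, hS⟩ := D.decay
  obtain ⟨L, hL0, hL⟩ := D.exists_L1_bound
  have hε5 : 0 < ε / 5 := by positivity
  have t1 := tendsto_setIntegral_tail D.int_initial (n := fun x => ‖x‖) measurable_norm
  have t2 := tendsto_setIntegral_tail D.int_source (n := fun p : ℝ × Space N => ‖p.2‖)
    (by fun_prop)
  have t3 := tendsto_flux_bound (N := N) hθ (T * (C * cutoffConst N * C₀ * (L + 1)))
  obtain ⟨R, hR, h1, h2, h3⟩ := ((eventually_gt_atTop (1 : ℝ)).and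
    ((t1.eventually_lt_const hε5).and ((t2.eventually_lt_const hε5).and
      (t3.eventually_lt_const hε5)))).exists
  refine ⟨2 * R, by linarith, ?_⟩
  have hms : MeasurableSet {x : Space N | R < ‖x‖} :=
    measurableSet_lt measurable_const measurable_norm
  filter_upwards [D.eventually_data_le hε5, hL] with h ⟨hh, h0, hsrc⟩ hLh j hj
  refine ((hd h hh.1).tail D.pos_exp D.exp_le hC hC₀ hθ (hS h hh) hLh hR hj).trans ?_
  have b1 : ∫ x in {x | R < ‖x‖}, |spaceInterp h (U h 0) x| ≤ 2 * (ε / 5) := by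
    have i0 := D.integrable hh.1 (Nat.zero_le (G h).J)
    have i1 : Integrable fun x => |spaceInterp h (U h 0) x - u₀ x| := (i0.sub D.int_initial).abs
    have := integral_abs_le_add (f := spaceInterp h (U h 0))
      (μ := volume.restrict {x | R < ‖x‖}) D.int_initial.abs.integrableOn
      i1.integrableOn (fun x => by
        simpa using abs_add_le (u₀ x) (spaceInterp h (U h 0) x - u₀ x))
    have h4 := setIntegral_le_integral (s := {x | R < ‖x‖}) i1 (ae_of_all _ fun _ => abs_nonneg _)
    linarith
  have b2 : ∑ k ∈ Finset.range j, (G h).step k *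
      ∫ x in {x | R < ‖x‖}, |sourceInterp h (G h) g k x| ≤ 2 * (ε / 5) := by
    have hslab : ∀ k ∈ Finset.range (G h).J, (G h).step k *
        ∫ x in {x | R < ‖x‖}, |sourceInterp h (G h) g k x|
        ≤ (∫ p in (G h).slab N k, |sourceInterp h (G h) g k p.2 - g p.1 p.2|)
          + ∫ p in (G h).slab N k, {p : ℝ × Space N | R < ‖p.2‖}.indicator
            (fun p => |g p.1 p.2|) p := by
      intro k hk
      have hk' := Finset.mem_range.1 hk
      have hm2 : MeasurableSet {p : ℝ × Space N | R < ‖p.2‖} :=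
        measurableSet_lt measurable_const (by fun_prop)
      have j0 := D.int_source.mono_set ((G h).slab_subset N hk')
      have j1 : IntegrableOn (fun p : ℝ × Space N =>
          |sourceInterp h (G h) g k p.2 - g p.1 p.2|) ((G h).slab N k) :=
        (((G h).integrableOn_slab_snd k (D.integrable_source hh.1 hk')).sub j0).abs
      rw [← integral_indicator hms, ← (G h).setIntegral_slab_snd hk', ← integral_add j1
        (j0.abs.indicator hm2)]
      refine integral_mono_of_nonneg (ae_of_all _ fun p => indicator_nonneg
        (fun _ _ => abs_nonneg _) _) (j1.add (j0.abs.indicator hm2)) (ae_of_all _ fun p => ?_)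
      by_cases hp : R < ‖p.2‖
      · simp only [indicator_of_mem (show p.2 ∈ {x | R < ‖x‖} from hp),
          indicator_of_mem (show p ∈ {p : ℝ × Space N | R < ‖p.2‖} from hp)]
        simpa using abs_add_le (sourceInterp h (G h) g k p.2 - g p.1 p.2) (g p.1 p.2)
      · simp only [indicator_of_notMem (show p.2 ∉ {x | R < ‖x‖} from hp),
          indicator_of_notMem (show p ∉ {p : ℝ × Space N | R < ‖p.2‖} from hp)]
        positivity
    have hnn : ∀ k ∈ Finset.range (G h).J, k ∉ Finset.range j → 0 ≤ (G h).step k *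
        ∫ x in {x | R < ‖x‖}, |sourceInterp h (G h) g k x| := fun k hk _ =>
      mul_nonneg ((G h).step_pos (Finset.mem_range.1 hk)).le (integral_nonneg fun _ => abs_nonneg _)
    have hm2 : MeasurableSet {p : ℝ × Space N | R < ‖p.2‖} :=
      measurableSet_lt measurable_const (by fun_prop)
    refine (Finset.sum_le_sum_of_subset_of_nonneg (Finset.range_mono hj) hnn).trans
      ((Finset.sum_le_sum hslab).trans ?_)
    rw [Finset.sum_add_distrib, (G h).sum_setIntegral_slab N (D.int_source.abs.indicator hm2),
      integral_indicator hm2]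
    linarith
  linarith

end Basic

end SchemeData

end GPME

namespace GPME

variable {N : ℕ} {T : ℝ}

/-- The bounds at scale $R=1$. They depend on the stencil only through the truncated moment, hence
are uniform in $h$ for a fixed test function. -/
theorem Stencil.op_bounds (S : Stencil N) {h A ρ K : ℝ} {ψ : Space N → ℝ} (hψ : Continuous ψ)
    (hA : 0 ≤ A) (hb : ∀ x, |ψ x| ≤ A) (hs : ∀ x, ρ < ‖x‖ → ψ x = 0)
    (h2 : ∀ x z, |secondDiff ψ x z| ≤ A * ‖z‖ ^ 2) (hi : Integrable ψ) (hK : S.trunc h 1 ≤ K) :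
    (∀ x, |S.op h ψ x| ≤ 4 * A * K) ∧
      ∫ x, |S.op h ψ x|
        ≤ 4 * A * volume.real (Metric.closedBall (0 : Space N) (ρ + 1)) * K := by
  constructor
  · intro x
    refine (S.abs_op_le h (R := 1) (A := 4 * A) hb fun z => ?_).trans
      (mul_le_mul_of_nonneg_left hK (by positivity))
    simpa using abs_secondDiff_le_min hA hb h2 x z
  · refine (S.integral_abs_op_le h (R := 1)
      (A := 4 * A * volume.real (Metric.closedBall (0 : Space N) (ρ + 1)))
      hψ.measurable hi hb fun z => ?_).trans
      (mul_le_mul_of_nonneg_left hK (by positivity))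
    simpa using integral_secondDiff_le hψ hA hb hs h2 z

/-! ### The time interpolation -/

/-- The coefficient of `U^{j+1} - U^j` in the interpolant. -/
noncomputable def TimeGrid.clamp (G : TimeGrid T) (j : ℕ) (t : ℝ) : ℝ :=
  max 0 (min 1 ((t - G.node j) / G.step j))

theorem TimeGrid.continuous_clamp (G : TimeGrid T) (j : ℕ) : Continuous (G.clamp j) := by
  unfold TimeGrid.clamp; fun_prop

theorem TimeGrid.clamp_mem (G : TimeGrid T) (j : ℕ) (t : ℝ) : G.clamp j t ∈ Icc (0 : ℝ) 1 :=
  ⟨le_max_left _ _, max_le zero_le_one (min_le_left _ _)⟩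

theorem TimeGrid.clamp_of_le (G : TimeGrid T) {j : ℕ} (hj : j < G.J) {t : ℝ}
    (ht : t ≤ G.node j) : G.clamp j t = 0 := by
  refine max_eq_left ((min_le_right _ _).trans ?_)
  exact div_nonpos_of_nonpos_of_nonneg (by linarith) (G.step_pos hj).le

theorem TimeGrid.clamp_of_ge (G : TimeGrid T) {j : ℕ} (hj : j < G.J) {t : ℝ}
    (ht : G.node (j + 1) ≤ t) : G.clamp j t = 1 := by
  unfold TimeGrid.clamp
  rw [min_eq_left, max_eq_right zero_le_one]
  rw [le_div_iff₀ (G.step_pos hj)]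
  unfold TimeGrid.step; linarith

theorem TimeGrid.clamp_of_mem (G : TimeGrid T) {j : ℕ} (hj : j < G.J) {t : ℝ}
    (ht : t ∈ Icc (G.node j) (G.node (j + 1))) : G.clamp j t = (t - G.node j) / G.step j := by
  unfold TimeGrid.clamp
  rw [min_eq_right, max_eq_right]
  · exact div_nonneg (by linarith [ht.1]) (G.step_pos hj).le
  · rw [div_le_one (G.step_pos hj)]
    unfold TimeGrid.step; linarith [ht.2]

/-- Completed steps have coefficient $1$ and telescope, future steps have coefficient $0$, and only
the current one is partial. -/
theorem TimeGrid.sum_clamp (G : TimeGrid T) (a : ℕ → ℝ) {k : ℕ} (hk : k < G.J) {t : ℝ}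
    (ht : t ∈ Icc (G.node k) (G.node (k + 1))) :
    a 0 + ∑ j ∈ Finset.range G.J, G.clamp j t * (a (j + 1) - a j)
      = a k + G.clamp k t * (a (k + 1) - a k) := by
  have h1 : ∑ j ∈ Finset.range G.J, G.clamp j t * (a (j + 1) - a j)
      = ∑ j ∈ Finset.range (k + 1), G.clamp j t * (a (j + 1) - a j) := by
    refine (Finset.sum_subset (Finset.range_mono hk) fun j hj hj' => ?_).symm
    rw [Finset.mem_range] at hj hj'
    rw [G.clamp_of_le hj, zero_mul]
    exact ht.2.trans (G.node_mono (not_lt.1 hj') hj.le)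
  have h2 : ∑ j ∈ Finset.range k, G.clamp j t * (a (j + 1) - a j)
      = ∑ j ∈ Finset.range k, (a (j + 1) - a j) := by
    refine Finset.sum_congr rfl fun j hj => ?_
    rw [Finset.mem_range] at hj
    rw [G.clamp_of_ge (hj.trans hk), one_mul]
    exact (G.node_mono (show j + 1 ≤ k from hj) hk.le).trans ht.1
  rw [h1, Finset.sum_range_succ, h2, Finset.sum_range_sub]
  ring

/-- Closed intervals treat $t=0$ together with the half-open pieces of the definition; positivity of
$T$ guarantees that there is a step to put $t=0$ in. -/
theorem interpolant_of_mem (h : ℝ) (G : TimeGrid T) (U : ℕ → Idx N → ℝ) (hT : 0 < T) {t : ℝ}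
    (ht : t ∈ Icc 0 T) : ∃ k < G.J, t ∈ Icc (G.node k) (G.node (k + 1)) ∧
      ∀ x, interpolant h G U t x = spaceInterp h (U k) x
        + G.clamp k t * (spaceInterp h (U (k + 1)) x - spaceInterp h (U k) x) := by
  rcases ht.1.eq_or_lt with h0 | h0
  · have hJ : 0 < G.J := by
      obtain ⟨j, hj, -⟩ := G.exists_mem ⟨hT, le_rfl⟩
      omega
    have ht0 : t = G.node 0 := by rw [G.node_zero, h0]
    refine ⟨0, hJ, ⟨ht0.ge, ?_⟩, fun x => ?_⟩
    · rw [← h0]; exact G.node_nonneg hJ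
    · rw [G.clamp_of_le hJ ht0.le, zero_mul, add_zero]
      unfold interpolant
      rw [indicator_of_mem (mem_singleton_iff.2 ht0), Finset.sum_eq_zero, add_zero]
      intro j hj
      refine indicator_of_notMem (fun hm => ?_) _
      have := G.node_nonneg (Finset.mem_range.1 hj).le
      exact absurd hm.1 (not_lt.2 (by rw [← h0]; exact this))
  · obtain ⟨k, hk, hm⟩ := G.exists_mem ⟨h0, ht.2⟩
    refine ⟨k, hk, Ioc_subset_Icc_self hm, fun x => ?_⟩
    unfold interpolant
    rw [indicator_of_notMem (by rw [mem_singleton_iff, G.node_zero]; exact h0.ne'), zero_add,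
      Finset.sum_eq_single k]
    · rw [indicator_of_mem hm, G.clamp_of_mem hk (Ioc_subset_Icc_self hm)]
      rfl
    · intro j hj hjk
      rw [Finset.mem_range] at hj
      refine indicator_of_notMem (fun hm' => ?_) _
      rcases lt_or_gt_of_ne hjk with hlt | hlt
      · exact absurd (hm'.2.trans (G.node_mono hlt hk.le)) (not_le.2 hm.1)
      · exact absurd (hm.2.trans (G.node_mono hlt hj.le)) (not_le.2 hm'.1)
    · intro hk'
      exact absurd (Finset.mem_range.2 hk) hk'

/-- A global form with continuous time coefficients and fixed spatial functions. It yields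
continuity in time directly and permits integration by parts in time term by term. -/
theorem interpolant_eq_sum_clamp (h : ℝ) (G : TimeGrid T) (U : ℕ → Idx N → ℝ) (hT : 0 < T) {t : ℝ}
    (ht : t ∈ Icc 0 T) (x : Space N) :
    interpolant h G U t x = spaceInterp h (U 0) x + ∑ j ∈ Finset.range G.J,
      G.clamp j t * (spaceInterp h (U (j + 1)) x - spaceInterp h (U j) x) := by
  obtain ⟨k, hk, hm, he⟩ := interpolant_of_mem h G U hT ht
  rw [he, G.sum_clamp (fun j => spaceInterp h (U j) x) hk hm]

theorem measurable_indicator_fst {I : Set ℝ} (f : ℝ → Space N → ℝ) (hI : MeasurableSet I)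
    (hf : Measurable fun p : ℝ × Space N => f p.1 p.2) :
    Measurable fun p : ℝ × Space N => I.indicator (fun s => f s p.2) p.1 := by
  have : (fun p : ℝ × Space N => I.indicator (fun s => f s p.2) p.1)
      = (Prod.fst ⁻¹' I).indicator fun p => f p.1 p.2 := by
    funext p
    by_cases hp : p.1 ∈ I
    · rw [indicator_of_mem hp, indicator_of_mem (show p ∈ Prod.fst ⁻¹' I from hp)]
    · rw [indicator_of_notMem hp, indicator_of_notMem (show p ∉ Prod.fst ⁻¹' I from hp)]
  rw [this]
  exact hf.indicator (measurable_fst hI)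

theorem measurable_interpolant (h : ℝ) (G : TimeGrid T) (U : ℕ → Idx N → ℝ) :
    Measurable fun p : ℝ × Space N => interpolant h G U p.1 p.2 := by
  have hs : ∀ j, Measurable fun p : ℝ × Space N => spaceInterp h (U j) p.2 := fun j =>
    (measurable_spaceInterp h (U j)).comp measurable_snd
  have hj : ∀ j, Measurable fun p : ℝ × Space N => spaceInterp h (U j) p.2
      + (p.1 - G.node j) / (G.node (j + 1) - G.node j)
        * (spaceInterp h (U (j + 1)) p.2 - spaceInterp h (U j) p.2) := by
    intro j
    have q : Measurable fun p : ℝ × Space N =>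
        (p.1 - G.node j) / (G.node (j + 1) - G.node j) := by fun_prop
    exact (hs j).add (q.mul ((hs (j + 1)).sub (hs j)))
  simp only [interpolant]
  refine (measurable_indicator_fst (fun _ x => spaceInterp h (U 0) x)
    (measurableSet_singleton _) (hs 0)).add (Finset.measurable_fun_sum _ fun j _ => ?_)
  exact measurable_indicator_fst (fun s x => spaceInterp h (U j) x
      + (s - G.node j) / (G.node (j + 1) - G.node j)
        * (spaceInterp h (U (j + 1)) x - spaceInterp h (U j) x)) measurableSet_Ioc (hj j)

theorem measurable_interpolant_slice (h : ℝ) (G : TimeGrid T) (U : ℕ → Idx N → ℝ) (t : ℝ) :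
    Measurable (interpolant h G U t) :=
  Measurable.of_uncurry_left (f := interpolant h G U) (measurable_interpolant h G U)

/-! ### Equicontinuity in time at the nodes -/

namespace SchemeData

variable {γ : ℝ} {φ : ℝ → ℝ} {u₀ : Space N → ℝ} {g : ℝ → Space N → ℝ}
  {S : ℝ → Stencil N} {G : ℝ → TimeGrid T} {U : ℝ → ℕ → Idx N → ℝ}
variable (D : SchemeData γ φ u₀ g S G U)
include D

theorem exists_trunc_one : ∃ K, 0 ≤ K ∧ ∀ h ∈ Ioo (0 : ℝ) 1, (S h).trunc h 1 ≤ K := by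
  obtain ⟨θ, C, -, hC, hS⟩ := D.decay
  exact ⟨4 * (C * 2 ^ (-θ)), by positivity, fun h hh => trunc_one_le (hS h hh)⟩

/-- Equicontinuity in time in a dual sense: the scheme is tested with $\psi$ and summed over the
steps, with the operator moved onto $\psi$, so only the sup bound of $\varphi(U)$ and the $L^1$ norm
of $\mathcal L^h\psi$ enter. -/
theorem node_functional {h : ℝ} (hh : 0 < h) {ψ : Space N → ℝ} {A E Φ : ℝ} (hψm : Measurable ψ)
    (hψi : Integrable ψ) (hA : ∀ x, |ψ x| ≤ A) (hE : ∫ x, |(S h).op h ψ x| ≤ E)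
    (hΦ : ∀ j ≤ (G h).J, ∀ x, |φ (spaceInterp h (U h j) x)| ≤ Φ) {i j : ℕ} (hij : i ≤ j)
    (hj : j ≤ (G h).J) :
    |∫ x, (spaceInterp h (U h j) x - spaceInterp h (U h i) x) * ψ x|
      ≤ ((G h).node j - (G h).node i) * (Φ * E)
        + A * ∑ k ∈ Finset.Ico i j, (G h).step k * ∫ x, |sourceInterp h (G h) g k x| := by
  have hmul : ∀ f : Space N → ℝ, Integrable f → Integrable fun x => f x * ψ x := fun f hf =>
    hf.mul_bdd (c := A) hψm.aestronglyMeasurable (ae_of_all _ hA)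
  induction j, hij using Nat.le_induction with
  | base => simp
  | succ k hk ih =>
    have hs := (G h).step_pos hj
    have hkJ : k ≤ (G h).J := by omega
    have hφm : Measurable fun x => φ (spaceInterp h (U h (k + 1)) x) :=
      D.mono.measurable.comp (measurable_spaceInterp _ _)
    have i1 : Integrable fun x =>
        (spaceInterp h (U h k) x - spaceInterp h (U h i) x) * ψ x :=
      hmul _ ((D.integrable hh hkJ).sub (D.integrable hh (hk.trans hkJ)))
    have i2 : Integrable fun x => sourceInterp h (G h) g k x * ψ x :=
      hmul _ (D.integrable_source hh hj)
    have i12 : Integrable fun x => (spaceInterp h (U h k) x - spaceInterp h (U h i) x) * ψ x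
        + (G h).step k * (sourceInterp h (G h) g k x * ψ x) := i1.add (i2.const_mul _)
    have i3 : Integrable fun x =>
        ψ x * (S h).op h (fun y => φ (spaceInterp h (U h (k + 1)) y)) x :=
      hψi.mul_bdd (c := 2 * Φ * (S h).mass) ((S h).measurable_op h hφm).aestronglyMeasurable
        (ae_of_all _ fun x => (S h).abs_op_le_mass h (hΦ _ hj) x)
    have e : ∫ x, (spaceInterp h (U h (k + 1)) x - spaceInterp h (U h i) x) * ψ x
        = (∫ x, (spaceInterp h (U h k) x - spaceInterp h (U h i) x) * ψ x)
          + (G h).step k * (∫ x, sourceInterp h (G h) g k x * ψ x)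
          + (G h).step k * ∫ x, φ (spaceInterp h (U h (k + 1)) x) * (S h).op h ψ x := by
      rw [← (S h).integral_mul_op h (hΦ _ hj) hφm hψi, ← integral_const_mul, ← integral_const_mul,
        ← integral_add i1 (i2.const_mul _), ← integral_add i12 (i3.const_mul _)]
      congr 1; ext x
      rw [D.step_eq hh hj x]
      ring
    have b2 : |∫ x, sourceInterp h (G h) g k x * ψ x|
        ≤ A * ∫ x, |sourceInterp h (G h) g k x| := by
      refine abs_integral_le_integral_abs.trans ?_
      rw [← integral_const_mul]
      refine integral_mono i2.abs ((D.integrable_source hh hj).abs.const_mul _) fun x => ?_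
      simp only [abs_mul]
      rw [mul_comm]
      exact mul_le_mul_of_nonneg_right (hA x) (abs_nonneg _)
    have hΦ0 : 0 ≤ Φ := (abs_nonneg _).trans (hΦ _ hj 0)
    have b3 : |∫ x, φ (spaceInterp h (U h (k + 1)) x) * (S h).op h ψ x| ≤ Φ * E := by
      refine abs_integral_le_integral_abs.trans ?_
      refine le_trans ?_ (mul_le_mul_of_nonneg_left hE hΦ0)
      rw [← integral_const_mul]
      refine integral_mono_of_nonneg (ae_of_all _ fun _ => abs_nonneg _)
        (((S h).integrable_op h hψm hψi).abs.const_mul _) (ae_of_all _ fun x => ?_)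
      simp only [abs_mul]
      exact mul_le_mul_of_nonneg_right (hΦ _ hj x) (abs_nonneg _)
    have hnode : (G h).node (k + 1) = (G h).node k + (G h).step k := by
      unfold TimeGrid.step; ring
    rw [e, Finset.sum_Ico_succ_top hk, mul_add, hnode]
    have t1 := abs_add_le ((∫ x, (spaceInterp h (U h k) x - spaceInterp h (U h i) x) * ψ x)
          + (G h).step k * (∫ x, sourceInterp h (G h) g k x * ψ x))
          ((G h).step k * ∫ x, φ (spaceInterp h (U h (k + 1)) x) * (S h).op h ψ x)
    have t2 := abs_add_le (∫ x, (spaceInterp h (U h k) x - spaceInterp h (U h i) x) * ψ x)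
          ((G h).step k * (∫ x, sourceInterp h (G h) g k x * ψ x))
    rw [abs_mul, abs_of_pos hs] at t1 t2
    have c2 := mul_le_mul_of_nonneg_left b2 hs.le
    have c3 := mul_le_mul_of_nonneg_left b3 hs.le
    linarith [ih hkJ]

/-- A Kruzhkov-type argument: dual estimates against translates of one mollifier become strong $L^1$
estimates, since translations and tails are already uniformly controlled. Each node contributes
$\varepsilon/8$, so the difference has translation error and tail at most $\varepsilon/4$. -/
theorem exists_node_time_le {ε : ℝ} (hε : 0 < ε) : ∃ η > 0, ∀ᶠ h in 𝓝[>] 0,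
    ∀ i ≤ (G h).J, ∀ j ≤ (G h).J, |(G h).node j - (G h).node i| ≤ η →
      ∫ x, |spaceInterp h (U h j) x - spaceInterp h (U h i) x| ≤ ε := by
  obtain ⟨δ, hδ, htr⟩ := D.exists_translate_le (show 0 < ε / 8 by positivity)
  obtain ⟨R, hR, htl⟩ := D.exists_tail_le (show 0 < ε / 8 by positivity)
  obtain ⟨ρ, hρ, hρc, hρ0, hρ1, hρs⟩ := exists_mollifier N hδ
  obtain ⟨A₀, hA₀, h2⟩ := exists_secondDiff_le hρ hρc
  obtain ⟨B, hB⟩ := hρ.continuous.bounded_above_of_compact_support hρc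
  obtain ⟨K, hK, htrunc⟩ := D.exists_trunc_one
  obtain ⟨M, hM, hU⟩ := D.bdd
  set A := max A₀ B with hAdef
  have hA : 0 ≤ A := hA₀.trans (le_max_left _ _)
  have hAb : ∀ x, |ρ x| ≤ A := fun x => (hB x).trans (le_max_right _ _)
  have hA2 : ∀ x z, |secondDiff ρ x z| ≤ A * ‖z‖ ^ 2 := fun x z =>
    (h2 x z).trans (mul_le_mul_of_nonneg_right (le_max_left _ _) (by positivity))
  have hρi : Integrable ρ := hρ.continuous.integrable_of_hasCompactSupport hρc
  set E := 4 * A * volume.real (Metric.closedBall (0 : Space N) (δ + 1)) * K with hEdef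
  have hE : 0 ≤ E := by positivity
  set Φ := |φ M| + |φ (-M)| with hΦdef
  have hΦ0 : 0 ≤ Φ := by positivity
  set V := volume.real (Metric.closedBall (0 : Space N) R) with hVdef
  have hV : 0 ≤ V := measureReal_nonneg
  -- Mollified values of size $\kappa$ integrate over the ball to at most $\varepsilon/2$. Half of
  -- $\kappa$ is then allotted to the diffusion and half to the source.
  set κ := ε / (2 * (V + 1)) with hκdef
  have hκ : 0 < κ := by positivity
  obtain ⟨η₁, hη₁, hac⟩ := exists_setIntegral_cylinder_le D.int_source
    (show 0 < κ / (2 * (A + 1)) by positivity)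
  refine ⟨min η₁ (κ / (2 * (Φ * E + 1))), by positivity, ?_⟩
  filter_upwards [htr, htl, eventually_mem_Ioo_one] with h htr htl hh
  have key : ∀ i j, i ≤ j → j ≤ (G h).J →
      (G h).node j - (G h).node i ≤ min η₁ (κ / (2 * (Φ * E + 1))) →
      ∫ x, |spaceInterp h (U h j) x - spaceInterp h (U h i) x| ≤ ε := by
    intro i j hij hj hη
    have hi := hij.trans hj
    have Ii := D.integrable hh.1 hi
    have Ij := D.integrable hh.1 hj
    have main := integral_abs_le_of_mollified (f := fun x => spaceInterp h (U h j) x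
      - spaceInterp h (U h i) x) (δ := δ) (R := R) (ε := ε / 4) (κ := κ) hρ.continuous hρi hρ0
      hρ1 hρs (Ij.sub Ii) ((measurable_spaceInterp _ _).sub (measurable_spaceInterp _ _))
      (fun ξ hξ => ?_) ?_ (fun x _ => ?_)
    · refine main.trans ?_
      have : κ * V ≤ ε / 2 := by
        rw [hκdef, div_mul_eq_mul_div, div_le_div_iff₀ (by positivity) (by positivity)]
        nlinarith
      linarith
    · have := integral_abs_le_add (f := fun x => spaceInterp h (U h j) (x + ξ)
          - spaceInterp h (U h i) (x + ξ) - (spaceInterp h (U h j) x - spaceInterp h (U h i) x))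
        ((Ij.comp_add_right ξ).sub Ij).abs ((Ii.comp_add_right ξ).sub Ii).abs (fun x => by
          simp only [Pi.sub_apply]
          refine le_trans (le_of_eq ?_) (abs_sub _ _)
          congr 1; ring)
      refine this.trans ?_
      have a1 := htr ξ hξ j hj
      have a2 := htr ξ hξ i hi
      simp only [Pi.sub_apply]
      linarith
    · have := integral_abs_le_add (μ := volume.restrict {x | R < ‖x‖})
        (f := fun x => spaceInterp h (U h j) x - spaceInterp h (U h i) x)
        Ij.abs.integrableOn Ii.abs.integrableOn (fun x => abs_sub _ _)
      linarith [htl j hj, htl i hi]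
    -- Translation invariance makes the constant independent of the centre $x$ of the mollifier.
    · have hop : ∀ y, (S h).op h (fun y => ρ (y - x)) y = (S h).op h ρ (y - x) := fun y => by
        simpa [sub_eq_add_neg] using (S h).op_comp_add_right h ρ (-x) y
      have hEx : ∫ y, |(S h).op h (fun y => ρ (y - x)) y| ≤ E := by
        simp_rw [hop]
        rw [integral_sub_right_eq_self (fun y => |(S h).op h ρ y|) x]
        exact ((S h).op_bounds hρ.continuous hA hAb hρs hA2 hρi (htrunc h hh)).2
      refine (D.node_functional hh.1 (hρ.continuous.measurable.comp (measurable_id.sub_const x))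
        (hρi.comp_sub_right x) (fun y => hAb _) hEx
        (fun k hk y => D.abs_phi_le (hU h hh.1 k hk _)) hij hj).trans ?_
      have s1 := (D.sum_source_le hh.1 (i := i) hj).trans (hac _ _ (hη.trans (min_le_left _ _)))
      have s2 : ((G h).node j - (G h).node i) * (Φ * E) ≤ κ / 2 := by
        have := mul_le_mul_of_nonneg_right (hη.trans (min_le_right _ _))
          (show 0 ≤ Φ * E by positivity)
        refine this.trans ?_
        rw [div_mul_eq_mul_div, div_le_div_iff₀ (by positivity) (by positivity)]
        nlinarith [mul_nonneg hΦ0 hE]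
      have s3 : A * ∑ k ∈ Finset.Ico i j, (G h).step k * ∫ x, |sourceInterp h (G h) g k x|
          ≤ κ / 2 := by
        refine (mul_le_mul_of_nonneg_left s1 hA).trans ?_
        rw [mul_div_assoc', div_le_div_iff₀ (by positivity) (by positivity)]
        nlinarith
      linarith
  intro i hi j hj hη
  rcases le_total i j with hij | hij
  · exact key i j hij hj ((le_abs_self _).trans hη)
  · simp_rw [abs_sub_comm (spaceInterp h (U h j) _)]
    exact key j i hij hi ((le_abs_self _).trans (by rwa [abs_sub_comm]))

/-! ### Uniform estimates for the interpolants -/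

/-- Convexity transfers every norm estimate from the nodes to all intermediate times. -/
theorem interpolant_convex (h : ℝ) {t : ℝ} (ht : t ∈ Icc 0 T) :
    ∃ k < (G h).J, t ∈ Icc ((G h).node k) ((G h).node (k + 1)) ∧ ∃ l ∈ Icc (0 : ℝ) 1,
      ∀ x, interpolant h (G h) (U h) t x = (1 - l) * spaceInterp h (U h k) x
        + l * spaceInterp h (U h (k + 1)) x := by
  obtain ⟨k, hk, hm, he⟩ := interpolant_of_mem h (G h) (U h) D.pos_time ht
  exact ⟨k, hk, hm, _, (G h).clamp_mem k t, fun x => by rw [he]; ring⟩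

theorem abs_interpolant_le {M : ℝ} {h : ℝ} (hU : ∀ j ≤ (G h).J, ∀ β, |U h j β| ≤ M) {t : ℝ}
    (ht : t ∈ Icc 0 T) (x : Space N) : |interpolant h (G h) (U h) t x| ≤ M := by
  obtain ⟨k, hk, -, l, hl, he⟩ := D.interpolant_convex h ht
  rw [he]
  refine (abs_add_le _ _).trans ?_
  rw [abs_mul, abs_mul, abs_of_nonneg hl.1, abs_of_nonneg (sub_nonneg.2 hl.2)]
  have a1 := mul_le_mul_of_nonneg_left (hU k hk.le (cellIndex h x)) (sub_nonneg.2 hl.2)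
  have a2 := mul_le_mul_of_nonneg_left (hU (k + 1) hk (cellIndex h x)) hl.1
  simp only [spaceInterp]
  linarith

theorem integrable_interpolant {h : ℝ} (hh : 0 < h) {t : ℝ} (ht : t ∈ Icc 0 T) :
    Integrable (interpolant h (G h) (U h) t) := by
  obtain ⟨k, hk, -, l, hl, he⟩ := D.interpolant_convex h ht
  have e : interpolant h (G h) (U h) t = fun x => (1 - l) * spaceInterp h (U h k) x
        + l * spaceInterp h (U h (k + 1)) x := funext he
  rw [e]
  exact ((D.integrable hh hk.le).const_mul _).add ((D.integrable hh hk).const_mul _)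

theorem exists_interpolant_L1_bound : ∃ L, 0 ≤ L ∧ ∀ᶠ h in 𝓝[>] 0, ∀ t ∈ Icc 0 T,
    ∫ x, |interpolant h (G h) (U h) t x| ≤ L := by
  obtain ⟨L, hL, hb⟩ := D.exists_L1_bound
  refine ⟨L, hL, ?_⟩
  filter_upwards [hb, self_mem_nhdsWithin] with h hb hh t ht
  obtain ⟨k, hk, -, l, hl, he⟩ := D.interpolant_convex h ht
  have := integral_abs_le_add (f := interpolant h (G h) (U h) t)
    ((D.integrable hh hk.le).abs.const_mul (1 - l)) ((D.integrable hh hk).abs.const_mul l)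
    fun x => by
      rw [he]
      refine (abs_add_le _ _).trans (le_of_eq ?_)
      rw [abs_mul, abs_mul, abs_of_nonneg hl.1, abs_of_nonneg (sub_nonneg.2 hl.2)]
  rw [integral_const_mul, integral_const_mul] at this
  have a1 := mul_le_mul_of_nonneg_left (hb k hk.le) (sub_nonneg.2 hl.2)
  have a2 := mul_le_mul_of_nonneg_left (hb (k + 1) hk) hl.1
  linarith

theorem exists_interpolant_translate_le {ε : ℝ} (hε : 0 < ε) : ∃ δ > 0, ∀ᶠ h in 𝓝[>] 0,
    ∀ ξ : Space N, ‖ξ‖ ≤ δ → ∀ t ∈ Icc 0 T,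
      ∫ x, |interpolant h (G h) (U h) t (x + ξ) - interpolant h (G h) (U h) t x| ≤ ε := by
  obtain ⟨δ, hδ, hb⟩ := D.exists_translate_le hε
  refine ⟨δ, hδ, ?_⟩
  filter_upwards [hb, self_mem_nhdsWithin] with h hb hh ξ hξ t ht
  obtain ⟨k, hk, -, l, hl, he⟩ := D.interpolant_convex h ht
  have I1 := D.integrable hh hk.le
  have I2 := D.integrable hh hk
  have := integral_abs_le_add
    (f := fun x => interpolant h (G h) (U h) t (x + ξ) - interpolant h (G h) (U h) t x)
    (((I1.comp_add_right ξ).sub I1).abs.const_mul (1 - l))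
    (((I2.comp_add_right ξ).sub I2).abs.const_mul l)
    fun x => by
      have e : interpolant h (G h) (U h) t (x + ξ) - interpolant h (G h) (U h) t x
        = (1 - l) * (spaceInterp h (U h k) (x + ξ) - spaceInterp h (U h k) x)
          + l * (spaceInterp h (U h (k + 1)) (x + ξ) - spaceInterp h (U h (k + 1)) x) := by
        rw [he, he]; ring
      rw [e]
      refine (abs_add_le _ _).trans (le_of_eq ?_)
      rw [abs_mul, abs_mul, abs_of_nonneg hl.1, abs_of_nonneg (sub_nonneg.2 hl.2)]
      rfl
  rw [integral_const_mul, integral_const_mul] at this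
  have a1 := mul_le_mul_of_nonneg_left (hb ξ hξ k hk.le) (sub_nonneg.2 hl.2)
  have a2 := mul_le_mul_of_nonneg_left (hb ξ hξ (k + 1) hk) hl.1
  simp only [Pi.sub_apply] at this
  linarith

theorem exists_interpolant_tail_le {ε : ℝ} (hε : 0 < ε) : ∃ R > 0, ∀ᶠ h in 𝓝[>] 0,
    ∀ t ∈ Icc 0 T, ∫ x in {x | R < ‖x‖}, |interpolant h (G h) (U h) t x| ≤ ε := by
  obtain ⟨R, hR, hb⟩ := D.exists_tail_le hε
  refine ⟨R, hR, ?_⟩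
  filter_upwards [hb, self_mem_nhdsWithin] with h hb hh t ht
  obtain ⟨k, hk, -, l, hl, he⟩ := D.interpolant_convex h ht
  have := integral_abs_le_add (f := interpolant h (G h) (U h) t)
    (μ := volume.restrict {x | R < ‖x‖})
    ((D.integrable hh hk.le).abs.integrableOn.const_mul (1 - l))
    ((D.integrable hh hk).abs.integrableOn.const_mul l)
    fun x => by
      rw [he]
      refine (abs_add_le _ _).trans (le_of_eq ?_)
      rw [abs_mul, abs_mul, abs_of_nonneg hl.1, abs_of_nonneg (sub_nonneg.2 hl.2)]
  rw [integral_const_mul, integral_const_mul] at this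
  have a1 := mul_le_mul_of_nonneg_left (hb k hk.le) (sub_nonneg.2 hl.2)
  have a2 := mul_le_mul_of_nonneg_left (hb (k + 1) hk) hl.1
  linarith

theorem integral_interpolant_sub_node_le {h : ℝ} (hh : 0 < h) {k : ℕ} (hk : k < (G h).J) {t : ℝ}
    {l : ℝ} (hl : l ∈ Icc (0 : ℝ) 1)
    (he : ∀ x, interpolant h (G h) (U h) t x = (1 - l) * spaceInterp h (U h k) x
        + l * spaceInterp h (U h (k + 1)) x) :
    (∫ x, |interpolant h (G h) (U h) t x - spaceInterp h (U h k) x|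
      ≤ ∫ x, |spaceInterp h (U h (k + 1)) x - spaceInterp h (U h k) x|) ∧
    ∫ x, |interpolant h (G h) (U h) t x - spaceInterp h (U h (k + 1)) x|
      ≤ ∫ x, |spaceInterp h (U h (k + 1)) x - spaceInterp h (U h k) x| := by
  have I : Integrable fun x => |spaceInterp h (U h (k + 1)) x - spaceInterp h (U h k) x| :=
    ((D.integrable hh hk).sub (D.integrable hh hk.le)).abs
  constructor
  · refine integral_mono_of_nonneg (ae_of_all _ fun _ => abs_nonneg _) I (ae_of_all _ fun x => ?_)
    have e : interpolant h (G h) (U h) t x - spaceInterp h (U h k) x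
        = l * (spaceInterp h (U h (k + 1)) x - spaceInterp h (U h k) x) := by rw [he]; ring
    simp only
    rw [e, abs_mul, abs_of_nonneg hl.1]
    exact mul_le_of_le_one_left (abs_nonneg _) hl.2
  · refine integral_mono_of_nonneg (ae_of_all _ fun _ => abs_nonneg _) I (ae_of_all _ fun x => ?_)
    have e : interpolant h (G h) (U h) t x - spaceInterp h (U h (k + 1)) x
        = -((1 - l) * (spaceInterp h (U h (k + 1)) x - spaceInterp h (U h k) x)) := by
      rw [he]; ring
    simp only
    rw [e, abs_neg, abs_mul, abs_of_nonneg (sub_nonneg.2 hl.2)]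
    exact mul_le_of_le_one_left (abs_nonneg _) (by linarith [hl.1])

theorem eventually_consecutive_le {ε : ℝ} (hε : 0 < ε) : ∀ᶠ h in 𝓝[>] 0,
    ∀ k < (G h).J, ∫ x, |spaceInterp h (U h (k + 1)) x - spaceInterp h (U h k) x| ≤ ε := by
  obtain ⟨η, hη, hb⟩ := D.exists_node_time_le hε
  filter_upwards [hb, D.mesh.eventually_lt_const hη] with h hb hm k hk
  refine hb k hk.le (k + 1) hk ?_
  change |(G h).step k| ≤ η
  rw [abs_of_pos ((G h).step_pos hk)]
  exact ((G h).step_le_mesh hk).trans hm.le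

/-- The implicit scheme evaluates $\varphi$ at the right end of each step, so the limit of the
nonlinear term needs the interpolant to be close to that value. -/
theorem eventually_interpolant_sub_next_le {ε : ℝ} (hε : 0 < ε) : ∀ᶠ h in 𝓝[>] 0,
    ∀ k < (G h).J, ∀ t ∈ Ioo ((G h).node k) ((G h).node (k + 1)),
      ∫ x, |interpolant h (G h) (U h) t x - spaceInterp h (U h (k + 1)) x| ≤ ε := by
  filter_upwards [D.eventually_consecutive_le hε, self_mem_nhdsWithin] with h hb hh k hk t ht
  have htT : t ∈ Icc 0 T := ⟨((G h).node_nonneg hk.le).trans ht.1.le,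
    ht.2.le.trans ((G h).node_le hk)⟩
  obtain ⟨k', hk', hm, l, hl, he⟩ := D.interpolant_convex h htT
  have : k' = k := by
    rcases lt_trichotomy k' k with hlt | heq | hlt
    · exact absurd (hm.2.trans ((G h).node_mono hlt hk.le)) (not_le.2 ht.1)
    · exact heq
    · exact absurd (((G h).node_mono hlt hk'.le).trans hm.1) (not_le.2 ht.2)
  subst this
  exact (D.integral_interpolant_sub_node_le hh hk hl he).2.trans (hb k' hk)

theorem exists_interpolant_time_le {ε : ℝ} (hε : 0 < ε) : ∃ η > 0, ∀ᶠ h in 𝓝[>] 0,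
    ∀ s ∈ Icc 0 T, ∀ t ∈ Icc 0 T, |t - s| ≤ η →
      ∫ x, |interpolant h (G h) (U h) t x - interpolant h (G h) (U h) s x| ≤ ε := by
  obtain ⟨η, hη, hb⟩ := D.exists_node_time_le (show 0 < ε / 3 by positivity)
  -- Left nodes of the steps containing $s$ and $t$ are at distance at most $|t-s|$ plus the mesh
  -- size; each is given $\eta/2$.
  refine ⟨η / 2, by positivity, ?_⟩
  filter_upwards [hb, D.eventually_consecutive_le (show 0 < ε / 3 by positivity),
    D.mesh.eventually_lt_const (show 0 < η / 2 by positivity), self_mem_nhdsWithin]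
    with h hb hc hm hh s hs t ht hst
  obtain ⟨i, hi, his, l, hl, hle⟩ := D.interpolant_convex h hs
  obtain ⟨j, hj, hjt, l', hl', hle'⟩ := D.interpolant_convex h ht
  have s1 := (G h).step_le_mesh hi
  have s2 := (G h).step_le_mesh hj
  unfold TimeGrid.step at s1 s2
  have hnode : |(G h).node j - (G h).node i| ≤ η := by
    have := abs_le.1 hst
    rw [abs_le]
    constructor <;> linarith [his.1, his.2, hjt.1, hjt.2]
  have a1 := (D.integral_interpolant_sub_node_le hh hi hl hle).1.trans (hc i hi)
  have a2 := (D.integral_interpolant_sub_node_le hh hj hl' hle').1.trans (hc j hj)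
  have a3 := hb i hi.le j hj.le hnode
  have := integral_abs_le_add₃
    (f := fun x => interpolant h (G h) (U h) t x - interpolant h (G h) (U h) s x)
    ((D.integrable_interpolant hh ht).sub (D.integrable hh hj.le)).abs
    ((D.integrable hh hj.le).sub (D.integrable hh hi.le)).abs
    ((D.integrable_interpolant hh hs).sub (D.integrable hh hi.le)).abs (fun x => by
      have e : interpolant h (G h) (U h) t x - interpolant h (G h) (U h) s x
        = (interpolant h (G h) (U h) t x - spaceInterp h (U h j) x)
          + (spaceInterp h (U h j) x - spaceInterp h (U h i) x)
          - (interpolant h (G h) (U h) s x - spaceInterp h (U h i) x) := by ring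
      rw [e]
      exact (abs_sub _ _).trans (add_le_add_left (abs_add_le _ _) _))
  simp only [Pi.sub_apply] at this
  linarith

end SchemeData

end GPME

namespace GPME

variable {N : ℕ} {T : ℝ}

/-! ### Compactness -/

/-- The Kolmogorov–Riesz criterion along an ultrafilter. -/
theorem exists_mem_integral_sub_le {ι : Type*} (𝓤 : Ultrafilter ι) {f : ι → Space N → ℝ} {L : ℝ}
    (hm : ∀ i, Measurable (f i)) (hi : ∀ᶠ i in (𝓤 : Filter ι), Integrable (f i))
    (hL : ∀ᶠ i in (𝓤 : Filter ι), ∫ x, |f i x| ≤ L)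
    (htr : ∀ ε > 0, ∃ δ > 0, ∀ᶠ i in (𝓤 : Filter ι), ∀ ξ, ‖ξ‖ ≤ δ →
      ∫ x, |f i (x + ξ) - f i x| ≤ ε)
    (htl : ∀ ε > 0, ∃ R > 0, ∀ᶠ i in (𝓤 : Filter ι), ∫ x in {x | R < ‖x‖}, |f i x| ≤ ε)
    {ε : ℝ} (hε : 0 < ε) :
    ∃ A ∈ 𝓤, ∀ i ∈ A, ∀ j ∈ A, ∫ x, |f i x - f j x| ≤ ε := by
  obtain ⟨δ, hδ, htr⟩ := htr (ε / 8) (by positivity)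
  obtain ⟨R, hR, htl⟩ := htl (ε / 8) (by positivity)
  obtain ⟨ρ, hρ, hρc, hρ0, hρ1, hρs⟩ := exists_mollifier N hδ
  obtain ⟨B, hB⟩ := hρ.continuous.bounded_above_of_compact_support hρc
  have hB0 : 0 ≤ B := (norm_nonneg _).trans (hB 0)
  have hρi : Integrable ρ := hρ.continuous.integrable_of_hasCompactSupport hρc
  set V := volume.real (Metric.closedBall (0 : Space N) R) with hVdef
  have hV : 0 ≤ V := measureReal_nonneg
  set κ := ε / (2 * (V + 1)) with hκdef
  have hκ : 0 < κ := by positivity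
  have hL0 : 0 ≤ L := by
    obtain ⟨i, hi⟩ := hL.exists
    exact (integral_nonneg fun _ => abs_nonneg _).trans hi
  -- With $L^1$ norms at most $L$, moving the centre of the mollifier by less than $e$ changes the
  -- mollified values by at most $\kappa/4$, uniformly in $i$. Finitely many centres therefore
  -- suffice.
  obtain ⟨e, he, huc⟩ := Metric.uniformContinuous_iff.1
    (hρc.uniformContinuous_of_continuous hρ.continuous) (κ / (4 * (L + 1))) (by positivity)
  have hmul : ∀ i, Integrable (f i) → ∀ y, Integrable fun x => f i x * ρ (x - y) :=
    fun i hf y => hf.mul_bdd (c := B)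
      (hρ.continuous.comp (continuous_id.sub continuous_const)).aestronglyMeasurable
      (ae_of_all _ fun x => hB _)
  obtain ⟨Y, -, hYf, hY⟩ := (isCompact_closedBall (0 : Space N) R).finite_cover_balls he
  -- Bounded real families converge along an ultrafilter, so no diagonal extraction is needed. Two
  -- such values at a net point differ by at most $\kappa/2$, and the two changes of centre cost the
  -- other $\kappa/2$.
  have hlim : ∀ y : Space N, ∃ a : ℝ,
      Tendsto (fun i => ∫ x, f i x * ρ (x - y)) (𝓤 : Filter ι) (𝓝 a) := by
    intro y
    have hbd : ∀ᶠ i in (𝓤 : Filter ι), ∫ x, f i x * ρ (x - y) ∈ Icc (-(L * B)) (L * B) := by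
      filter_upwards [hi, hL] with i hfi hLi
      rw [mem_Icc, ← abs_le]
      refine abs_integral_le_integral_abs.trans ?_
      refine le_trans ?_ (mul_le_mul_of_nonneg_right hLi hB0)
      rw [← integral_mul_const]
      refine integral_mono_of_nonneg (ae_of_all _ fun _ => abs_nonneg _) (hfi.abs.mul_const _)
        (ae_of_all _ fun x => ?_)
      simp only [abs_mul]
      exact mul_le_mul_of_nonneg_left (hB _) (abs_nonneg _)
    obtain ⟨a, -, ha⟩ := isCompact_Icc.ultrafilter_le_nhds
      (𝓤.map fun i => ∫ x, f i x * ρ (x - y)) (le_principal_iff.2 hbd)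
    exact ⟨a, ha⟩
  choose a ha using hlim
  have hnet : ∀ᶠ i in (𝓤 : Filter ι), ∀ y ∈ Y, |(∫ x, f i x * ρ (x - y)) - a y| < κ / 4 :=
    (eventually_all_finite hYf).2 fun y _ => Metric.tendsto_nhds.1 (ha y) _ (by positivity)
  refine ⟨_, (hi.and (hL.and (htr.and (htl.and hnet)))), ?_⟩
  rintro i ⟨hfi, hLi, htri, htli, hni⟩ j ⟨hfj, hLj, htrj, htlj, hnj⟩
  have main := integral_abs_le_of_mollified (f := fun x => f i x - f j x) (δ := δ) (R := R)
    (ε := ε / 4) (κ := κ) hρ.continuous hρi hρ0 hρ1 hρs (hfi.sub hfj) ((hm i).sub (hm j))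
    (fun ξ hξ => ?_) ?_ (fun x hx => ?_)
  · refine main.trans ?_
    have : κ * V ≤ ε / 2 := by
      rw [hκdef, div_mul_eq_mul_div, div_le_div_iff₀ (by positivity) (by positivity)]
      nlinarith
    linarith
  · have := integral_abs_le_add (f := fun x => f i (x + ξ) - f j (x + ξ) - (f i x - f j x))
      ((hfi.comp_add_right ξ).sub hfi).abs ((hfj.comp_add_right ξ).sub hfj).abs (fun x => by
        simp only [Pi.sub_apply]
        refine le_trans (le_of_eq ?_) (abs_sub _ _)
        congr 1; ring)
    refine this.trans ?_
    have a1 := htri ξ hξ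
    have a2 := htrj ξ hξ
    simp only [Pi.sub_apply]
    linarith
  · have := integral_abs_le_add (μ := volume.restrict {x | R < ‖x‖})
      (f := fun x => f i x - f j x)
      hfi.abs.integrableOn hfj.abs.integrableOn (fun x => abs_sub _ _)
    linarith
  · obtain ⟨y, hyY, hxy⟩ := mem_iUnion₂.1 (hY (mem_closedBall_zero_iff.2 hx))
    have hsh : ∀ k, Integrable (f k) → ∫ x, |f k x| ≤ L →
        |(∫ z, f k z * ρ (z - x)) - ∫ z, f k z * ρ (z - y)| ≤ κ / 4 := by
      intro k hfk hLk
      rw [← integral_sub (hmul k hfk x) (hmul k hfk y)]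
      refine abs_integral_le_integral_abs.trans ?_
      have s1 : ∫ z, |f k z * ρ (z - x) - f k z * ρ (z - y)|
          ≤ ∫ z, |f k z| * (κ / (4 * (L + 1))) := by
        refine integral_mono_of_nonneg (ae_of_all _ fun _ => abs_nonneg _) (hfk.abs.mul_const _)
          (ae_of_all _ fun z => ?_)
        simp only
        rw [← mul_sub, abs_mul]
        refine mul_le_mul_of_nonneg_left ?_ (abs_nonneg _)
        refine (huc (a := z - x) (b := z - y) ?_).le
        rw [dist_sub_left]
        exact hxy
      rw [integral_mul_const] at s1
      refine s1.trans ((mul_le_mul_of_nonneg_right hLk (by positivity)).trans ?_)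
      rw [mul_div_assoc', div_le_div_iff₀ (by positivity) (by positivity)]
      nlinarith
    have e : ∫ z, (f i z - f j z) * ρ (z - x)
        = (∫ z, f i z * ρ (z - x)) - ∫ z, f j z * ρ (z - x) := by
      rw [← integral_sub (hmul i hfi x) (hmul j hfj x)]
      congr 1; ext z; ring
    rw [e]
    have b1 := abs_le.1 (hsh i hfi hLi)
    have b2 := abs_le.1 (hsh j hfj hLj)
    have b3 := abs_lt.1 (hni y hyY)
    have b4 := abs_lt.1 (hnj y hyY)
    rw [abs_le]
    constructor <;> linarith [b1.1, b1.2, b2.1, b2.2, b3.1, b3.2, b4.1, b4.2]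

theorem eLpNorm_one_le_ofReal {α : Type*} [MeasurableSpace α] {μ : Measure α} {f : α → ℝ} {ε : ℝ}
    (hf : Integrable f μ) (h : ∫ x, |f x| ∂μ ≤ ε) : eLpNorm f 1 μ ≤ ENNReal.ofReal ε := by
  rw [eLpNorm_one_eq_lintegral_enorm, ← ofReal_integral_norm_eq_lintegral_enorm hf]
  exact ENNReal.ofReal_le_ofReal h

theorem integral_abs_le_of_eLpNorm {α : Type*} [MeasurableSpace α] {μ : Measure α} {f : α → ℝ}
    {ε : ℝ} (hε : 0 ≤ ε) (hf : Integrable f μ) (h : eLpNorm f 1 μ ≤ ENNReal.ofReal ε) :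
    ∫ x, |f x| ∂μ ≤ ε := by
  rw [eLpNorm_one_eq_lintegral_enorm, ← ofReal_integral_norm_eq_lintegral_enorm hf] at h
  exact (ENNReal.ofReal_le_ofReal_iff hε).1 h

/-- `u` is the limit of `w h` along `l`, in `L¹(ℝ^N)` uniformly on `[0,T]`. -/
structure IsUniformLimit (T : ℝ) (l : Filter ℝ) (w : ℝ → ℝ → Space N → ℝ)
    (u : ℝ → Space N → ℝ) : Prop where
  meas : Measurable fun p : ℝ × Space N => u p.1 p.2
  integrable : ∀ t ∈ Icc 0 T, Integrable (u t)
  close : ∀ ε > 0, ∀ᶠ h in l, ∀ t ∈ Icc 0 T, ∫ x, |w h t x - u t x| ≤ ε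

/-- Completeness, with a good representative: the limit must be jointly measurable and bounded
everywhere. It is built from one rapidly Cauchy sequence of parameters, the same for all times. -/
theorem exists_isUniformLimit (𝓤 : Ultrafilter ℝ) {w : ℝ → ℝ → Space N → ℝ} {M : ℝ} (hM : 0 ≤ M)
    (hm : ∀ h, Measurable fun p : ℝ × Space N => w h p.1 p.2)
    (hw : ∀ᶠ h in (𝓤 : Filter ℝ), ∀ t ∈ Icc 0 T, Integrable (w h t) ∧ ∀ x, |w h t x| ≤ M)
    (hc : ∀ ε > 0, ∃ A ∈ 𝓤, ∀ h ∈ A, ∀ h' ∈ A, ∀ t ∈ Icc 0 T,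
      ∫ x, |w h t x - w h' t x| ≤ ε) :
    ∃ u, (∀ t x, |u t x| ≤ M) ∧ IsUniformLimit T 𝓤 w u := by
  have hε : ∀ n : ℕ, (0 : ℝ) < (1 / 2) ^ n := fun n => by positivity
  choose A hA hAc using fun n : ℕ => hc ((1 / 2) ^ (n + 1)) (hε _)
  have hB : ∀ n : ℕ, ((⋂ k ∈ Iic n, A k) ∩
      {h | ∀ t ∈ Icc 0 T, Integrable (w h t) ∧ ∀ x, |w h t x| ≤ M}) ∈ (𝓤 : Filter ℝ) := fun n =>
    inter_mem ((biInter_mem (finite_Iic n)).2 fun k _ => hA k) hw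
  -- The $n$-th parameter lies in all of $A_0,\dots,A_n$, so the tail of the sequence from $k$ on
  -- stays in $A_k$.
  choose H hH using fun n => 𝓤.nonempty_of_mem (hB n)
  have hHA : ∀ k n, k ≤ n → H n ∈ A k := fun k n hkn => mem_iInter₂.1 (hH n).1 k hkn
  have hms : ∀ h t, Measurable (w h t) := fun h t =>
    Measurable.of_uncurry_left (f := w h) (hm h)
  -- The upper limit is measurable without any convergence, and the truncation to $[-M,M]$ makes the
  -- bound hold at every point. Where the sequence converges, neither changes the limit.
  set u : ℝ → Space N → ℝ := fun t x =>
    max (-M) (min M (limsup (fun n => w (H n) t x) atTop)) with hu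
  have hum : Measurable fun p : ℝ × Space N => u p.1 p.2 := by
    have := Measurable.limsup (f := fun n (p : ℝ × Space N) => w (H n) p.1 p.2) fun n => hm _
    exact measurable_const.max (measurable_const.min this)
  have hus : ∀ t, Measurable (u t) := fun t => Measurable.of_uncurry_left (f := u) hum
  have hub : ∀ t x, |u t x| ≤ M := fun t x => by
    rw [abs_le]
    exact ⟨le_max_left _ _, max_le (by linarith) (min_le_left _ _)⟩
  have hae : ∀ t ∈ Icc 0 T, ∀ᵐ x, Tendsto (fun n => w (H n) t x) atTop (𝓝 (u t x)) := by
    intro t ht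
    have h1 := Lp.ae_tendsto_of_cauchy_eLpNorm (μ := (volume : Measure (Space N))) (p := 1)
      (f := fun n => w (H n) t) (B := fun n => ENNReal.ofReal ((1 / 2) ^ n))
      (fun n => (hms _ t).aestronglyMeasurable) le_rfl
      (Summable.tsum_ofReal_ne_top summable_geometric_two) (fun k n m hn hm' => ?_)
    · filter_upwards [h1] with x ⟨a, ha⟩
      have hb : a ∈ Icc (-M) M := isClosed_Icc.mem_of_tendsto ha
        (Eventually.of_forall fun n => abs_le.1 (((hH n).2 t ht).2 x))
      have : u t x = a := by
        simp only [hu]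
        rw [ha.limsup_eq, min_eq_right hb.2, max_eq_right hb.1]
      rwa [this]
    · refine (eLpNorm_one_le_ofReal (((hH n).2 t ht).1.sub ((hH m).2 t ht).1)
        (hAc k _ (hHA k n hn) _ (hHA k m hm') t ht)).trans_lt ?_
      rw [ENNReal.ofReal_lt_ofReal_iff (hε k), pow_succ]
      linarith [hε k]
  have hcl : ∀ k, ∀ t ∈ Icc 0 T, ∀ h ∈ A k, Integrable (w h t) →
      eLpNorm (w h t - u t) 1 volume ≤ ENNReal.ofReal ((1 / 2) ^ (k + 1)) := by
    intro k t ht h hh hi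
    -- Fatou's lemma carries the Cauchy estimate on $A_k$ over to the distance from the limit.
    have h1 := Lp.eLpNorm_lim_le_liminf_eLpNorm (p := 1) (μ := (volume : Measure (Space N)))
      (f := fun n => w h t - w (H n) t)
      (fun n => ((hms _ _).sub (hms _ _)).aestronglyMeasurable) (w h t - u t) (by
        filter_upwards [hae t ht] with x hx
        exact tendsto_const_nhds.sub hx)
    refine h1.trans (liminf_le_of_frequently_le' (Eventually.frequently ?_))
    filter_upwards [eventually_ge_atTop k] with n hn
    exact eLpNorm_one_le_ofReal (hi.sub ((hH n).2 t ht).1) (hAc k _ hh _ (hHA k n hn) t ht)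
  have hui : ∀ t ∈ Icc 0 T, Integrable (u t) := by
    intro t ht
    have h1 := hcl 0 t ht (H 0) (hHA 0 0 le_rfl) ((hH 0).2 t ht).1
    have h2 : Integrable (w (H 0) t - u t) := by
      rw [← memLp_one_iff_integrable]
      exact ⟨((hms _ _).sub (hus t)).aestronglyMeasurable, h1.trans_lt ENNReal.ofReal_lt_top⟩
    have := ((hH 0).2 t ht).1.sub h2
    rwa [sub_sub_cancel] at this
  refine ⟨u, hub, hum, hui, fun ε hε' => ?_⟩
  obtain ⟨k, hk⟩ := exists_pow_lt_of_lt_one hε' (show (1 / 2 : ℝ) < 1 by norm_num)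
  filter_upwards [hA k, hw] with h hh hw t ht
  refine le_trans (integral_abs_le_of_eLpNorm (hε _).le ((hw t ht).1.sub (hui t ht))
    (hcl k t ht h hh (hw t ht).1)) ?_
  rw [pow_succ]
  linarith [hε k]

namespace SchemeData

variable {γ : ℝ} {φ : ℝ → ℝ} {u₀ : Space N → ℝ} {g : ℝ → Space N → ℝ}
  {S : ℝ → Stencil N} {G : ℝ → TimeGrid T} {U : ℝ → ℕ → Idx N → ℝ}
variable (D : SchemeData γ φ u₀ g S G U)
include D

/-- Arzelà–Ascoli: the compactness criterion is used at a finite net of times, and equicontinuity in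
time extends the Cauchy property to all of $[0,T]$ with three errors of $\varepsilon/3$. -/
theorem exists_mem_interpolant_sub_le (𝓤 : Ultrafilter ℝ) (h𝓤 : (𝓤 : Filter ℝ) ≤ 𝓝[>] 0) {ε : ℝ}
    (hε : 0 < ε) : ∃ A ∈ 𝓤, ∀ h ∈ A, ∀ h' ∈ A, ∀ t ∈ Icc 0 T,
      ∫ x, |interpolant h (G h) (U h) t x - interpolant h' (G h') (U h') t x| ≤ ε := by
  obtain ⟨L, hL, hLb⟩ := D.exists_interpolant_L1_bound
  have hpos : ∀ᶠ h in (𝓤 : Filter ℝ), 0 < h := h𝓤 self_mem_nhdsWithin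
  have hslice : ∀ t ∈ Icc 0 T, ∃ A ∈ 𝓤, ∀ h ∈ A, ∀ h' ∈ A,
      ∫ x, |interpolant h (G h) (U h) t x - interpolant h' (G h') (U h') t x| ≤ ε / 3 := by
    intro t ht
    refine exists_mem_integral_sub_le 𝓤 (L := L) (fun h => measurable_interpolant_slice _ _ _ t)
      (hpos.mono fun h hh => D.integrable_interpolant hh ht)
      ((hLb.filter_mono h𝓤).mono fun h hh => hh t ht) (fun ε hε => ?_) (fun ε hε => ?_)
      (by positivity)
    · obtain ⟨δ, hδ, hb⟩ := D.exists_interpolant_translate_le hε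
      exact ⟨δ, hδ, (hb.filter_mono h𝓤).mono fun h hh ξ hξ => hh ξ hξ t ht⟩
    · obtain ⟨R, hR, hb⟩ := D.exists_interpolant_tail_le hε
      exact ⟨R, hR, (hb.filter_mono h𝓤).mono fun h hh => hh t ht⟩
  obtain ⟨η, hη, hb⟩ := D.exists_interpolant_time_le (show 0 < ε / 3 by positivity)
  obtain ⟨Y, hYs, hYf, hY⟩ := (isCompact_Icc (a := (0 : ℝ)) (b := T)).finite_cover_balls hη
  have hall : ∃ A ∈ 𝓤, ∀ h ∈ A, ∀ h' ∈ A, ∀ t ∈ Y,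
      ∫ x, |interpolant h (G h) (U h) t x - interpolant h' (G h') (U h') t x| ≤ ε / 3 := by
    choose! A hA hAb using hslice
    refine ⟨⋂ t ∈ Y, A t, (biInter_mem hYf).2 fun t ht => hA t (hYs ht), ?_⟩
    intro h hh h' hh' t ht
    exact hAb t (hYs ht) h (mem_iInter₂.1 hh t ht) h' (mem_iInter₂.1 hh' t ht)
  obtain ⟨A, hA, hAb⟩ := hall
  refine ⟨A ∩ _, inter_mem hA (hpos.and (hb.filter_mono h𝓤)), ?_⟩
  rintro h ⟨hA1, hp1, hb1⟩ h' ⟨hA2, hp2, hb2⟩ t ht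
  obtain ⟨s, hs, hts⟩ := mem_iUnion₂.1 (hY ht)
  have hts' : |t - s| ≤ η := (Metric.mem_ball.1 hts).le
  have c1 := hb1 s (hYs hs) t ht hts'
  have c2 := hb2 s (hYs hs) t ht hts'
  have c3 := hAb h hA1 h' hA2 s hs
  have I1 := D.integrable_interpolant hp1 ht
  have I1' := D.integrable_interpolant hp1 (hYs hs)
  have I2 := D.integrable_interpolant hp2 ht
  have I2' := D.integrable_interpolant hp2 (hYs hs)
  have := integral_abs_le_add₃
    (f := fun x => interpolant h (G h) (U h) t x - interpolant h' (G h') (U h') t x)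
    (I1.sub I1').abs (I1'.sub I2').abs (I2.sub I2').abs (fun x => by
      simp only [Pi.sub_apply]
      have e : interpolant h (G h) (U h) t x - interpolant h' (G h') (U h') t x
        = (interpolant h (G h) (U h) t x - interpolant h (G h) (U h) s x)
          + (interpolant h (G h) (U h) s x - interpolant h' (G h') (U h') s x)
          - (interpolant h' (G h') (U h') t x - interpolant h' (G h') (U h') s x) := by ring
      rw [e]
      exact (abs_sub _ _).trans (add_le_add_left (abs_add_le _ _) _))
  simp only [Pi.sub_apply] at this
  linarith

theorem exists_limit (𝓤 : Ultrafilter ℝ) (h𝓤 : (𝓤 : Filter ℝ) ≤ 𝓝[>] 0) :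
    ∃ u : ℝ → Space N → ℝ, (∃ M, 0 ≤ M ∧ ∀ t x, |u t x| ≤ M) ∧
      IsUniformLimit T 𝓤 (fun h => interpolant h (G h) (U h)) u := by
  obtain ⟨M, hM, hU⟩ := D.bdd
  obtain ⟨u, hu, hl⟩ := exists_isUniformLimit 𝓤 (T := T)
    (w := fun h => interpolant h (G h) (U h)) hM
    (fun h => measurable_interpolant _ _ _)
    (Eventually.mono (h𝓤 self_mem_nhdsWithin) fun h hh t ht =>
      ⟨D.integrable_interpolant hh ht, D.abs_interpolant_le (hU h hh) ht⟩)
    (fun ε hε => D.exists_mem_interpolant_sub_le 𝓤 h𝓤 hε)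
  exact ⟨u, ⟨M, hM, hu⟩, hl⟩

/-- The modulus of continuity in time passes to the limit. -/
theorem exists_limit_time_le {𝓤 : Ultrafilter ℝ} (h𝓤 : (𝓤 : Filter ℝ) ≤ 𝓝[>] 0)
    {u : ℝ → Space N → ℝ}
    (hu : IsUniformLimit T 𝓤 (fun h => interpolant h (G h) (U h)) u) {ε : ℝ} (hε : 0 < ε) :
    ∃ η > 0, ∀ s ∈ Icc 0 T, ∀ t ∈ Icc 0 T, |t - s| ≤ η → ∫ x, |u t x - u s x| ≤ ε := by
  obtain ⟨η, hη, hb⟩ := D.exists_interpolant_time_le (show 0 < ε / 3 by positivity)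
  obtain ⟨h, hp, h1, h2⟩ := (Eventually.and (h𝓤 self_mem_nhdsWithin : ∀ᶠ h : ℝ in (𝓤 : Filter ℝ), 0 < h)
    ((hb.filter_mono h𝓤).and (hu.close (ε / 3) (by positivity)))).exists
  refine ⟨η, hη, fun s hs t ht hts => ?_⟩
  have c1 := h1 s hs t ht hts
  have I1 := D.integrable_interpolant hp ht
  have I2 := D.integrable_interpolant hp hs
  have := integral_abs_le_add₃ (f := fun x => u t x - u s x)
    (I1.sub (hu.integrable t ht)).abs (I1.sub I2).abs (I2.sub (hu.integrable s hs)).abs (fun x => by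
      simp only [Pi.sub_apply]
      have e : u t x - u s x
        = (interpolant h (G h) (U h) t x - interpolant h (G h) (U h) s x)
          - (interpolant h (G h) (U h) t x - u t x)
          + (interpolant h (G h) (U h) s x - u s x) := by ring
      rw [e]
      refine (abs_add_le _ _).trans (add_le_add_left ((abs_sub _ _).trans (le_of_eq ?_)) _)
      ring)
  simp only [Pi.sub_apply] at this
  linarith [h2 s hs, h2 t ht]

end SchemeData

/-! ### From `L¹` to `L^r` -/

/-- Interpolation between $L^1$ and $L^\infty$, from $|f|^r\le B^{r-1}|f|$. -/
theorem eLpNorm_le_rpow_eLpNorm_one {r : ENNReal} (hr : 1 ≤ r) (hr' : r ≠ ⊤) {B : ℝ}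
    {f : Space N → ℝ} (hb : ∀ x, |f x| ≤ B) :
    eLpNorm f r volume ≤ (ENNReal.ofReal B ^ (r.toReal - 1) * eLpNorm f 1 volume) ^
      (1 / r.toReal) := by
  have hρ : 1 ≤ r.toReal := by
    rw [← ENNReal.toReal_one]
    exact ENNReal.toReal_mono hr' hr
  rw [eLpNorm_eq_lintegral_rpow_enorm_toReal (by positivity) hr', eLpNorm_one_eq_lintegral_enorm]
  refine ENNReal.rpow_le_rpow ?_ (by positivity)
  rw [← lintegral_const_mul' _ _ (ENNReal.rpow_ne_top_of_nonneg (by linarith)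
    ENNReal.ofReal_ne_top)]
  refine lintegral_mono fun x => ?_
  have e : ‖f x‖ₑ ^ r.toReal = ‖f x‖ₑ ^ (r.toReal - 1) * ‖f x‖ₑ := by
    have := ENNReal.rpow_add_of_nonneg (x := ‖f x‖ₑ) (r.toReal - 1) 1 (by linarith) zero_le_one
    rwa [sub_add_cancel, ENNReal.rpow_one] at this
  rw [e]
  refine mul_le_mul_left (ENNReal.rpow_le_rpow ?_ (by linarith)) _
  rw [Real.enorm_eq_ofReal_abs]
  exact ENNReal.ofReal_le_ofReal (hb x)

theorem exists_eLpNorm_le {r : ENNReal} (hr : 1 ≤ r) (hr' : r ≠ ⊤) (B : ℝ)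
    {ε : ENNReal} (hε : 0 < ε) : ∃ δ > 0, ∀ f : Space N → ℝ, Integrable f → (∀ x, |f x| ≤ B) →
      ∫ x, |f x| ≤ δ → eLpNorm f r volume ≤ ε := by
  have hρ : 1 ≤ r.toReal := by
    rw [← ENNReal.toReal_one]
    exact ENNReal.toReal_mono hr' hr
  have hb : ENNReal.ofReal B ^ (r.toReal - 1) ≠ ⊤ :=
    ENNReal.rpow_ne_top_of_nonneg (by linarith) ENNReal.ofReal_ne_top
  have h1 : Tendsto (fun δ : ℝ => (ENNReal.ofReal B ^ (r.toReal - 1) * ENNReal.ofReal δ) ^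
      (1 / r.toReal)) (𝓝[>] 0) (𝓝 0) := by
    have h2 : Tendsto (fun δ : ℝ => ENNReal.ofReal B ^ (r.toReal - 1) * ENNReal.ofReal δ)
        (𝓝[>] 0) (𝓝 (ENNReal.ofReal B ^ (r.toReal - 1) * ENNReal.ofReal 0)) :=
      ENNReal.Tendsto.const_mul
        ((ENNReal.continuous_ofReal.tendsto 0).mono_left nhdsWithin_le_nhds) (Or.inr hb)
    have h3 := (ENNReal.continuous_rpow_const (y := 1 / r.toReal)).tendsto
      (ENNReal.ofReal B ^ (r.toReal - 1) * ENNReal.ofReal 0)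
    have h4 := h3.comp h2
    rwa [ENNReal.ofReal_zero, mul_zero, ENNReal.zero_rpow_of_pos (by positivity)] at h4
  obtain ⟨δ, hδ, hδ0⟩ := ((h1.eventually_lt_const hε).and self_mem_nhdsWithin).exists
  refine ⟨δ, hδ0, fun f hf hfb hfi => (eLpNorm_le_rpow_eLpNorm_one hr hr' hfb).trans ?_⟩
  refine le_trans (ENNReal.rpow_le_rpow ?_ (by positivity)) hδ.le
  exact mul_le_mul_right (eLpNorm_one_le_ofReal hf hfi) _

theorem memLp_of_integrable_of_bdd {r : ENNReal} (hr : 1 ≤ r) (hr' : r ≠ ⊤) {B : ℝ}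
    {f : Space N → ℝ} (hf : Integrable f) (hb : ∀ x, |f x| ≤ B) : MemLp f r volume := by
  have hρ : 1 ≤ r.toReal := by
    rw [← ENNReal.toReal_one]
    exact ENNReal.toReal_mono hr' hr
  refine ⟨hf.1, (eLpNorm_le_rpow_eLpNorm_one hr hr' hb).trans_lt ?_⟩
  refine ENNReal.rpow_lt_top_of_nonneg (by positivity) (ENNReal.mul_ne_top
    (ENNReal.rpow_ne_top_of_nonneg (by linarith) ENNReal.ofReal_ne_top) ?_)
  exact (memLp_one_iff_integrable.2 hf).2.ne

theorem memCtLp_of_tendsto {r : ENNReal} (hr : 1 ≤ r) (hr' : r ≠ ⊤) {B : ℝ}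
    {u : ℝ → Space N → ℝ} (hi : ∀ t ∈ Icc 0 T, Integrable (u t))
    (hb : ∀ t ∈ Icc 0 T, ∀ x, |u t x| ≤ B)
    (hc : ∀ t ∈ Icc 0 T, Tendsto (fun s => ∫ x, |u s x - u t x|) (𝓝[Icc 0 T] t) (𝓝 0)) :
    MemCtLp T r u := by
  refine ⟨fun t ht => memLp_of_integrable_of_bdd hr hr' (hi t ht) (hb t ht), fun t ht => ?_⟩
  refine ENNReal.tendsto_nhds_zero.2 fun ε hε => ?_
  obtain ⟨δ, hδ, hδb⟩ := exists_eLpNorm_le (N := N) hr hr' (B + B) hε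
  filter_upwards [(hc t ht).eventually_lt_const hδ, self_mem_nhdsWithin] with s hs hsT
  exact hδb _ ((hi s hsT).sub (hi t ht))
    (fun x => (abs_sub _ _).trans (add_le_add (hb s hsT x) (hb t ht x))) hs.le

theorem IsUniformLimit.tendsto_distCtLp {r : ENNReal} (hr : 1 ≤ r) (hr' : r ≠ ⊤) {l : Filter ℝ}
    {w : ℝ → ℝ → Space N → ℝ} {u : ℝ → Space N → ℝ} {B B' : ℝ} (hu : IsUniformLimit T l w u)
    (hub : ∀ t x, |u t x| ≤ B')
    (hw : ∀ᶠ h in l, ∀ t ∈ Icc 0 T, Integrable (w h t) ∧ ∀ x, |w h t x| ≤ B) :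
    Tendsto (fun h => distCtLp T r (w h) u) l (𝓝 0) := by
  refine ENNReal.tendsto_nhds_zero.2 fun ε hε => ?_
  obtain ⟨δ, hδ, hδb⟩ := exists_eLpNorm_le (N := N) hr hr' (B + B') hε
  filter_upwards [hu.close δ hδ, hw] with h hc hw
  refine iSup₂_le fun t ht => ?_
  exact hδb _ ((hw t ht).1.sub (hu.integrable t ht))
    (fun x => (abs_sub _ _).trans (add_le_add ((hw t ht).2 x) (hub t x))) (hc t ht)

namespace SchemeData

variable {γ : ℝ} {φ : ℝ → ℝ} {u₀ : Space N → ℝ} {g : ℝ → Space N → ℝ}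
  {S : ℝ → Stencil N} {G : ℝ → TimeGrid T} {U : ℝ → ℕ → Idx N → ℝ}
variable (D : SchemeData γ φ u₀ g S G U)
include D

/-- For a fixed $h$ the interpolant is a finite combination of integrable functions with continuous
time coefficients; no estimate uniform in $h$ is involved. -/
theorem memCtLp_interpolant {r : ENNReal} (hr : 1 ≤ r) (hr' : r ≠ ⊤) {h : ℝ} (hh : 0 < h) :
    MemCtLp T r (interpolant h (G h) (U h)) := by
  obtain ⟨M, hM, hU⟩ := D.bdd
  refine memCtLp_of_tendsto hr hr' (B := M) (fun t ht => D.integrable_interpolant hh ht)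
    (fun t ht => D.abs_interpolant_le (hU h hh) ht) fun t ht => ?_
  set d : ℕ → Space N → ℝ := fun j x => spaceInterp h (U h (j + 1)) x - spaceInterp h (U h j) x
  have hd : ∀ j < (G h).J, Integrable (d j) := fun j hj =>
    (D.integrable hh hj).sub (D.integrable hh hj.le)
  have hlim : Tendsto (fun s => ∑ j ∈ Finset.range (G h).J,
      |(G h).clamp j s - (G h).clamp j t| * ∫ x, |d j x|) (𝓝[Icc 0 T] t) (𝓝 0) := by
    have hc : Continuous fun s => ∑ j ∈ Finset.range (G h).J,
        |(G h).clamp j s - (G h).clamp j t| * ∫ x, |d j x| :=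
      continuous_finsetSum _ fun j _ =>
        (((G h).continuous_clamp j).sub continuous_const).abs.mul continuous_const
    have := (hc.tendsto t).mono_left (nhdsWithin_le_nhds (s := Icc 0 T))
    simpa using this
  refine squeeze_zero' (Eventually.of_forall fun s => integral_nonneg fun x => abs_nonneg _) ?_ hlim
  filter_upwards [self_mem_nhdsWithin] with s hs
  have I : ∀ j ∈ Finset.range (G h).J, Integrable fun x =>
      |(G h).clamp j s - (G h).clamp j t| * |d j x| := fun j hj =>
    (hd j (Finset.mem_range.1 hj)).abs.const_mul _
  simp_rw [← integral_const_mul]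
  rw [← integral_finsetSum _ I]
  refine integral_mono_of_nonneg (ae_of_all _ fun _ => abs_nonneg _) (integrable_finsetSum _ I)
    (ae_of_all _ fun x => ?_)
  simp only
  rw [interpolant_eq_sum_clamp h _ _ D.pos_time hs, interpolant_eq_sum_clamp h _ _ D.pos_time ht,
    add_sub_add_left_eq_sub, ← Finset.sum_sub_distrib]
  refine (Finset.abs_sum_le_sum_abs _ _).trans (Finset.sum_le_sum fun j _ => ?_)
  rw [← sub_mul, abs_mul]

theorem memCtLp_limit {r : ENNReal} (hr : 1 ≤ r) (hr' : r ≠ ⊤) {𝓤 : Ultrafilter ℝ}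
    (h𝓤 : (𝓤 : Filter ℝ) ≤ 𝓝[>] 0) {u : ℝ → Space N → ℝ} {M : ℝ} (hM : ∀ t x, |u t x| ≤ M)
    (hu : IsUniformLimit T 𝓤 (fun h => interpolant h (G h) (U h)) u) : MemCtLp T r u := by
  refine memCtLp_of_tendsto hr hr' (B := M) hu.integrable (fun t _ => hM t) fun t ht => ?_
  refine Metric.tendsto_nhds.2 fun ε hε => ?_
  obtain ⟨η, hη, hb⟩ := D.exists_limit_time_le h𝓤 hu (show 0 < ε / 2 by positivity)
  filter_upwards [self_mem_nhdsWithin, nhdsWithin_le_nhds (Metric.closedBall_mem_nhds t hη)]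
    with s hs hst
  rw [Real.dist_0_eq_abs, abs_of_nonneg (integral_nonneg fun _ => abs_nonneg _)]
  linarith [hb t ht s hs (Metric.mem_closedBall.1 hst)]

end SchemeData

end GPME

namespace GPME

variable {N : ℕ} {T : ℝ}

/-! ### The operators on test functions -/

/-- The density equal to $|z|^2$ on the unit ball and $1$ outside has finite integral and is
positive off the origin. Hence the restricted measure is a finite measure with density its inverse.
This is needed to integrate out $z$ measurably in the Lévy operator. -/
theorem IsSymmLevyMeasure.sFinite_restrict {μ : Measure (Space N)} (hμ : IsSymmLevyMeasure μ) :
    SFinite (μ.restrict {z | z ≠ 0}) := by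
  set f : Space N → ENNReal := fun z => if ‖z‖ ≤ 1 then ENNReal.ofReal (‖z‖ ^ 2) else 1 with hf
  have hfm : Measurable f := Measurable.ite (measurableSet_le measurable_norm measurable_const)
    (by fun_prop) measurable_const
  have hfin : ∫⁻ z in {z | z ≠ 0}, f z ∂μ ≠ ⊤ := by
    have hsub : {z : Space N | z ≠ 0} ⊆ {z | 0 < ‖z‖ ∧ ‖z‖ ≤ 1} ∪ {z | 1 < ‖z‖} := by
      intro z hz
      rcases le_or_gt ‖z‖ 1 with h | h
      · exact Or.inl ⟨norm_pos_iff.2 hz, h⟩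
      · exact Or.inr h
    refine ne_top_of_le_ne_top hμ.levy.ne ((lintegral_mono_set hsub).trans
      ((lintegral_union_le _ _ _).trans (add_le_add ?_ ?_)))
    · refine (setLIntegral_congr_fun ?_ fun z hz => ?_).le
      · exact (measurableSet_lt measurable_const measurable_norm).inter
          (measurableSet_le measurable_norm measurable_const)
      · simp only [hf]
        rw [if_pos hz.2]
    · refine (setLIntegral_congr_fun (g := fun _ => 1) ?_ fun z hz => ?_).le.trans (by simp)
      · exact measurableSet_lt measurable_const measurable_norm
      · simp only [hf]
        rw [if_neg (not_le.2 hz)]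
  have := isFiniteMeasure_withDensity hfin
  rw [← withDensity_inv_same (μ := μ.restrict {z | z ≠ 0}) hfm]
  · infer_instance
  · filter_upwards [ae_restrict_mem (measurableSet_singleton (0 : Space N)).compl] with z hz
    simp only [hf]
    have hz' : 0 < ‖z‖ := norm_pos_iff.2 hz
    split_ifs
    · exact (ENNReal.ofReal_pos.2 (by positivity)).ne'
    · exact one_ne_zero
  · refine ae_of_all _ fun z => ?_
    simp only [hf]
    split_ifs <;> simp

theorem slice_eq_comp (ψ : ℝ × Space N → ℝ) (t : ℝ) :
    (fun y => ψ (t, y))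
      = (fun q => ψ ((t, 0) + q)) ∘ (ContinuousLinearMap.inr ℝ ℝ (Space N)) := by
  funext y; simp

theorem contDiff_slice {ψ : ℝ × Space N → ℝ} (hψ : ContDiff ℝ ∞ ψ) (t : ℝ) :
    ContDiff ℝ ∞ fun y => ψ (t, y) :=
  hψ.comp (contDiff_prodMk_right t)

theorem contDiff_slice_time {ψ : ℝ × Space N → ℝ} (hψ : ContDiff ℝ ∞ ψ) (x : Space N) :
    ContDiff ℝ ∞ fun s => ψ (s, x) :=
  hψ.comp (contDiff_prodMk_left x)

/-- The Laplacian of a slice is a sum of second derivatives of the space-time function in spatial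
directions, hence jointly continuous. -/
theorem continuous_laplacian_slice {ψ : ℝ × Space N → ℝ} (hψ : ContDiff ℝ ∞ ψ) :
    Continuous fun p : ℝ × Space N => Laplacian.laplacian (fun y => ψ (p.1, y)) p.2 := by
  have e : ∀ p : ℝ × Space N, Laplacian.laplacian (fun y => ψ (p.1, y)) p.2
      = ∑ i, iteratedFDeriv ℝ 2 ψ p (fun k => ContinuousLinearMap.inr ℝ ℝ (Space N)
          (![stdOrthonormalBasis ℝ (Space N) i, stdOrthonormalBasis ℝ (Space N) i] k)) := by
    intro p
    rw [InnerProductSpace.laplacian_eq_iteratedFDeriv_stdOrthonormalBasis]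
    refine Finset.sum_congr rfl fun i _ => ?_
    have hs : ContDiff ℝ ∞ fun q : ℝ × Space N => ψ ((p.1, 0) + q) :=
      hψ.comp (contDiff_const.add contDiff_id)
    rw [slice_eq_comp, ContinuousLinearMap.iteratedFDeriv_comp_right _ hs _
      (WithTop.coe_le_coe.2 le_top), iteratedFDeriv_comp_add_left]
    simp only [ContinuousLinearMap.inr_apply, Prod.mk_add_mk, add_zero, zero_add]
    rfl
  simp_rw [e]
  refine continuous_finsetSum _ fun i _ => ?_
  have hc : Continuous fun p => iteratedFDeriv ℝ 2 ψ p :=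
    hψ.continuous_iteratedFDeriv (m := 2) (WithTop.coe_le_coe.2 le_top)
  exact (ContinuousMultilinearMap.apply ℝ (fun _ : Fin 2 => ℝ × Space N) ℝ
    (fun k => ContinuousLinearMap.inr ℝ ℝ (Space N)
      (![stdOrthonormalBasis ℝ (Space N) i, stdOrthonormalBasis ℝ (Space N) i] k))).continuous.comp
    hc

theorem fderiv_slice {ψ : ℝ × Space N → ℝ} (hψ : ContDiff ℝ ∞ ψ) (t : ℝ) (x z : Space N) :
    fderiv ℝ (fun y => ψ (t, y)) x z = fderiv ℝ ψ (t, x) (0, z) := by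
  have h1 : HasFDerivAt ψ (fderiv ℝ ψ (t, x)) (t, x) :=
    (hψ.differentiable (by simp) _).hasFDerivAt
  have h2 := h1.comp x (hasFDerivAt_prodMk_right t x)
  have h3 := h2.fderiv
  change fderiv ℝ (fun y => ψ (t, y)) x = _ at h3
  rw [h3]
  simp

theorem measurable_levyOp_slice {μ : Measure (Space N)} (hμ : IsSymmLevyMeasure μ)
    {ψ : ℝ × Space N → ℝ} (hψ : ContDiff ℝ ∞ ψ) :
    Measurable fun p : ℝ × Space N => levyOp μ (fun y => ψ (p.1, y)) p.2 := by
  have := hμ.sFinite_restrict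
  unfold levyOp
  refine StronglyMeasurable.measurable (StronglyMeasurable.integral_prod_right'
    (f := fun q : (ℝ × Space N) × Space N => ψ (q.1.1, q.1.2 + q.2) - ψ (q.1.1, q.1.2)
      - if ‖q.2‖ ≤ 1 then fderiv ℝ (fun y => ψ (q.1.1, y)) q.1.2 q.2 else 0) ?_)
  refine Measurable.stronglyMeasurable (Measurable.sub ?_ ?_)
  · have hc := hψ.continuous
    exact (by fun_prop : Continuous fun q : (ℝ × Space N) × Space N =>
      ψ (q.1.1, q.1.2 + q.2) - ψ (q.1.1, q.1.2)).measurable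
  · refine Measurable.ite (measurableSet_le measurable_snd.norm measurable_const) ?_
      measurable_const
    simp_rw [fderiv_slice hψ]
    have hc : Continuous (fderiv ℝ ψ) := hψ.continuous_fderiv (by simp)
    exact (by fun_prop : Continuous fun q : (ℝ × Space N) × Space N =>
      fderiv ℝ ψ (q.1.1, q.1.2) (0, q.2)).measurable

theorem measurable_diffusionOp_slice {μ : Measure (Space N)} (hμ : IsSymmLevyMeasure μ) (c : ℝ)
    {ψ : ℝ × Space N → ℝ} (hψ : ContDiff ℝ ∞ ψ) :
    Measurable fun p : ℝ × Space N => diffusionOp c μ (fun y => ψ (p.1, y)) p.2 :=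
  ((continuous_laplacian_slice hψ).measurable.const_mul c).add (measurable_levyOp_slice hμ hψ)

/-- Uniform bounds of a test function and of its slices. -/
theorem exists_test_bounds {ψ : ℝ × Space N → ℝ} (hψ : ContDiff ℝ ∞ ψ) (hc : HasCompactSupport ψ) :
    ∃ A ρ, 0 ≤ A ∧ (∀ p, |ψ p| ≤ A) ∧ (∀ p : ℝ × Space N, |deriv (fun s => ψ (s, p.2)) p.1| ≤ A) ∧
      (∀ t x, ρ < ‖x‖ → ψ (t, x) = 0) ∧
      ∀ t x z, |secondDiff (fun y => ψ (t, y)) x z| ≤ A * ‖z‖ ^ 2 := by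
  obtain ⟨A₀, hA₀, h2⟩ := exists_secondDiff_le hψ hc
  obtain ⟨B, hB⟩ := hψ.continuous.bounded_above_of_compact_support hc
  obtain ⟨B', hB'⟩ := (hψ.continuous_fderiv (by simp)).bounded_above_of_compact_support
    (hc.fderiv ℝ)
  obtain ⟨ρ, hρ⟩ := hc.isCompact.isBounded.exists_norm_le
  refine ⟨max A₀ (max B B'), ρ, le_max_of_le_left hA₀, fun p => (hB p).trans (by simp),
    fun p => ?_, fun t x hx => ?_, fun t x z => ?_⟩
  · have h1 : HasFDerivAt ψ (fderiv ℝ ψ (p.1, p.2)) (p.1, p.2) :=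
      (hψ.differentiable (by simp) _).hasFDerivAt
    have h3 : deriv (fun s => ψ (s, p.2)) p.1 = fderiv ℝ ψ p (1, 0) := by
      have h4 := (h1.comp p.1 (hasFDerivAt_prodMk_left p.1 p.2)).hasDerivAt.deriv
      change deriv (fun s => ψ (s, p.2)) p.1 = _ at h4
      rw [h4]; simp
    rw [h3]
    refine ((fderiv ℝ ψ p).le_opNorm _).trans ?_
    have : ‖((1 : ℝ), (0 : Space N))‖ = 1 := by simp [Prod.norm_def]
    rw [this, mul_one]
    exact (hB' p).trans (by simp)
  · by_contra hne
    have h1 := hρ (t, x) (subset_tsupport _ hne)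
    exact absurd ((le_max_right _ _).trans h1 : ‖x‖ ≤ ρ) (not_le.2 hx)
  · have h1 := h2 (t, x) (0, z)
    have e : ‖((0 : ℝ), z)‖ = ‖z‖ := by simp [Prod.norm_def]
    rw [e] at h1
    have e2 : secondDiff (fun y => ψ (t, y)) x z = secondDiff ψ (t, x) (0, z) := by
      simp [secondDiff]
    rw [e2]
    exact h1.trans (mul_le_mul_of_nonneg_right (le_max_left _ _) (by positivity))

theorem continuous_deriv_time {ψ : ℝ × Space N → ℝ} (hψ : ContDiff ℝ ∞ ψ) :
    Continuous fun p : ℝ × Space N => deriv (fun s => ψ (s, p.2)) p.1 := by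
  have h3 : ∀ p : ℝ × Space N, deriv (fun s => ψ (s, p.2)) p.1 = fderiv ℝ ψ p (1, 0) := by
    intro p
    have h1 : HasFDerivAt ψ (fderiv ℝ ψ (p.1, p.2)) (p.1, p.2) :=
      (hψ.differentiable (by simp) _).hasFDerivAt
    have h4 := (h1.comp p.1 (hasFDerivAt_prodMk_left p.1 p.2)).hasDerivAt.deriv
    change deriv (fun s => ψ (s, p.2)) p.1 = _ at h4
    rw [h4]; simp
  simp_rw [h3]
  have hc : Continuous (fderiv ℝ ψ) := hψ.continuous_fderiv (by simp)
  fun_prop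

theorem hasCompactSupport_slice {ψ : ℝ × Space N → ℝ} {ρ : ℝ} (hs : ∀ t x, ρ < ‖x‖ → ψ (t, x) = 0)
    (t : ℝ) : HasCompactSupport fun y => ψ (t, y) :=
  HasCompactSupport.of_support_subset_isCompact (isCompact_closedBall (0 : Space N) ρ) fun x hx => by
    rw [mem_closedBall_zero_iff]
    by_contra h
    exact hx (hs t x (not_le.1 h))

/-- Consistency for space-time test functions. -/
theorem tendsto_lintegral_op_sub {c : ℝ} {μ : Measure (Space N)} (hμ : IsSymmLevyMeasure μ)
    {S : ℝ → Stencil N} (hcons : Consistent c μ S) {K : ℝ}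
    (hK : ∀ h ∈ Ioo (0 : ℝ) 1, (S h).trunc h 1 ≤ K)
    {ψ : ℝ × Space N → ℝ} (hψ : ContDiff ℝ ∞ ψ) (hc : HasCompactSupport ψ) :
    Tendsto (fun h => ∫⁻ p in cylinder N T, ‖(S h).op h (fun y => ψ (p.1, y)) p.2
      - diffusionOp c μ (fun y => ψ (p.1, y)) p.2‖ₑ) (𝓝[>] 0) (𝓝 0) := by
  obtain ⟨A, ρ, hA, hb, -, hs, h2⟩ := exists_test_bounds hψ hc
  set E := 4 * A * volume.real (Metric.closedBall (0 : Space N) (ρ + 1)) * K with hE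
  have hcs := hasCompactSupport_slice hs
  have hmop : ∀ h, Measurable fun p : ℝ × Space N => (S h).op h (fun y => ψ (p.1, y)) p.2 :=
    fun h => (S h).measurable_op_prod h hψ.continuous.measurable
  have hmd := measurable_diffusionOp_slice hμ c hψ
  have hmd' : ∀ t, Measurable (diffusionOp c μ fun y => ψ (t, y)) := fun t =>
    Measurable.of_uncurry_left (f := fun t => diffusionOp c μ fun y => ψ (t, y)) hmd
  have hmop' : ∀ h t, Measurable ((S h).op h fun y => ψ (t, y)) := fun h t =>
    (S h).measurable_op h (contDiff_slice hψ t).continuous.measurable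
  have hopE : ∀ h ∈ Ioo (0 : ℝ) 1, ∀ t,
      eLpNorm ((S h).op h fun y => ψ (t, y)) 1 volume ≤ ENNReal.ofReal E := by
    intro h hh t
    have hct := (contDiff_slice hψ t).continuous
    have hit := hct.integrable_of_hasCompactSupport (μ := volume) (hcs t)
    exact eLpNorm_one_le_ofReal ((S h).integrable_op h hct.measurable hit)
      ((S h).op_bounds hct hA (fun x => hb _) (hs t) (h2 t) hit (hK h hh)).2
  have hlim : ∀ t, Tendsto (fun h => eLpNorm (((S h).op h fun y => ψ (t, y))
      - diffusionOp c μ fun y => ψ (t, y)) 1 volume) (𝓝[>] 0) (𝓝 0) := fun t =>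
    hcons _ (contDiff_slice hψ t) (hcs t)
  -- The uniform bound for the limit operator is inherited from the discrete ones through
  -- consistency, so no direct estimate of the Lévy operator is required. It provides the constant
  -- dominating function in time.
  have hdE : ∀ t, eLpNorm (diffusionOp c μ fun y => ψ (t, y)) 1 volume ≤ ENNReal.ofReal E := by
    intro t
    have h1 : Tendsto (fun h => ENNReal.ofReal E + eLpNorm (((S h).op h fun y => ψ (t, y))
      - diffusionOp c μ fun y => ψ (t, y)) 1 volume) (𝓝[>] 0) (𝓝 (ENNReal.ofReal E + 0)) :=
      tendsto_const_nhds.add (hlim t)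
    rw [add_zero] at h1
    refine ge_of_tendsto h1 ?_
    filter_upwards [eventually_mem_Ioo_one] with h hh
    have h3 := eLpNorm_sub_le (p := 1) (μ := volume) (hmop' h t).aestronglyMeasurable
      ((hmop' h t).sub (hmd' t)).aestronglyMeasurable le_rfl
    rw [sub_sub_cancel] at h3
    exact h3.trans (add_le_add_left (hopE h hh t) _)
  have hdct := tendsto_lintegral_filter_of_dominated_convergence
    (μ := volume.restrict (Ioo (0 : ℝ) T)) (l := 𝓝[>] (0 : ℝ))
    (F := fun h t => ∫⁻ x, ‖(S h).op h (fun y => ψ (t, y)) x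
      - diffusionOp c μ (fun y => ψ (t, y)) x‖ₑ) (f := fun _ => 0)
    (fun _ => ENNReal.ofReal E + ENNReal.ofReal E) ?_ ?_ ?_ ?_
  · rw [lintegral_zero] at hdct
    refine hdct.congr fun h => ?_
    rw [cylinder, restrict_prod_univ, lintegral_prod]
    exact (((hmop h).sub hmd).enorm).aemeasurable
  · exact Eventually.of_forall fun h => Measurable.lintegral_prod_right'
      (f := fun p : ℝ × Space N => ‖(S h).op h (fun y => ψ (p.1, y)) p.2
        - diffusionOp c μ (fun y => ψ (p.1, y)) p.2‖ₑ) ((hmop h).sub hmd).enorm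
  · filter_upwards [eventually_mem_Ioo_one] with h hh
    refine ae_of_all _ fun t => ?_
    have h3 := eLpNorm_sub_le (p := 1) (μ := volume) (hmop' h t).aestronglyMeasurable
      (hmd' t).aestronglyMeasurable le_rfl
    rw [eLpNorm_one_eq_lintegral_enorm] at h3
    exact h3.trans (add_le_add (hopE h hh t) (hdE t))
  · rw [setLIntegral_const]
    exact ENNReal.mul_ne_top (by simp) (by simp)
  · refine ae_of_all _ fun t => ?_
    have := hlim t
    simp_rw [eLpNorm_one_eq_lintegral_enorm] at this
    exact this

/-- Uniform bounds of the discrete operators on space-time test functions. -/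
theorem exists_op_slice_le (T : ℝ) {S : ℝ → Stencil N} {K : ℝ}
    (hK0 : 0 ≤ K) (hK : ∀ h ∈ Ioo (0 : ℝ) 1, (S h).trunc h 1 ≤ K)
    {ψ : ℝ × Space N → ℝ} (hψ : ContDiff ℝ ∞ ψ) (hc : HasCompactSupport ψ) :
    ∃ A E, 0 ≤ A ∧ 0 ≤ E ∧ ∀ h ∈ Ioo (0 : ℝ) 1,
      (∀ t x, |(S h).op h (fun y => ψ (t, y)) x| ≤ A) ∧
      IntegrableOn (fun p : ℝ × Space N => (S h).op h (fun y => ψ (p.1, y)) p.2) (cylinder N T) ∧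
      ∫ p in cylinder N T, |(S h).op h (fun y => ψ (p.1, y)) p.2| ≤ E := by
  obtain ⟨A, ρ, hA, hb, -, hs, h2⟩ := exists_test_bounds hψ hc
  set E := 4 * A * volume.real (Metric.closedBall (0 : Space N) (ρ + 1)) * K with hE
  have hE0 : 0 ≤ E := by positivity
  have hcs := hasCompactSupport_slice hs
  refine ⟨4 * A * K, max 0 T * E, by positivity, by positivity, fun h hh => ?_⟩
  have hct := fun t => (contDiff_slice hψ t).continuous
  have hit := fun t => (hct t).integrable_of_hasCompactSupport (μ := volume) (hcs t)
  have hbd := fun t => (S h).op_bounds (hct t) hA (fun x => hb _) (hs t) (h2 t) (hit t) (hK h hh)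
  have hm := (S h).measurable_op_prod h hψ.continuous.measurable
  have hle : ∫⁻ p in cylinder N T, ‖(S h).op h (fun y => ψ (p.1, y)) p.2‖ₑ
      ≤ ENNReal.ofReal (max 0 T * E) := by
    rw [cylinder, restrict_prod_univ, lintegral_prod _ hm.enorm.aemeasurable]
    refine (lintegral_mono (g := fun _ => ENNReal.ofReal E) fun t => ?_).trans ?_
    · have := eLpNorm_one_le_ofReal ((S h).integrable_op h (hct t).measurable (hit t)) (hbd t).2
      rwa [eLpNorm_one_eq_lintegral_enorm] at this
    · rw [setLIntegral_const, Real.volume_Ioo, sub_zero, mul_comm,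
        ENNReal.ofReal_mul (le_max_left _ _)]
      exact mul_le_mul_left (ENNReal.ofReal_le_ofReal (le_max_right _ _)) _
  have hi : IntegrableOn (fun p : ℝ × Space N => (S h).op h (fun y => ψ (p.1, y)) p.2)
      (cylinder N T) := ⟨hm.aestronglyMeasurable, hle.trans_lt ENNReal.ofReal_lt_top⟩
  refine ⟨fun t => (hbd t).1, hi, ?_⟩
  refine integral_abs_le_of_eLpNorm (by positivity) hi ?_
  rwa [eLpNorm_one_eq_lintegral_enorm]

/-- A single small $h$ suffices: the discrete operator is integrable and lies at finite $L^1$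
distance from the limit operator. -/
theorem integrableOn_diffusionOp_slice {c : ℝ} {μ : Measure (Space N)} (hμ : IsSymmLevyMeasure μ)
    {S : ℝ → Stencil N} (hcons : Consistent c μ S) {K : ℝ}
    (hK0 : 0 ≤ K) (hK : ∀ h ∈ Ioo (0 : ℝ) 1, (S h).trunc h 1 ≤ K)
    {ψ : ℝ × Space N → ℝ} (hψ : ContDiff ℝ ∞ ψ) (hc : HasCompactSupport ψ) :
    IntegrableOn (fun p : ℝ × Space N => diffusionOp c μ (fun y => ψ (p.1, y)) p.2)
      (cylinder N T) := by
  obtain ⟨A, E, -, -, hop⟩ := exists_op_slice_le T hK0 hK hψ hc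
  obtain ⟨h, hh, hlt⟩ := (eventually_mem_Ioo_one.and ((tendsto_lintegral_op_sub (T := T) hμ hcons
    hK hψ hc).eventually_lt_const ENNReal.zero_lt_top)).exists
  have h1 : IntegrableOn (fun p : ℝ × Space N => (S h).op h (fun y => ψ (p.1, y)) p.2
      - diffusionOp c μ (fun y => ψ (p.1, y)) p.2) (cylinder N T) :=
    ⟨(((S h).measurable_op_prod h hψ.continuous.measurable).sub
      (measurable_diffusionOp_slice hμ c hψ)).aestronglyMeasurable, hlt⟩
  refine ((hop h hh).2.1.sub h1).congr (ae_of_all _ fun p => ?_)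
  simp

theorem eventually_integral_op_sub_le {c : ℝ} {μ : Measure (Space N)} (hμ : IsSymmLevyMeasure μ)
    {S : ℝ → Stencil N} (hcons : Consistent c μ S) {K : ℝ}
    (hK0 : 0 ≤ K) (hK : ∀ h ∈ Ioo (0 : ℝ) 1, (S h).trunc h 1 ≤ K)
    {ψ : ℝ × Space N → ℝ} (hψ : ContDiff ℝ ∞ ψ) (hc : HasCompactSupport ψ) {ε : ℝ} (hε : 0 < ε) :
    ∀ᶠ h in 𝓝[>] 0, ∫ p in cylinder N T, |(S h).op h (fun y => ψ (p.1, y)) p.2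
      - diffusionOp c μ (fun y => ψ (p.1, y)) p.2| ≤ ε := by
  obtain ⟨A, E, -, -, hop⟩ := exists_op_slice_le T hK0 hK hψ hc
  filter_upwards [eventually_mem_Ioo_one, (tendsto_lintegral_op_sub (T := T) hμ hcons
    hK hψ hc).eventually_le_const (ENNReal.ofReal_pos.2 hε)] with h hh hle
  refine integral_abs_le_of_eLpNorm hε.le
    ((hop h hh).2.1.sub (integrableOn_diffusionOp_slice hμ hcons hK0 hK hψ hc)) ?_
  rwa [eLpNorm_one_eq_lintegral_enorm]

end GPME

namespace GPME

variable {N : ℕ} {T : ℝ}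

/-! ### The weak formulation of the scheme -/

theorem integral_deriv_of_eq_zero (hT : 0 ≤ T) {f : ℝ → ℝ} (hf : ContDiff ℝ ∞ f) (hfT : f T = 0) :
    ∫ t in Ioo 0 T, deriv f t = -f 0 := by
  have hc : Continuous (deriv f) := hf.continuous_deriv (by simp)
  rw [← integral_Ioc_eq_integral_Ioo, ← intervalIntegral.integral_of_le hT,
    intervalIntegral.integral_deriv_eq_sub
      (fun x _ => (hf.differentiable (by simp)).differentiableAt) (hc.intervalIntegrable _ _), hfT,
    zero_sub]

/-- Integration by parts: the derivative of the coefficient is the inverse step length on the step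
and zero elsewhere, and the boundary terms vanish because the coefficient is $0$ at time $0$ and
$f(T)=0$. -/
theorem TimeGrid.integral_clamp_mul_deriv (G : TimeGrid T) {j : ℕ} (hj : j < G.J) {f : ℝ → ℝ}
    (hf : ContDiff ℝ ∞ f) (hfT : f T = 0) :
    ∫ t in Ioo 0 T, G.clamp j t * deriv f t
      = -((G.step j)⁻¹ * ∫ t in Ioo (G.node j) (G.node (j + 1)), f t) := by
  have h0 := G.node_nonneg hj.le
  have h1 := (G.node_lt j hj).le
  have h2 := G.node_le (show j + 1 ≤ G.J from hj)
  have hc : Continuous (deriv f) := hf.continuous_deriv (by simp)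
  have hcc : Continuous fun t => G.clamp j t * deriv f t := (G.continuous_clamp j).mul hc
  have hd : ∀ x, HasDerivAt f (deriv f x) x := fun x =>
    ((hf.differentiable (by simp)).differentiableAt).hasDerivAt
  rw [← integral_Ioc_eq_integral_Ioo, ← integral_Ioc_eq_integral_Ioo,
    ← intervalIntegral.integral_of_le (h0.trans (h1.trans h2)),
    ← intervalIntegral.integral_of_le h1,
    ← intervalIntegral.integral_add_adjacent_intervals (b := G.node j)
      (hcc.intervalIntegrable _ _) (hcc.intervalIntegrable _ _),
    ← intervalIntegral.integral_add_adjacent_intervals (a := G.node j) (b := G.node (j + 1))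
      (hcc.intervalIntegrable _ _) (hcc.intervalIntegrable _ _)]
  have e1 : ∫ t in (0)..(G.node j), G.clamp j t * deriv f t = 0 := by
    refine intervalIntegral.integral_zero_ae (ae_of_all _ fun t ht => ?_)
    rw [uIoc_of_le h0] at ht
    rw [G.clamp_of_le hj ht.2, zero_mul]
  have e3 : ∫ t in (G.node (j + 1))..T, G.clamp j t * deriv f t = -f (G.node (j + 1)) := by
    have : ∫ t in (G.node (j + 1))..T, G.clamp j t * deriv f t
        = ∫ t in (G.node (j + 1))..T, deriv f t := by
      refine intervalIntegral.integral_congr fun t ht => ?_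
      rw [uIcc_of_le h2] at ht
      rw [G.clamp_of_ge hj ht.1, one_mul]
    rw [this, intervalIntegral.integral_deriv_eq_sub
      (fun x _ => (hf.differentiable (by simp)).differentiableAt) (hc.intervalIntegrable _ _), hfT,
      zero_sub]
  have e2 : ∫ t in (G.node j)..(G.node (j + 1)), G.clamp j t * deriv f t
      = f (G.node (j + 1)) - (G.step j)⁻¹ * ∫ t in (G.node j)..(G.node (j + 1)), f t := by
    have : ∫ t in (G.node j)..(G.node (j + 1)), G.clamp j t * deriv f t
        = ∫ t in (G.node j)..(G.node (j + 1)), ((t - G.node j) / G.step j) * deriv f t := by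
      refine intervalIntegral.integral_congr fun t ht => ?_
      rw [uIcc_of_le h1] at ht
      rw [G.clamp_of_mem hj ht]
    rw [this, intervalIntegral.integral_mul_deriv_eq_deriv_mul (u' := fun _ => (G.step j)⁻¹)
      (v := f) (fun x _ => by
        simpa [one_div] using ((hasDerivAt_id x).sub_const (G.node j)).div_const (G.step j))
      (fun x _ => hd x) intervalIntegrable_const (hc.intervalIntegrable _ _),
      intervalIntegral.integral_const_mul]
    have : (G.node (j + 1) - G.node j) / G.step j = 1 := div_self (G.step_pos hj).ne'
    rw [this, sub_self]
    ring
  rw [e1, e2, e3]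
  ring

theorem IsTestFunction.eq_zero_of_le {ψ : ℝ × Space N → ℝ} (hψ : IsTestFunction T ψ) {t : ℝ}
    (ht : T ≤ t) (x : Space N) : ψ (t, x) = 0 := by
  refine image_eq_zero_of_notMem_tsupport fun h => ?_
  exact absurd (hψ.supp h).1 (not_lt.2 ht)

theorem integrableOn_mul_bdd {s : Set (ℝ × Space N)} {f k : ℝ × Space N → ℝ} {B : ℝ}
    (hf : IntegrableOn f s) (hk : Measurable k) (hb : ∀ p, |k p| ≤ B) :
    IntegrableOn (fun p => f p * k p) s :=
  hf.mul_bdd (c := B) hk.aestronglyMeasurable (ae_of_all _ hb)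

theorem integral_cylinder_deriv {ψ : ℝ × Space N → ℝ} (hψ : IsTestFunction T ψ) (hT : 0 ≤ T)
    {d : Space N → ℝ} (hd : Integrable d) :
    ∫ p in cylinder N T, d p.2 * deriv (fun s => ψ (s, p.2)) p.1 = -∫ x, d x * ψ (0, x) := by
  obtain ⟨A, ρ, hA, hb, hbt, -, -⟩ := exists_test_bounds hψ.smooth hψ.compact
  have i1 := integrableOn_mul_bdd (integrableOn_slab_snd (Ioo 0 T) (by simp) hd)
    (continuous_deriv_time hψ.smooth).measurable hbt
  rw [cylinder, restrict_prod_univ]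
  rw [IntegrableOn, restrict_prod_univ] at i1
  rw [integral_prod_symm _ i1, ← integral_neg]
  congr 1; ext x
  simp only
  rw [integral_const_mul, integral_deriv_of_eq_zero hT (contDiff_slice_time hψ.smooth x)
    (hψ.eq_zero_of_le le_rfl x), mul_neg]

theorem integral_cylinder_clamp_deriv {ψ : ℝ × Space N → ℝ} (hψ : IsTestFunction T ψ)
    (G : TimeGrid T) {j : ℕ} (hj : j < G.J) {d : Space N → ℝ} (hd : Integrable d) :
    ∫ p in cylinder N T, G.clamp j p.1 * (d p.2 * deriv (fun s => ψ (s, p.2)) p.1)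
      = -((G.step j)⁻¹ * ∫ p in G.slab N j, d p.2 * ψ p) := by
  obtain ⟨A, ρ, hA, hb, hbt, -, -⟩ := exists_test_bounds hψ.smooth hψ.compact
  have i1 : IntegrableOn (fun p : ℝ × Space N =>
      G.clamp j p.1 * (d p.2 * deriv (fun s => ψ (s, p.2)) p.1)) (Ioo 0 T ×ˢ univ) := by
    have := integrableOn_mul_bdd (integrableOn_mul_bdd (integrableOn_slab_snd (Ioo 0 T)
      (by simp) hd) (continuous_deriv_time hψ.smooth).measurable hbt)
      ((G.continuous_clamp j).measurable.comp measurable_fst) (B := 1) (fun p => by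
        have := G.clamp_mem j p.1
        simp only [Function.comp_apply]
        rw [abs_of_nonneg this.1]; exact this.2)
    refine this.congr (ae_of_all _ fun p => ?_)
    simp only [Function.comp_apply]
    ring
  have i2 : IntegrableOn (fun p : ℝ × Space N => d p.2 * ψ p)
      (Ioo (G.node j) (G.node (j + 1)) ×ˢ univ) :=
    integrableOn_mul_bdd (integrableOn_slab_snd _ (by simp) hd) hψ.smooth.continuous.measurable hb
  rw [TimeGrid.slab, cylinder, restrict_prod_univ, restrict_prod_univ]
  rw [IntegrableOn, restrict_prod_univ] at i1 i2
  rw [integral_prod_symm _ i1, integral_prod_symm _ i2, ← integral_const_mul, ← integral_neg]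
  congr 1; ext x
  simp only
  have e : ∀ t, G.clamp j t * (d x * deriv (fun s => ψ (s, x)) t)
      = d x * (G.clamp j t * deriv (fun s => ψ (s, x)) t) := fun t => by ring
  simp_rw [e]
  rw [integral_const_mul, G.integral_clamp_mul_deriv hj (contDiff_slice_time hψ.smooth x)
    (hψ.eq_zero_of_le le_rfl x), integral_const_mul]
  ring

/-- Self-adjointness on each time slice, integrated by Fubini. -/
theorem setIntegral_slab_mul_op (S : Stencil N) (h : ℝ) (G : TimeGrid T) (j : ℕ)
    {ψ : ℝ × Space N → ℝ} {ρ B : ℝ} (hψ : ContDiff ℝ ∞ ψ) (hc : HasCompactSupport ψ)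
    (hs : ∀ t x, ρ < ‖x‖ → ψ (t, x) = 0) {q : Space N → ℝ}
    (hq : Measurable q) (hqb : ∀ x, |q x| ≤ B)
    (hop : IntegrableOn (fun p : ℝ × Space N => S.op h (fun y => ψ (p.1, y)) p.2) (G.slab N j)) :
    ∫ p in G.slab N j, ψ p * S.op h q p.2
      = ∫ p in G.slab N j, q p.2 * S.op h (fun y => ψ (p.1, y)) p.2 := by
  have i1 : IntegrableOn (fun p : ℝ × Space N => ψ p * S.op h q p.2)
      (Ioo (G.node j) (G.node (j + 1)) ×ˢ univ) :=
    integrableOn_mul_bdd (hψ.continuous.integrable_of_hasCompactSupport hc).integrableOn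
      ((S.measurable_op h hq).comp measurable_snd) (fun p => S.abs_op_le_mass h hqb p.2)
  have i2 : IntegrableOn (fun p : ℝ × Space N => q p.2 * S.op h (fun y => ψ (p.1, y)) p.2)
      (Ioo (G.node j) (G.node (j + 1)) ×ˢ univ) := by
    have := integrableOn_mul_bdd hop (hq.comp measurable_snd) (fun p => hqb p.2)
    refine this.congr (ae_of_all _ fun p => ?_)
    simp only [Function.comp_apply]
    ring
  rw [TimeGrid.slab, restrict_prod_univ]
  rw [IntegrableOn, restrict_prod_univ] at i1 i2
  rw [integral_prod _ i1, integral_prod _ i2]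
  congr 1; ext t
  exact S.integral_mul_op h hqb hq ((contDiff_slice hψ t).continuous.integrable_of_hasCompactSupport
    (hasCompactSupport_slice hs t))

namespace SchemeData

variable {γ : ℝ} {φ : ℝ → ℝ} {u₀ : Space N → ℝ} {g : ℝ → Space N → ℝ}
  {S : ℝ → Stencil N} {G : ℝ → TimeGrid T} {U : ℝ → ℕ → Idx N → ℝ}
variable (D : SchemeData γ φ u₀ g S G U)
include D

theorem integrableOn_interpolant {h : ℝ} (hh : 0 < h) :
    IntegrableOn (fun p : ℝ × Space N => interpolant h (G h) (U h) p.1 p.2) (cylinder N T) := by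
  have e : ∀ p ∈ cylinder N T, spaceInterp h (U h 0) p.2 + ∑ j ∈ Finset.range (G h).J,
      (spaceInterp h (U h (j + 1)) p.2 - spaceInterp h (U h j) p.2) * (G h).clamp j p.1
      = interpolant h (G h) (U h) p.1 p.2 := fun p hp => by
    rw [interpolant_eq_sum_clamp h _ _ D.pos_time (Ioo_subset_Icc_self hp.1)]
    simp_rw [mul_comm (_ - _)]
  refine IntegrableOn.congr_fun (Integrable.add ?_ (integrable_finsetSum _ fun j hj => ?_)) e
    measurableSet_cylinder
  · exact integrableOn_slab_snd _ (by simp) (D.integrable hh (Nat.zero_le _))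
  · have hj := Finset.mem_range.1 hj
    refine integrableOn_mul_bdd (B := 1) (integrableOn_slab_snd _ (by simp)
      ((D.integrable hh hj).sub (D.integrable hh hj.le)))
      (((G h).continuous_clamp j).measurable.comp measurable_fst) fun p => ?_
    have := (G h).clamp_mem j p.1
    rw [abs_of_nonneg this.1]; exact this.2

/-- An exact weak formulation of the scheme, with no truncation error. It differs from the limit
equation only in the data, in the operator, and in that $\varphi$ is evaluated at the next node
instead of along the interpolant. -/
theorem weak_identity {h : ℝ} (hh : 0 < h) {ψ : ℝ × Space N → ℝ} (hψ : IsTestFunction T ψ)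
    (hop : IntegrableOn (fun p : ℝ × Space N => (S h).op h (fun y => ψ (p.1, y)) p.2)
      (cylinder N T)) :
    (∫ p in cylinder N T, interpolant h (G h) (U h) p.1 p.2 * deriv (fun s => ψ (s, p.2)) p.1)
      + (∑ j ∈ Finset.range (G h).J, ((∫ p in (G h).slab N j, sourceInterp h (G h) g j p.2 * ψ p)
        + ∫ p in (G h).slab N j, φ (spaceInterp h (U h (j + 1)) p.2)
          * (S h).op h (fun y => ψ (p.1, y)) p.2))
      + ∫ x, spaceInterp h (U h 0) x * ψ (0, x) = 0 := by
  obtain ⟨A, ρ, hA, hb, hbt, hs, -⟩ := exists_test_bounds hψ.smooth hψ.compact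
  obtain ⟨M, hM, hU⟩ := D.bdd
  set d : ℕ → Space N → ℝ := fun j x => spaceInterp h (U h (j + 1)) x - spaceInterp h (U h j) x
    with hd
  have hdi : ∀ j < (G h).J, Integrable (d j) := fun j hj =>
    (D.integrable hh hj).sub (D.integrable hh hj.le)
  have hdm := (continuous_deriv_time hψ.smooth).measurable
  have i0 : IntegrableOn (fun p : ℝ × Space N => spaceInterp h (U h 0) p.2
      * deriv (fun s => ψ (s, p.2)) p.1) (cylinder N T) :=
    integrableOn_mul_bdd (integrableOn_slab_snd _ (by simp) (D.integrable hh (Nat.zero_le _)))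
      hdm hbt
  have ij : ∀ j ∈ Finset.range (G h).J, IntegrableOn (fun p : ℝ × Space N =>
      (G h).clamp j p.1 * (d j p.2 * deriv (fun s => ψ (s, p.2)) p.1)) (cylinder N T) := by
    intro j hj
    have := integrableOn_mul_bdd (integrableOn_mul_bdd (integrableOn_slab_snd (Ioo 0 T)
      (by simp) (hdi j (Finset.mem_range.1 hj))) hdm hbt)
      (((G h).continuous_clamp j).measurable.comp measurable_fst) (B := 1) (fun p => by
        have := (G h).clamp_mem j p.1
        simp only [Function.comp_apply]
        rw [abs_of_nonneg this.1]; exact this.2)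
    refine this.congr (ae_of_all _ fun p => ?_)
    simp only [Function.comp_apply]
    ring
  have e1 : ∫ p in cylinder N T, interpolant h (G h) (U h) p.1 p.2
        * deriv (fun s => ψ (s, p.2)) p.1
      = (∫ p in cylinder N T, spaceInterp h (U h 0) p.2 * deriv (fun s => ψ (s, p.2)) p.1)
        + ∑ j ∈ Finset.range (G h).J, ∫ p in cylinder N T,
          (G h).clamp j p.1 * (d j p.2 * deriv (fun s => ψ (s, p.2)) p.1) := by
    rw [← integral_finsetSum _ ij, ← integral_add i0 (integrable_finsetSum _ ij)]
    refine setIntegral_congr_fun measurableSet_cylinder fun p hp => ?_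
    rw [interpolant_eq_sum_clamp h _ _ D.pos_time (Ioo_subset_Icc_self hp.1), add_mul,
      Finset.sum_mul]
    simp only [hd, mul_assoc]
  have e2 : ∀ j ∈ Finset.range (G h).J, ∫ p in cylinder N T,
          (G h).clamp j p.1 * (d j p.2 * deriv (fun s => ψ (s, p.2)) p.1)
      = -((∫ p in (G h).slab N j, sourceInterp h (G h) g j p.2 * ψ p)
        + ∫ p in (G h).slab N j, φ (spaceInterp h (U h (j + 1)) p.2)
          * (S h).op h (fun y => ψ (p.1, y)) p.2) := by
    intro j hj
    have hj := Finset.mem_range.1 hj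
    have hst := (G h).step_pos hj
    have hφm : Measurable fun x => φ (spaceInterp h (U h (j + 1)) x) :=
      D.mono.measurable.comp (measurable_spaceInterp _ _)
    have hφb : ∀ x, |φ (spaceInterp h (U h (j + 1)) x)| ≤ |φ M| + |φ (-M)| := fun x =>
      D.abs_phi_le (hU h hh _ hj _)
    rw [integral_cylinder_clamp_deriv hψ (G h) hj (hdi j hj),
      ← setIntegral_slab_mul_op (S h) h (G h) j hψ.smooth hψ.compact hs hφm hφb
        (hop.mono_set ((G h).slab_subset N hj)), ← integral_add, ← integral_const_mul]
    · congr 1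
      congr 1; ext p
      -- The scheme identifies the time difference quotient, which integration by parts has put on
      -- the slab, with source plus diffusion.
      have := D.step_eq hh hj p.2
      simp only [hd]
      rw [this]
      field_simp
      ring
    · exact integrableOn_mul_bdd ((G h).integrableOn_slab_snd j (D.integrable_source hh hj))
        hψ.smooth.continuous.measurable hb
    · exact integrableOn_mul_bdd
        (hψ.smooth.continuous.integrable_of_hasCompactSupport hψ.compact).integrableOn
        (((S h).measurable_op h hφm).comp measurable_snd)
        (fun p => (S h).abs_op_le_mass h hφb p.2)
  rw [e1, Finset.sum_congr rfl e2, Finset.sum_neg_distrib,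
    integral_cylinder_deriv hψ D.pos_time.le (D.integrable hh (Nat.zero_le _))]
  ring

end SchemeData

end GPME

namespace GPME

variable {N : ℕ} {T : ℝ}

/-! ### Passage to the limit in the weak formulation -/

theorem abs_integral_mul_sub_le {α : Type*} [MeasurableSpace α] {μ : Measure α} {f f' k : α → ℝ}
    {B : ℝ} (hf : Integrable f μ) (hf' : Integrable f' μ) (hk : AEStronglyMeasurable k μ)
    (hb : ∀ x, |k x| ≤ B) :
    |(∫ x, f x * k x ∂μ) - ∫ x, f' x * k x ∂μ| ≤ B * ∫ x, |f x - f' x| ∂μ := by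
  rw [← integral_sub (hf.mul_bdd (c := B) hk (ae_of_all _ hb))
    (hf'.mul_bdd (c := B) hk (ae_of_all _ hb)), ← integral_const_mul]
  refine abs_integral_le_integral_abs.trans (integral_mono_of_nonneg (ae_of_all _ fun _ =>
    abs_nonneg _) ((hf.sub hf').abs.const_mul B) (ae_of_all _ fun x => ?_))
  simp only
  rw [← sub_mul, abs_mul, mul_comm]
  exact mul_le_mul_of_nonneg_right (hb x) (abs_nonneg _)

theorem integrableOn_Ioo_prod {a b L : ℝ} (hab : a ≤ b) (hL0 : 0 ≤ L) {f : ℝ × Space N → ℝ}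
    (hm : Measurable f) (hi : ∀ t ∈ Ioo a b, Integrable fun x => f (t, x))
    (hL : ∀ t ∈ Ioo a b, ∫ x, |f (t, x)| ≤ L) :
    IntegrableOn f (Ioo a b ×ˢ univ) ∧ ∫ p in Ioo a b ×ˢ univ, |f p| ≤ (b - a) * L := by
  have hle : ∫⁻ p in Ioo a b ×ˢ univ, ‖f p‖ₑ ≤ ENNReal.ofReal ((b - a) * L) := by
    rw [restrict_prod_univ, lintegral_prod _ hm.enorm.aemeasurable]
    refine (setLIntegral_mono (g := fun _ => ENNReal.ofReal L) measurable_const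
      fun t ht => ?_).trans ?_
    · have := eLpNorm_one_le_ofReal (hi t ht) (hL t ht)
      rwa [eLpNorm_one_eq_lintegral_enorm] at this
    · rw [setLIntegral_const, Real.volume_Ioo, mul_comm, ENNReal.ofReal_mul (by linarith)]
  have hi : IntegrableOn f (Ioo a b ×ˢ univ) :=
    ⟨hm.aestronglyMeasurable, hle.trans_lt ENNReal.ofReal_lt_top⟩
  refine ⟨hi, integral_abs_le_of_eLpNorm (mul_nonneg (by linarith) hL0) hi ?_⟩
  rwa [eLpNorm_one_eq_lintegral_enorm]

/-- Provides the splitting level for the Hölder difference $\varphi(u)-\varphi(U)$: its constant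
part $\kappa^\gamma$ must be small before the $L^1$ error is chosen. -/
theorem exists_rpow_mul_le {γ B ε : ℝ} (hγ : 0 < γ) (hB : 0 ≤ B) (hε : 0 < ε) :
    ∃ κ > 0, B * κ ^ γ ≤ ε := by
  refine ⟨(ε / (B + 1)) ^ γ⁻¹, by positivity, ?_⟩
  rw [← Real.rpow_mul (by positivity), inv_mul_cancel₀ hγ.ne', Real.rpow_one, mul_div_assoc',
    div_le_iff₀ (by positivity)]
  nlinarith

namespace SchemeData

variable {γ : ℝ} {φ : ℝ → ℝ} {u₀ : Space N → ℝ} {g : ℝ → Space N → ℝ}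
  {S : ℝ → Stencil N} {G : ℝ → TimeGrid T} {U : ℝ → ℕ → Idx N → ℝ}
variable (D : SchemeData γ φ u₀ g S G U)
include D

theorem integrableOn_limit {𝓤 : Ultrafilter ℝ} (h𝓤 : (𝓤 : Filter ℝ) ≤ 𝓝[>] 0)
    {u : ℝ → Space N → ℝ} (hu : IsUniformLimit T 𝓤 (fun h => interpolant h (G h) (U h)) u) :
    IntegrableOn (fun p : ℝ × Space N => u p.1 p.2) (cylinder N T) := by
  obtain ⟨h, hh, hc⟩ := (Eventually.and (h𝓤 self_mem_nhdsWithin : ∀ᶠ h : ℝ in (𝓤 : Filter ℝ), 0 < h)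
    (hu.close 1 one_pos)).exists
  have h1 := (integrableOn_Ioo_prod (f := fun p : ℝ × Space N =>
    interpolant h (G h) (U h) p.1 p.2 - u p.1 p.2) D.pos_time.le zero_le_one
    ((measurable_interpolant _ _ _).sub hu.meas)
    (fun t ht => (D.integrable_interpolant hh (Ioo_subset_Icc_self ht)).sub
      (hu.integrable t (Ioo_subset_Icc_self ht)))
    (fun t ht => hc t (Ioo_subset_Icc_self ht))).1
  refine ((D.integrableOn_interpolant hh).sub h1).congr (ae_of_all _ fun p => ?_)
  simp

/-- The left side does not depend on $h$, so it is enough to compare it term by term with the exact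
identity of one scheme that is close enough to the limit. -/
theorem weakEq_limit {c : ℝ} {μ : Measure (Space N)} (hμ : IsSymmLevyMeasure μ)
    (hcons : Consistent c μ S) {𝓤 : Ultrafilter ℝ} (h𝓤 : (𝓤 : Filter ℝ) ≤ 𝓝[>] 0)
    {u : ℝ → Space N → ℝ} {M₁ : ℝ} (hM₁ : ∀ t x, |u t x| ≤ M₁)
    (hu : IsUniformLimit T 𝓤 (fun h => interpolant h (G h) (U h)) u)
    {ψ : ℝ × Space N → ℝ} (hψ : IsTestFunction T ψ) :
    (∫ p in cylinder N T, u p.1 p.2 * deriv (fun s => ψ (s, p.2)) p.1)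
      + (∫ p in cylinder N T, diffusionOp c μ (fun y => ψ (p.1, y)) p.2 * φ (u p.1 p.2))
      + (∫ p in cylinder N T, g p.1 p.2 * ψ p) + ∫ x, u₀ x * ψ (0, x) = 0 := by
  obtain ⟨A, ρ, hA, hb, hbt, hs, -⟩ := exists_test_bounds hψ.smooth hψ.compact
  obtain ⟨K, hK0, hK⟩ := D.exists_trunc_one
  obtain ⟨A', E, hA', hE, hop⟩ := exists_op_slice_le T hK0 hK hψ.smooth hψ.compact
  obtain ⟨M₂, hM₂, hU⟩ := D.bdd
  set M := max M₁ M₂ with hMdef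
  have huM : ∀ t x, |u t x| ≤ M := fun t x => (hM₁ t x).trans (le_max_left _ _)
  obtain ⟨C, hC, hφ⟩ := D.holder M
  set Φ := |φ M| + |φ (-M)| with hΦdef
  have hΦ0 : 0 ≤ Φ := by positivity
  have hφu : ∀ p : ℝ × Space N, |φ (u p.1 p.2)| ≤ Φ := fun p => D.abs_phi_le (huM _ _)
  have hφm : Measurable fun p : ℝ × Space N => φ (u p.1 p.2) := D.mono.measurable.comp hu.meas
  have hdI := integrableOn_diffusionOp_slice (T := T) hμ hcons hK0 hK hψ.smooth hψ.compact
  have hui := D.integrableOn_limit h𝓤 hu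
  have hψm := hψ.smooth.continuous.measurable
  have hT := D.pos_time
  set W := (∫ p in cylinder N T, u p.1 p.2 * deriv (fun s => ψ (s, p.2)) p.1)
      + (∫ p in cylinder N T, diffusionOp c μ (fun y => ψ (p.1, y)) p.2 * φ (u p.1 p.2))
      + (∫ p in cylinder N T, g p.1 p.2 * ψ p) + ∫ x, u₀ x * ψ (0, x) with hW
  suffices h : ∀ ε > 0, |W| ≤ ε from
    abs_nonpos_iff.1 (le_of_forall_pos_le_add fun ε hε => by simpa using h ε hε)
  intro ε hε
  obtain ⟨κ, hκ, hκE⟩ := exists_rpow_mul_le D.pos_exp (show 0 ≤ C * E by positivity)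
    (show 0 < ε / 2 by positivity)
  -- $Q$ collects all errors linear in $\delta$. The level $\kappa$ is fixed first, as
  -- $\kappa^{\gamma-1}$ may be large; then $\delta$ is chosen so that $Q\delta\le\varepsilon/2$.
  set Q := A * T + Φ + C * (κ ^ (γ - 1) * A' * (T * 2)) + 2 * A with hQ
  have hQ0 : 0 ≤ Q := by positivity
  set δ := ε / (2 * (Q + 1)) with hδdef
  have hδ : 0 < δ := by positivity
  have hQδ : Q * δ ≤ ε / 2 := by
    rw [hδdef, mul_div_assoc', div_le_div_iff₀ (by positivity) (by positivity)]
    nlinarith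
  obtain ⟨h, ⟨hh, hinit, hsrc⟩, hnext, hops, hclose⟩ :=
    (((D.eventually_data_le hδ).filter_mono h𝓤).and
      (((D.eventually_interpolant_sub_next_le hδ).filter_mono h𝓤).and
        (((eventually_integral_op_sub_le (T := T) hμ hcons hK0 hK hψ.smooth hψ.compact
          hδ).filter_mono h𝓤).and (hu.close δ hδ)))).exists
  obtain ⟨hopA, hopI, hopE⟩ := hop h hh
  have hident := D.weak_identity hh.1 hψ hopI
  have hId := (G h).sum_setIntegral_slab N (f := fun p => g p.1 p.2 * ψ p)
    (integrableOn_mul_bdd D.int_source hψm hb)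
  have hop' : IntegrableOn (fun p : ℝ × Space N => (S h).op h (fun y => ψ (p.1, y)) p.2
      * φ (u p.1 p.2)) (cylinder N T) := integrableOn_mul_bdd hopI hφm hφu
  have hId2 := (G h).sum_setIntegral_slab N hop'
  have hId3 := (G h).sum_setIntegral_slab N hopI.abs
  have t1 : |(∫ p in cylinder N T, u p.1 p.2 * deriv (fun s => ψ (s, p.2)) p.1)
      - ∫ p in cylinder N T, interpolant h (G h) (U h) p.1 p.2 * deriv (fun s => ψ (s, p.2)) p.1|
      ≤ A * (T * δ) := by
    refine (abs_integral_mul_sub_le hui (D.integrableOn_interpolant hh.1)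
      (continuous_deriv_time hψ.smooth).aestronglyMeasurable hbt).trans
      (mul_le_mul_of_nonneg_left ?_ hA)
    have := (integrableOn_Ioo_prod (f := fun p : ℝ × Space N =>
      u p.1 p.2 - interpolant h (G h) (U h) p.1 p.2) hT.le hδ.le
      (hu.meas.sub (measurable_interpolant _ _ _))
      (fun t ht => (hu.integrable t (Ioo_subset_Icc_self ht)).sub
        (D.integrable_interpolant hh.1 (Ioo_subset_Icc_self ht)))
      (fun t ht => by
        simp only [abs_sub_comm (u _ _)]
        exact hclose t (Ioo_subset_Icc_self ht))).2
    rwa [sub_zero] at this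
  have t2 : |(∫ p in cylinder N T, diffusionOp c μ (fun y => ψ (p.1, y)) p.2 * φ (u p.1 p.2))
      - ∫ p in cylinder N T, (S h).op h (fun y => ψ (p.1, y)) p.2 * φ (u p.1 p.2)| ≤ Φ * δ := by
    refine (abs_integral_mul_sub_le hdI hopI hφm.aestronglyMeasurable hφu).trans
      (mul_le_mul_of_nonneg_left ?_ hΦ0)
    simp_rw [abs_sub_comm (diffusionOp _ _ _ _)]
    exact hops
  have t3 : ∀ j ∈ Finset.range (G h).J,
      |(∫ p in (G h).slab N j, (S h).op h (fun y => ψ (p.1, y)) p.2 * φ (u p.1 p.2))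
        - ∫ p in (G h).slab N j, φ (spaceInterp h (U h (j + 1)) p.2)
          * (S h).op h (fun y => ψ (p.1, y)) p.2|
      ≤ C * (κ ^ (γ - 1) * A' * ((G h).step j * (2 * δ)) + κ ^ γ *
        ∫ p in (G h).slab N j, |(S h).op h (fun y => ψ (p.1, y)) p.2|) := by
    intro j hj
    have hj := Finset.mem_range.1 hj
    have hsub := (G h).slab_subset N hj
    have hIcc : ∀ t ∈ Ioo ((G h).node j) ((G h).node (j + 1)), t ∈ Icc 0 T := fun t ht =>
      ⟨((G h).node_nonneg hj.le).trans ht.1.le, ht.2.le.trans ((G h).node_le hj)⟩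
    -- The limit is within $\delta$ of the interpolant, which is within $\delta$ of the next node
    -- value.
    have hw := integrableOn_Ioo_prod (L := 2 * δ) (f := fun p : ℝ × Space N =>
      u p.1 p.2 - spaceInterp h (U h (j + 1)) p.2) ((G h).node_lt j hj).le (by positivity)
      (hu.meas.sub ((measurable_spaceInterp _ _).comp measurable_snd))
      (fun t ht => (hu.integrable t (hIcc t ht)).sub (D.integrable hh.1 hj))
      (fun t ht => by
        have := integral_abs_le_add (f := fun x => u t x - spaceInterp h (U h (j + 1)) x)
          ((D.integrable_interpolant hh.1 (hIcc t ht)).sub (hu.integrable t (hIcc t ht))).abs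
          ((D.integrable_interpolant hh.1 (hIcc t ht)).sub (D.integrable hh.1 hj)).abs
          (fun x => by
            simp only [Pi.sub_apply]
            rw [abs_sub_comm (interpolant _ _ _ _ _) (u t x)]
            exact abs_sub_le _ _ _)
        simp only [Pi.sub_apply] at this
        linarith [hclose t (hIcc t ht), hnext j hj t ht])
    have hv : ∀ p : ℝ × Space N, |φ (spaceInterp h (U h (j + 1)) p.2)| ≤ Φ := fun p =>
      D.abs_phi_le ((hU h hh.1 _ hj _).trans (le_max_right _ _))
    have hvm : Measurable fun p : ℝ × Space N => φ (spaceInterp h (U h (j + 1)) p.2) :=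
      D.mono.measurable.comp ((measurable_spaceInterp _ _).comp measurable_snd)
    have i1 := integrableOn_mul_bdd (hopI.mono_set hsub) hφm hφu
    have i2 : IntegrableOn (fun p => φ (spaceInterp h (U h (j + 1)) p.2)
          * (S h).op h (fun y => ψ (p.1, y)) p.2) ((G h).slab N j) := by
      simp_rw [mul_comm (φ _)]
      exact integrableOn_mul_bdd (hopI.mono_set hsub) hvm hv
    rw [← integral_sub i1 i2]
    refine abs_integral_le_integral_abs.trans ?_
    refine le_trans (le_of_eq ?_) (integral_holder_mul_le (w := fun p : ℝ × Space N =>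
      u p.1 p.2 - spaceInterp h (U h (j + 1)) p.2)
      (p := fun p => φ (u p.1 p.2) - φ (spaceInterp h (U h (j + 1)) p.2)) (C := C)
      D.pos_exp D.exp_le hC hκ
      (ae_of_all _ fun p => hφ _ _ (huM _ _) ((hU h hh.1 _ hj _).trans (le_max_right _ _)))
      hw.1 hw.2 (hopI.mono_set hsub) hA' (fun p => hopA _ _) le_rfl)
    congr 1; ext p
    rw [← abs_mul]
    congr 1; ring
  have t4 : ∀ j ∈ Finset.range (G h).J,
      |(∫ p in (G h).slab N j, g p.1 p.2 * ψ p)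
        - ∫ p in (G h).slab N j, sourceInterp h (G h) g j p.2 * ψ p|
      ≤ A * ∫ p in (G h).slab N j, |sourceInterp h (G h) g j p.2 - g p.1 p.2| := by
    intro j hj
    have hj := Finset.mem_range.1 hj
    simp_rw [abs_sub_comm (sourceInterp _ _ _ _ _)]
    exact abs_integral_mul_sub_le (D.int_source.mono_set ((G h).slab_subset N hj))
      ((G h).integrableOn_slab_snd j (D.integrable_source hh.1 hj)) hψm.aestronglyMeasurable hb
  have t5 : |(∫ x, u₀ x * ψ (0, x)) - ∫ x, spaceInterp h (U h 0) x * ψ (0, x)| ≤ A * δ := by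
    refine (abs_integral_mul_sub_le D.int_initial (D.integrable hh.1 (Nat.zero_le _))
      (contDiff_slice hψ.smooth 0).continuous.aestronglyMeasurable (fun x => hb _)).trans
      (mul_le_mul_of_nonneg_left ?_ hA)
    simp_rw [abs_sub_comm (u₀ _)]
    exact hinit
  have s3 := (Finset.abs_sum_le_sum_abs _ _).trans (Finset.sum_le_sum t3)
  have s4 := (Finset.abs_sum_le_sum_abs _ _).trans (Finset.sum_le_sum t4)
  rw [Finset.sum_sub_distrib, hId2, ← Finset.mul_sum, Finset.sum_add_distrib, ← Finset.mul_sum,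
    ← Finset.sum_mul, ← Finset.mul_sum, hId3, (G h).sum_step, (G h).node_last] at s3
  rw [Finset.sum_sub_distrib, hId, ← Finset.mul_sum] at s4
  have s3' := s3.trans (mul_le_mul_of_nonneg_left (add_le_add_right
    (mul_le_mul_of_nonneg_left hopE (Real.rpow_nonneg hκ.le γ)) _) hC)
  have s4' := s4.trans (mul_le_mul_of_nonneg_left hsrc hA)
  rw [Finset.sum_add_distrib] at hident
  have hfin : A * (T * δ) + Φ * δ + C * (κ ^ (γ - 1) * A' * (T * (2 * δ)) + κ ^ γ * E)
      + A * δ + A * δ ≤ ε := by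
    have e : A * (T * δ) + Φ * δ + C * (κ ^ (γ - 1) * A' * (T * (2 * δ)) + κ ^ γ * E)
      + A * δ + A * δ = Q * δ + C * E * κ ^ γ := by rw [hQ]; ring
    rw [e]; linarith
  refine le_trans ?_ hfin
  have a1 := abs_le.1 t1
  have a2 := abs_le.1 t2
  have a3 := abs_le.1 s3'
  have a4 := abs_le.1 s4'
  have a5 := abs_le.1 t5
  rw [abs_le, hW]
  constructor <;> linarith [a1.1, a1.2, a2.1, a2.2, a3.1, a3.2, a4.1, a4.2, a5.1, a5.2]

theorem isVeryWeakSolution_limit {c : ℝ} {μ : Measure (Space N)} (hμ : IsSymmLevyMeasure μ)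
    (hcons : Consistent c μ S) {𝓤 : Ultrafilter ℝ} (h𝓤 : (𝓤 : Filter ℝ) ≤ 𝓝[>] 0)
    {u : ℝ → Space N → ℝ} {M : ℝ} (hM : ∀ t x, |u t x| ≤ M)
    (hu : IsUniformLimit T 𝓤 (fun h => interpolant h (G h) (U h)) u) :
    IsVeryWeakSolution T c μ φ u₀ g u := by
  obtain ⟨K, hK0, hK⟩ := D.exists_trunc_one
  have hui := D.integrableOn_limit h𝓤 hu
  have hφu : ∀ p : ℝ × Space N, |φ (u p.1 p.2)| ≤ |φ M| + |φ (-M)| := fun p =>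
    D.abs_phi_le (hM _ _)
  have hφm : Measurable fun p : ℝ × Space N => φ (u p.1 p.2) := D.mono.measurable.comp hu.meas
  have hopI : ∀ ψ : ℝ × Space N → ℝ, IsTestFunction T ψ → IntegrableOn (fun p : ℝ × Space N =>
      φ (u p.1 p.2) * diffusionOp c μ (fun y => ψ (p.1, y)) p.2) (cylinder N T) := by
    intro ψ hψ
    simp_rw [mul_comm (φ _)]
    exact integrableOn_mul_bdd
      (integrableOn_diffusionOp_slice hμ hcons hK0 hK hψ.smooth hψ.compact) hφm hφu
  refine ⟨?_, hopI, fun ψ hψ => ?_⟩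
  -- Local integrability is required up to $t=0$, a slice the open cylinder misses but which is
  -- null.
  · refine IntegrableOn.locallyIntegrableOn (hui.mono_set_ae ?_)
    filter_upwards [measure_eq_zero_iff_ae_notMem.1 (volume_null_slice N 0)] with p hp hpm
    refine ⟨⟨lt_of_le_of_ne hpm.1.1 fun h => hp ⟨h.symm, mem_univ _⟩, hpm.1.2⟩, mem_univ _⟩
  · obtain ⟨A, ρ, hA, hb, hbt, hs, -⟩ := exists_test_bounds hψ.smooth hψ.compact
    have i1 : IntegrableOn (fun p : ℝ × Space N => u p.1 p.2 * deriv (fun s => ψ (s, p.2)) p.1)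
        (cylinder N T) :=
      integrableOn_mul_bdd hui (continuous_deriv_time hψ.smooth).measurable hbt
    have i3 : IntegrableOn (fun p : ℝ × Space N => g p.1 p.2 * ψ p) (cylinder N T) :=
      integrableOn_mul_bdd D.int_source hψ.smooth.continuous.measurable hb
    have i12 : IntegrableOn (fun p : ℝ × Space N => u p.1 p.2 * deriv (fun s => ψ (s, p.2)) p.1
      + φ (u p.1 p.2) * diffusionOp c μ (fun y => ψ (p.1, y)) p.2) (cylinder N T) :=
      i1.add (hopI ψ hψ)
    rw [integral_add i12 i3, integral_add i1 (hopI ψ hψ)]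
    have := D.weakEq_limit hμ hcons h𝓤 hM hu hψ
    simp_rw [mul_comm (φ _)]
    exact this

end SchemeData

end GPME

namespace GPME

variable {N : ℕ} {T : ℝ}

/-! ### Conclusion -/

theorem AdmissibleSource.integrableOn {g : ℝ → Space N → ℝ} (hg : AdmissibleSource T g) :
    IntegrableOn (fun p : ℝ × Space N => g p.1 p.2) (cylinder N T) := by
  have hm := hg.meas
  have hb := hg.bound
  refine ⟨hm, ?_⟩
  unfold HasFiniteIntegral
  rw [cylinder, restrict_prod_univ] at hm ⊢
  rw [lintegral_prod _ hm.enorm]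
  refine (lintegral_mono fun t => ?_).trans_lt hb
  simp only [← eLpNorm_one_eq_lintegral_enorm (f := g t)]
  exact le_self_add

/-- Equality a.e. in the cylinder holds on almost every slice, hence at a dense set of times.
Continuity in $L^1$ extends it to every time, endpoints included, as the uniform distance requires.
-/
theorem ae_eq_slice_of_ae_eq_cylinder (hT : 0 < T) {u v : ℝ → Space N → ℝ}
    (hu : ∀ t ∈ Icc 0 T, Integrable (u t)) (hv : ∀ t ∈ Icc 0 T, Integrable (v t))
    (huc : ∀ ε > 0, ∃ η > 0, ∀ s ∈ Icc 0 T, ∀ t ∈ Icc 0 T, |t - s| ≤ η →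
      ∫ x, |u t x - u s x| ≤ ε)
    (hvc : ∀ ε > 0, ∃ η > 0, ∀ s ∈ Icc 0 T, ∀ t ∈ Icc 0 T, |t - s| ≤ η →
      ∫ x, |v t x - v s x| ≤ ε)
    (huv : (fun p : ℝ × Space N => u p.1 p.2)
      =ᵐ[volume.restrict (cylinder N T)] fun p => v p.1 p.2) {t : ℝ} (ht : t ∈ Icc 0 T) :
    u t =ᵐ[volume] v t := by
  rw [cylinder, restrict_prod_univ] at huv
  have h1 := Measure.ae_ae_of_ae_prod huv
  rw [ae_restrict_iff' measurableSet_Ioo] at h1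
  have hd := Measure.dense_of_ae h1
  have hi : Integrable fun x => u t x - v t x := (hu t ht).sub (hv t ht)
  suffices h : ∀ ε > 0, ∫ x, |u t x - v t x| ≤ ε by
    have h0 : ∫ x, |u t x - v t x| = 0 := le_antisymm
      (le_of_forall_pos_le_add fun ε hε => by simpa using h ε hε)
      (integral_nonneg fun _ => abs_nonneg _)
    rw [integral_eq_zero_iff_of_nonneg (fun _ => abs_nonneg _) hi.abs] at h0
    filter_upwards [h0] with x hx
    exact sub_eq_zero.1 (abs_eq_zero.1 hx)
  intro ε hε
  obtain ⟨η₁, hη₁, hb₁⟩ := huc (ε / 2) (by positivity)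
  obtain ⟨η₂, hη₂, hb₂⟩ := hvc (ε / 2) (by positivity)
  have hne : (Metric.ball t (min η₁ η₂) ∩ Ioo 0 T).Nonempty := by
    refine mem_closure_iff_nhds.1 ?_ _ (Metric.ball_mem_nhds t (lt_min hη₁ hη₂))
    rwa [closure_Ioo hT.ne]
  obtain ⟨s, ⟨hst, hsT⟩, hs⟩ := hd.inter_open_nonempty _ (Metric.isOpen_ball.inter isOpen_Ioo) hne
  have hsI := Ioo_subset_Icc_self hsT
  have hts : |t - s| ≤ min η₁ η₂ := by
    rw [abs_sub_comm]; exact (Metric.mem_ball.1 hst).le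
  have c1 := hb₁ s hsI t ht (hts.trans (min_le_left _ _))
  have c2 := hb₂ s hsI t ht (hts.trans (min_le_right _ _))
  have i1 : Integrable fun x => |u t x - u s x| := ((hu t ht).sub (hu s hsI)).abs
  have i2 : Integrable fun x => |v t x - v s x| := ((hv t ht).sub (hv s hsI)).abs
  have : ∫ x, |u t x - v t x| ≤ ∫ x, (|u t x - u s x| + |v t x - v s x|) := by
    refine integral_mono_of_nonneg (ae_of_all _ fun _ => abs_nonneg _) (i1.add i2) ?_
    filter_upwards [hs hsT] with x hx
    have e : u t x - v t x = (u t x - u s x) - (v t x - v s x) := by rw [hx]; ring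
    rw [e]
    exact abs_sub _ _
  rw [integral_add i1 i2] at this
  linarith

theorem distCtLp_congr {r : ENNReal} {w u v : ℝ → Space N → ℝ}
    (h : ∀ t ∈ Icc 0 T, u t =ᵐ[volume] v t) : distCtLp T r w u = distCtLp T r w v :=
  iSup_congr fun t => iSup_congr fun ht => eLpNorm_congr_ae ((ae_eq_refl (w t)).sub (h t ht))

theorem schemeData_of_admissible (hN : 1 ≤ N) (hT : 0 < T) {γ : NNReal} (hγ : 0 < γ) (hγ' : γ ≤ 1)
    {φ : ℝ → ℝ} (hφ : AdmissibleNonlinearity γ φ) {u₀ : Space N → ℝ} (hu₀ : AdmissibleInitial u₀)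
    {g : ℝ → Space N → ℝ} (hg : AdmissibleSource T g) {S : ℝ → Stencil N}
    (hS :
      ((∀ h > 0, ∀ ψ x, (S h).op h ψ x = discreteLaplacian h ψ x)
          ∧ LevyWeights S ∧ max ((N : ℝ) - 2) 0 / N < γ)
      ∨ (FirstMomentWeights S ∧ ((N : ℝ) - 1) / N < γ)
      ∨ (∃ α : ℝ, 0 < α ∧ α < 2 ∧ FractionalWeights α S ∧ max ((N : ℝ) - α) 0 / N < γ))
    {G : ℝ → TimeGrid T} (hG : Tendsto (fun h => (G h).mesh) (𝓝[>] 0) (𝓝 0))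
    {U : ℝ → ℕ → Idx N → ℝ} (hU : ∀ h > 0, IsSchemeSolution h (S h) (G h) φ u₀ g (U h)) :
    SchemeData (γ : ℝ) φ u₀ g S G U where
  pos_time := hT
  pos_exp := hγ
  exp_le := hγ'
  mono := hφ.mono
  holder M := by
    obtain ⟨C, hC⟩ := hφ.holder (Icc (-M) M) isCompact_Icc
    refine ⟨C, C.2, fun a b ha hb => ?_⟩
    have := hC.dist_le (abs_le.1 ha) (abs_le.1 hb)
    rwa [Real.dist_eq, Real.dist_eq] at this
  int_initial := memLp_one_iff_integrable.1 hu₀.memL1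
  int_source := hg.integrableOn
  mesh := hG
  sol := hU
  bdd := by
    obtain ⟨M, hM, hb⟩ := exists_scheme_bound hφ.mono hu₀ hg
    exact ⟨M, hM, fun h hh j hj β => hb h _ _ _ hh (hU h hh) j hj β⟩
  decay := exists_trunc_decay hN hS

namespace SchemeData

variable {γ : ℝ} {φ : ℝ → ℝ} {u₀ : Space N → ℝ} {g : ℝ → Space N → ℝ}
  {S : ℝ → Stencil N} {G : ℝ → TimeGrid T} {U : ℝ → ℕ → Idx N → ℝ}
variable (D : SchemeData γ φ u₀ g S G U)
include D

theorem memSolutionClass_limit {r : ENNReal} (hr : 1 ≤ r) (hr' : r ≠ ⊤) {𝓤 : Ultrafilter ℝ}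
    (h𝓤 : (𝓤 : Filter ℝ) ≤ 𝓝[>] 0) {u : ℝ → Space N → ℝ} {M : ℝ} (hM : ∀ t x, |u t x| ≤ M)
    (hu : IsUniformLimit T 𝓤 (fun h => interpolant h (G h) (U h)) u) :
    MemSolutionClass T r u where
  memL1 := memLp_one_iff_integrable.2 (D.integrableOn_limit h𝓤 hu)
  memLinfty := memLp_top_of_bound hu.meas.aestronglyMeasurable M (ae_of_all _ fun _ => hM _ _)
  memCt := D.memCtLp_limit hr hr' h𝓤 hM hu

theorem tendsto_distCtLp_limit {r : ENNReal} (hr : 1 ≤ r) (hr' : r ≠ ⊤) {𝓤 : Ultrafilter ℝ}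
    (h𝓤 : (𝓤 : Filter ℝ) ≤ 𝓝[>] 0) {u : ℝ → Space N → ℝ} {M : ℝ} (hM : ∀ t x, |u t x| ≤ M)
    (hu : IsUniformLimit T 𝓤 (fun h => interpolant h (G h) (U h)) u) :
    Tendsto (fun h => distCtLp T r (interpolant h (G h) (U h)) u) 𝓤 (𝓝 0) := by
  obtain ⟨B, -, hB⟩ := D.bdd
  exact hu.tendsto_distCtLp hr hr' hM (B := B)
    (Eventually.mono (h𝓤 self_mem_nhdsWithin) fun h hh t ht =>
      ⟨D.integrable_interpolant hh ht, D.abs_interpolant_le (hB h hh) ht⟩)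

end SchemeData

end GPME

theorem theorem3p8 {N : ℕ} (hN : 1 ≤ N) {T : ℝ} (hT : 0 < T)
    (r : ENNReal) (hr : 1 ≤ r) (hr' : r ≠ ⊤)
    -- the equation and its data
    (γ : NNReal) (hγ : 0 < γ) (hγ' : γ ≤ 1)
    (φ : ℝ → ℝ) (hφ : GPME.AdmissibleNonlinearity γ φ)
    (c : ℝ) (hc : c = 0 ∨ c = 1)
    (μ : Measure (GPME.Space N)) (hμ : GPME.IsSymmLevyMeasure μ)
    (u₀ : GPME.Space N → ℝ) (hu₀ : GPME.AdmissibleInitial u₀)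
    (g : ℝ → GPME.Space N → ℝ) (hg : GPME.AdmissibleSource T g)
    -- the discrete operators, in one of the three cases
    (S : ℝ → GPME.Stencil N)
    (hS :
      ((∀ h > 0, ∀ ψ x, (S h).op h ψ x = GPME.discreteLaplacian h ψ x)
          ∧ GPME.LevyWeights S ∧ max ((N : ℝ) - 2) 0 / N < γ)
      ∨ (GPME.FirstMomentWeights S ∧ ((N : ℝ) - 1) / N < γ)
      ∨ (∃ α : ℝ, 0 < α ∧ α < 2 ∧ GPME.FractionalWeights α S
          ∧ max ((N : ℝ) - α) 0 / N < γ))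
    (hcons : GPME.Consistent c μ S)
    -- the time grids and the solutions of the schemes
    (G : ℝ → GPME.TimeGrid T) (hG : Tendsto (fun h => (G h).mesh) (𝓝[>] 0) (𝓝 0))
    (U : ℝ → ℕ → GPME.Idx N → ℝ)
    (hU : ∀ h > 0, GPME.IsSchemeSolution h (S h) (G h) φ u₀ g (U h))
    -- uniqueness for the limit problem
    (huniq : ∀ v w : ℝ → GPME.Space N → ℝ,
      GPME.MemSolutionClass T r v → GPME.IsVeryWeakSolution T c μ φ u₀ g v →
      GPME.MemSolutionClass T r w → GPME.IsVeryWeakSolution T c μ φ u₀ g w →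
      (fun p : ℝ × GPME.Space N => v p.1 p.2)
        =ᵐ[volume.restrict (GPME.cylinder N T)] fun p => w p.1 p.2) :
    (∀ h > 0, GPME.MemCtLp T r (GPME.interpolant h (G h) (U h))) ∧
    ∃ u : ℝ → GPME.Space N → ℝ,
      GPME.MemSolutionClass T r u ∧
      GPME.IsVeryWeakSolution T c μ φ u₀ g u ∧
      (∀ v : ℝ → GPME.Space N → ℝ,
        GPME.MemSolutionClass T r v → GPME.IsVeryWeakSolution T c μ φ u₀ g v →
        (fun p : ℝ × GPME.Space N => v p.1 p.2)
          =ᵐ[volume.restrict (GPME.cylinder N T)] fun p => u p.1 p.2) ∧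
      Tendsto (fun h => GPME.distCtLp T r (GPME.interpolant h (G h) (U h)) u)
        (𝓝[>] 0) (𝓝 0) := by
  have D := GPME.schemeData_of_admissible hN hT hγ hγ' hφ hu₀ hg hS hG hU
  refine ⟨fun h hh => D.memCtLp_interpolant hr hr' hh, ?_⟩
  -- Existence: any ultrafilter finer than $h\to0^+$ produces a solution.
  obtain ⟨u, ⟨M, -, hM⟩, hu⟩ := D.exists_limit _ (Ultrafilter.of_le (𝓝[>] (0 : ℝ)))
  have hmem := D.memSolutionClass_limit hr hr' (Ultrafilter.of_le _) hM hu
  have hsol := D.isVeryWeakSolution_limit hμ hcons (Ultrafilter.of_le _) hM hu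
  refine ⟨u, hmem, hsol, fun v hv hvs => huniq v u hv hvs hmem hsol, ?_⟩
  -- Convergence of the whole family is tested along each ultrafilter. The limit there is again a
  -- solution, so uniqueness identifies it with $u$ at every time.
  refine (tendsto_iff_ultrafilter _ _ _).2 fun 𝓥 h𝓥 => ?_
  obtain ⟨v, ⟨B, -, hB⟩, hv⟩ := D.exists_limit 𝓥 h𝓥
  have huv := huniq u v hmem hsol (D.memSolutionClass_limit hr hr' h𝓥 hB hv)
    (D.isVeryWeakSolution_limit hμ hcons h𝓥 hB hv)
  refine (D.tendsto_distCtLp_limit hr hr' h𝓥 hB hv).congr fun h => ?_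
  exact (GPME.distCtLp_congr fun t ht => GPME.ae_eq_slice_of_ae_eq_cylinder hT hu.integrable
    hv.integrable (fun ε hε => D.exists_limit_time_le (Ultrafilter.of_le _) hu hε)
    (fun ε hε => D.exists_limit_time_le h𝓥 hv hε) huv ht).symm
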